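/- Let $k,l\ge 1$ and let $f,g\in\mathbb{C}[z]$ be polynomials of degrees $k$ and $l$ whose roots $r_1,\dots,r_k$ (of $f$) and $s_1,\dots,s_l$ (of $g$) are pairwise distinct ($r_i\neq r_{i'}$, $s_j\neq s_{j'}$, $r_i\ne s_j$) and non-zero. Let $$X=\{(u_1,v_1,u_2,v_2,z)\in\mathbb{C}^4\times\mathbb{C}^\times \mid u_1v_1=f(z),\ u_2v_2=g(z)\}$$ be the deformed orbifolded conifold, with the restriction $\omega$ of the standard symplectic form, and let $X^*$ be the closure of $X$ in $\mathbb{P}^2\times\mathbb{P}^2\times\mathbb{P}^1$ under $(u_1,v_1,u_2,v_2,z)\mapsto([u_1:v_1:1],[u_2:v_2:1],[z:1])$. Let $B=[-\infty,\infty]^2\times[0,\infty]$ with coordinates $(b_1,b_2,b_3)$, and let $\pi$ be given on $X$ by $$\pi(u_1,v_1,u_2,v_2,z)=\Big(\tfrac12(|u_1|^2-|v_1|^2),\ \tfrac12(|u_2|^2-|v_2|^2),\ |z|\Big)\in B .$$ For $b\in B$ the fibre $F_b\subset X^*$ is the set of all $p\in X^*$ such that $(p,b)$ lies in the closure of the graph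 of $\pi|_X$ in $X^*\times B$. The discriminant locus is the set of those $b\in B$ whose fibre $F_b$ contains a point that is not regular; a point is regular if $X^*$ is a complex submanifold near it and $\pi$ extends near it to a smooth map to the manifold with corners $B$ whose differential at the point is surjective. Let $B_0\subset B$ be the complement of the discriminant locus. Then: 1. The discriminant locus is $$\partial B\ \cup\ \bigcup_{i=1}^k\{b_1=0,\ b_3=|r_i|\}\ \cup\ \bigcup_{j=1}^l\{b_2=0,\ b_3=|s_j|\}\subset B .$$ 2. The form $\Omega=d\log u_1\wedge d\log u_2\wedge d\log z$ extends from $\{u_1u_2\ne0\}$ to a nowhere-vanishing holomorphic volume form on $X$, and on the smooth locus of $X^*$ it is meromorphic, without zeros, with poles exactly along the complement of $X$. The fibration $\pi$ is special with respect to $\Omega$: for all $b\in B_0$ the fibre $F_b$ lies in $X$, is Lagrangian for $\omega$, and $\mathrm{Im}(e^{\sqrt{-1}\theta}\Omega)|_{F_b}=0$ for a constant $\theta$ that does not depend on $b$. 3. Let the wall $H\subset B_0$ be the set of $b\in B_0$ such that $F_b$ bounds a non-constant holomorphic disc (in the smooth locus of $X^*$) of Maslov index $0$. Then $$H=B_0\cap\Big(\bigcup_{i=1}^k\{b_3=|r_i|\}\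 \cup\ \bigcup_{j=1}^l\{b_3=|s_j|\}\Big).$$ -/

import Mathlib

open scoped LinearAlgebra.Projectivization Polynomial ENNReal Topology ContDiff

noncomputable section

namespace OrbConifold

/-- The quotient topology on a projective space. -/
instance projTopology {K V : Type*} [DivisionRing K] [AddCommGroup V] [Module K V]
    [TopologicalSpace V] : TopologicalSpace (ℙ K V) :=
  inferInstanceAs (TopologicalSpace (Quotient (projectivizationSetoid K V)))

/-- The ambient space `ℙ² × ℙ² × ℙ¹` of the compactification. -/
abbrev Ambient : Type := ℙ ℂ (Fin 3 → ℂ) × ℙ ℂ (Fin 3 → ℂ) × ℙ ℂ (Fin 2 → ℂ)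

/-- Homogeneous coordinates on `ℙ² × ℙ² × ℙ¹`. -/
abbrev HomCoord : Type := (Fin 3 → ℂ) × (Fin 3 → ℂ) × (Fin 2 → ℂ)

/-- The base `B = [-∞, ∞] × [-∞, ∞] × [0, ∞]`, with coordinates `b₁ = b.1`, `b₂ = b.2.1`,
`b₃ = b.2.2`. -/
abbrev Base : Type := EReal × EReal × ℝ≥0∞

/-- The boundary `∂B`. -/
def baseBoundary : Set Base :=
  {b | b.1 = ⊥ ∨ b.1 = ⊤ ∨ b.2.1 = ⊥ ∨ b.2.1 = ⊤ ∨ b.2.2 = 0 ∨ b.2.2 = ⊤}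

/-- `arctan`, extended to a homeomorphism from `[-∞, ∞]` to `[-π/2, π/2]`. -/
def compress (x : EReal) : ℝ :=
  if x = ⊤ then Real.pi / 2 else if x = ⊥ then -(Real.pi / 2) else Real.arctan x.toReal

/-- The global chart of `B` as a manifold with corners: it identifies `B` with the box
`[-π/2, π/2] × [-π/2, π/2] × [0, π/2]`. -/
def baseChart (b : Base) : Fin 3 → ℝ :=
  ![compress b.1, compress b.2.1, compress (b.2.2 : EReal)]

/-- The deformed orbifolded conifold `u₁v₁ = f(z)`, `u₂v₂ = g(z)` in `ℂ⁴ × ℂˣ`.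
A point is `x = (u₁, v₁, u₂, v₂, z)`. -/
def conifold (f g : ℂ[X]) : Set (Fin 5 → ℂ) :=
  {x | x 0 * x 1 = f.eval (x 4) ∧ x 2 * x 3 = g.eval (x 4) ∧ x 4 ≠ 0}

/-- The inclusion `(u₁, v₁, u₂, v₂, z) ↦ ([u₁ : v₁ : 1], [u₂ : v₂ : 1], [z : 1])`. -/
def embed (x : Fin 5 → ℂ) : Ambient :=
  (Projectivization.mk ℂ ![x 0, x 1, 1] (fun h => by simpa using congrFun h 2),
   Projectivization.mk ℂ ![x 2, x 3, 1] (fun h => by simpa using congrFun h 2),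
   Projectivization.mk ℂ ![x 4, 1] (fun h => by simpa using congrFun h 1))

/-- The conifold as a subset of `ℙ² × ℙ² × ℙ¹`. -/
def openPart (f g : ℂ[X]) : Set Ambient := embed '' conifold f g

/-- The compactification: the closure of the conifold in `ℙ² × ℙ² × ℙ¹`. -/
def compactification (f g : ℂ[X]) : Set Ambient := closure (openPart f g)

/-- The fibration
`π(u₁, v₁, u₂, v₂, z) = ((|u₁|² - |v₁|²)/2, (|u₂|² - |v₂|²)/2, |z|)` on the conifold. -/
def fibration (x : Fin 5 → ℂ) : Base :=
  (((1 / 2 * (‖x 0‖ ^ 2 - ‖x 1‖ ^ 2) : ℝ) : EReal),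
   ((1 / 2 * (‖x 2‖ ^ 2 - ‖x 3‖ ^ 2) : ℝ) : EReal),
   ‖x 4‖ₑ)

/-- The fibre over `b` of the fibration on the compactification: the points `p` of the
compactification such that `(p, b)` is in the closure of the graph of `π`. Where `π` extends
continuously this is the fibre of the extension; `π` has no continuous extension to the points
with `z = ∞` and `|u₁| = |v₁|` or `|u₂| = |v₂|`. -/
def fiber (f g : ℂ[X]) (b : Base) : Set Ambient :=
  {p | (p, b) ∈ closure ((fun x => (embed x, fibration x)) '' conifold f g)}

/-- The set of all homogeneous coordinates of the points of `S`. -/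
def cone (S : Set Ambient) : Set HomCoord :=
  {y | ∃ (h₁ : y.1 ≠ 0) (h₂ : y.2.1 ≠ 0) (h₃ : y.2.2 ≠ 0),
    (Projectivization.mk ℂ y.1 h₁, Projectivization.mk ℂ y.2.1 h₂,
      Projectivization.mk ℂ y.2.2 h₃) ∈ S}

/-- The affine coordinates `(u₁, v₁, u₂, v₂, z)` of the point with homogeneous coordinates `y`. -/
def affineCoord (y : HomCoord) : Fin 5 → ℂ :=
  ![y.1 0 / y.1 2, y.1 1 / y.1 2, y.2.1 0 / y.2.1 2, y.2.1 1 / y.2.1 2, y.2.2 0 / y.2.2 1]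

/-- The compactification is, near the point with homogeneous coordinates `y`, a complex
submanifold of codimension two in `ℙ² × ℙ² × ℙ¹`. -/
def IsSmoothPoint (f g : ℂ[X]) (y : HomCoord) : Prop :=
  y ∈ cone (compactification f g) ∧
  ∃ F : HomCoord → (Fin 2 → ℂ), AnalyticAt ℂ F y ∧ Function.Surjective (fderiv ℂ F y) ∧
    ∀ᶠ w in 𝓝 y, (w ∈ cone (compactification f g) ↔ F w = 0)

/-- Near the point with homogeneous coordinates `y` the compactification is smooth and the
fibration extends to a smooth map to `B` whose differential at the point is surjective. -/
def IsRegularPoint (f g : ℂ[X]) (y : HomCoord) : Prop :=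
  IsSmoothPoint f g y ∧
  ∃ G : HomCoord → (Fin 3 → ℝ), ContDiffAt ℝ ∞ G y ∧
    (∀ᶠ w in 𝓝 y, w ∈ cone (openPart f g) → G w = baseChart (fibration (affineCoord w))) ∧
    ∀ η : Fin 3 → ℝ, ∃ t ∈ tangentConeAt ℝ (cone (compactification f g)) y, fderiv ℝ G y t = η

/-- The discriminant locus: the points of `B` whose fibre contains a point that is not
regular. -/
def discriminant (f g : ℂ[X]) : Set Base :=
  {b | ∃ y ∈ cone (fiber f g b), ¬ IsRegularPoint f g y}

/-- `B₀`, the complement of the discriminant locus. -/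
def regularValues (f g : ℂ[X]) : Set Base := (discriminant f g)ᶜ

/-! ### The volume form and special Lagrangian fibres -/

/-- The standard symplectic form of `ℂ⁵`. -/
def stdSymplectic (v w : Fin 5 → ℂ) : ℝ := ∑ i, ((starRingEnd ℂ) (v i) * w i).im

/-- `Ω` is the holomorphic form `d log u₁ ∧ d log u₂ ∧ d log z` on the conifold: it agrees with
it on tangent vectors at all points with `u₁ ≠ 0` and `u₂ ≠ 0`, and it is holomorphic at all
points (as the restriction of a holomorphic form in a neighbourhood). Since `u₁u₂ ≠ 0` is dense,
this determines `Ω` on all tangent spaces of the conifold. -/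
structure IsLogVolumeForm (f g : ℂ[X]) (Ω : (Fin 5 → ℂ) → (Fin 5 → ℂ) [⋀^Fin 3]→L[ℂ] ℂ) :
    Prop where
  holomorphic : ∀ t, AnalyticOnNhd ℂ (fun x => Ω x t) (conifold f g)
  eq_log : ∀ x ∈ conifold f g, x 0 ≠ 0 → x 2 ≠ 0 →
    ∀ t : Fin 3 → (Fin 5 → ℂ), (∀ j, t j ∈ tangentConeAt ℂ (conifold f g) x) →
      Ω x t = Matrix.det (Matrix.of fun j => ![t j 0 / x 0, t j 2 / x 2, t j 4 / x 4])

/-- `Ω` vanishes at no point of the conifold. -/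
def IsNowhereVanishing (f g : ℂ[X]) (Ω : (Fin 5 → ℂ) → (Fin 5 → ℂ) [⋀^Fin 3]→L[ℂ] ℂ) : Prop :=
  ∀ x ∈ conifold f g, ∃ t : Fin 3 → (Fin 5 → ℂ),
    (∀ j, t j ∈ tangentConeAt ℂ (conifold f g) x) ∧ Ω x t ≠ 0

/-- At each smooth point of the compactification that does not lie on the conifold, `Ω` is
meromorphic with pole divisor supported exactly on the complement of the conifold, and without
zeros: locally `s • Ω = Θ` with `s` holomorphic, vanishing exactly on that complement, and `Θ` a
holomorphic form that does not vanish at the point. (`Ω` is pulled back to homogeneous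
coordinates.) -/
def HasPolesAlongBoundary (f g : ℂ[X]) (Ω : (Fin 5 → ℂ) → (Fin 5 → ℂ) [⋀^Fin 3]→L[ℂ] ℂ) :
    Prop :=
  ∀ y, IsSmoothPoint f g y → y ∉ cone (openPart f g) →
    ∃ (s : HomCoord → ℂ) (Θ : HomCoord → HomCoord [⋀^Fin 3]→L[ℂ] ℂ),
      AnalyticAt ℂ s y ∧ (∀ t, AnalyticAt ℂ (fun w => Θ w t) y) ∧
      (∀ᶠ w in 𝓝 y, w ∈ cone (compactification f g) → (s w = 0 ↔ w ∉ cone (openPart f g))) ∧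
      (∀ᶠ w in 𝓝 y, w ∈ cone (openPart f g) →
        ∀ t : Fin 3 → HomCoord, (∀ j, t j ∈ tangentConeAt ℂ (cone (compactification f g)) w) →
          s w * Ω (affineCoord w) (fun j => fderiv ℂ affineCoord w (t j)) = Θ w t) ∧
      ∃ t : Fin 3 → HomCoord, (∀ j, t j ∈ tangentConeAt ℂ (cone (compactification f g)) y) ∧
        Θ y t ≠ 0

/-- The part of the fibre over `b` in the conifold, in affine coordinates. -/
def affineFiber (f g : ℂ[X]) (b : Base) : Set (Fin 5 → ℂ) :=
  {x | x ∈ conifold f g ∧ embed x ∈ fiber f g b}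

/-- The regular fibres lie in the conifold, are Lagrangian for the restriction of the standard
symplectic form, and `Ω` has the same constant phase on all of them. -/
def IsSpecialLagrangianFibration (f g : ℂ[X])
    (Ω : (Fin 5 → ℂ) → (Fin 5 → ℂ) [⋀^Fin 3]→L[ℂ] ℂ) : Prop :=
  ∃ θ : ℝ, ∀ b ∈ regularValues f g, fiber f g b ⊆ openPart f g ∧
    ∀ x ∈ affineFiber f g b, ∃ T : Submodule ℝ (Fin 5 → ℂ),
      (T : Set (Fin 5 → ℂ)) = tangentConeAt ℝ (affineFiber f g b) x ∧
      Module.finrank ℝ T = 3 ∧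
      (∀ v ∈ T, ∀ w ∈ T, stdSymplectic v w = 0) ∧
      ∀ t : Fin 3 → (Fin 5 → ℂ), (∀ j, t j ∈ T) →
        (Complex.exp (θ * Complex.I) * Ω x t).im = 0

/-! ### Holomorphic discs, the Maslov index and the wall -/

/-- A holomorphic disc in the smooth locus of the compactification with boundary on the fibre over
`b`: continuous on the closed unit disc and holomorphic inside, written in homogeneous coordinates
(a disc whose boundary lies on a regular fibre always has such a lift). -/
structure IsHolomorphicDisc (f g : ℂ[X]) (b : Base) (u : ℂ → HomCoord) : Prop where
  diffContOnCl : DiffContOnCl ℂ u (Metric.ball 0 1)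
  smooth : ∀ ζ ∈ Metric.closedBall (0 : ℂ) 1, IsSmoothPoint f g (u ζ)
  boundary : ∀ ζ ∈ Metric.sphere (0 : ℂ) 1, u ζ ∈ cone (fiber f g b)

/-- The map to `ℙ² × ℙ² × ℙ¹` with homogeneous coordinates `u` is constant on the closed disc. -/
def IsConstantDisc (u : ℂ → HomCoord) : Prop :=
  ∃ p : Ambient, ∀ ζ ∈ Metric.closedBall (0 : ℂ) 1, u ζ ∈ cone {p}

/-- The Euler vectors at `y`; they span the kernel of the differential of the projection from
homogeneous coordinates to `ℙ² × ℙ² × ℙ¹`. -/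
def euler (y : HomCoord) : Fin 3 → HomCoord := ![(y.1, 0, 0), (0, y.2.1, 0), (0, 0, y.2.2)]

/-- The Maslov index of the disc `u` with boundary on the fibre over `b` is `m`: there is a complex
frame `e₁, e₂, e₃` of the pull-back by `u` of the tangent bundle (tangent vectors in homogeneous
coordinates, modulo the Euler vectors), such that `det²/|det|²` of the real tangent spaces of the
fibre along the boundary circle, relative to this frame, has winding number `m`. The columns of
`a` are coordinates of tangent vectors of the fibre, and `φ` is a continuous choice of argument. -/
def HasMaslovIndex (f g : ℂ[X]) (b : Base) (u : ℂ → HomCoord) (m : ℤ) : Prop :=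
  ∃ e : Fin 3 → ℂ → HomCoord,
    (∀ i, ContinuousOn (e i) (Metric.closedBall 0 1)) ∧
    (∀ ζ ∈ Metric.closedBall (0 : ℂ) 1,
      (∀ i, e i ζ ∈ tangentConeAt ℂ (cone (compactification f g)) (u ζ)) ∧
      LinearIndependent ℂ (Sum.elim (euler (u ζ)) (fun i => e i ζ))) ∧
    ∃ φ : ℝ → ℝ, Continuous φ ∧ φ (2 * Real.pi) = φ 0 + 2 * Real.pi * m ∧
      ∀ (θ : ℝ) (a : Matrix (Fin 3) (Fin 3) ℂ),
        (∀ j, ∑ i, a i j • e i (Complex.exp (θ * Complex.I)) ∈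
          tangentConeAt ℝ (cone (fiber f g b)) (u (Complex.exp (θ * Complex.I)))) →
        a.det ^ 2 = (‖a.det‖ : ℂ) ^ 2 * Complex.exp (φ θ * Complex.I)

/-- The wall: the points of `B₀` whose fibre bounds a non-constant holomorphic disc of Maslov
index `0`. -/
def wall (f g : ℂ[X]) : Set Base :=
  {b | b ∈ regularValues f g ∧
    ∃ u : ℂ → HomCoord, IsHolomorphicDisc f g b u ∧ ¬ IsConstantDisc u ∧ HasMaslovIndex f g b u 0}

end OrbConifold

end

/-! Everything is computed on the cone of homogeneous coordinates (U₁,V₁,W₁; U₂,V₂,W₂; z₀,z₁): the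
quotient map is open and continuous, so taking cones commutes with closures. Where z₁ ≠ 0 the
closure of X is cut out by U₁V₁ = W₁² f(z) and U₂V₂ = W₂² g(z), and these equations have independent
differentials because fg is squarefree. Over z = ∞ the closure is never smooth: the reflections Wᵢ ↦
-Wᵢ preserve X and every point with W₁ = W₂ = z₁ = 0 lies in the closure, so the differential of any
pair of defining functions would be a multiple of dz₁ (`not_isSmoothPoint_of_infinite`).

Discriminant. On X the differential of π is onto exactly where (u₁,v₁) ≠ 0 and (u₂,v₂) ≠ 0
(`isRegularPoint_iff`). No smooth point outside X is regular (`not_isRegularPoint`): where Wᵢ = 0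
the compressed coordinate reaches ±π/2 to second order, and where z = 0 the function |z| has no
differentiable extension with non-zero differential. Fibres over the interior of B lie in X by a
limit argument, and fibres over ∂B are non-empty by compactness and lie outside X.

Volume form. If A fg + B (fg)' = 1, then z⁻¹ du₁ ∧ du₂ ∧ (A v₁v₂ dz + B d(v₁v₂)) is holomorphic on X
and agrees with d log u₁ ∧ d log u₂ ∧ d log z; density of {u₁u₂ ≠ 0} gives uniqueness on tangent
vectors. Contracting the determinant of ℂ⁸ with Euler vectors and two normal vectors gives W₁W₂z₀z₁
Ω up to a non-vanishing factor (`homDet_eq`), which exhibits the poles. In the coframe (ū du - v̄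
dv)/(|u|² + |v|²) for the two pairs, together with dz/z, the form Ω is a determinant, and these
functionals are imaginary on fibre tangents; so Ω is imaginary there. The fibres are Lagrangian
because π consists of moment maps for the two circle actions, and |z|.

Wall. Because Ω has constant phase on the fibres, the Maslov index compares a non-vanishing
continuous function on the disc with the boundary values of s = W₁W₂z₀z₁. Index zero makes the
argument of s periodic on the circle, so s has no zero and the disc stays in X
(`mem_openPart_of_maslovIndex_zero`). There z never vanishes and has constant modulus on the circle,
hence is constant; if f(z) and g(z) are non-zero, the moment maps force the other coordinates to be
constant too. Conversely, over a root of f the disc (ζu₁, ζv₁, u₂, v₂, z) carries a frame of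
constant volume, hence has index zero; roots of g are symmetric (`mem_wall_of_disc`). -/

noncomputable section

namespace OrbConifold

/-! ### Tangent cones and differentials along subsets. -/

section Analysis

open Set Filter

section TangentCone

variable {𝕜 : Type*} [RCLike 𝕜] {E F : Type*} [NormedAddCommGroup E] [NormedSpace 𝕜 E]
  [NormedAddCommGroup F] [NormedSpace 𝕜 F]

/-- The tangent cone of a set that is locally a regular level set is the kernel of the
derivative. -/
theorem tangentConeAt_eq_ker [CompleteSpace E] [FiniteDimensional 𝕜 F] {S : Set E} {y : E}
    {G : E → F} {G' : E →L[𝕜] F} (hG : HasStrictFDerivAt G G' y) (hy : G y = 0)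
    (hsurj : Function.Surjective G') (hS : ∀ᶠ w in 𝓝 y, (w ∈ S ↔ G w = 0)) :
    tangentConeAt 𝕜 S y = {t | G' t = 0} := by
  ext t
  constructor
  · intro ht
    obtain ⟨α, l, hl, c, d, hd, hds, hcd⟩ := exists_fun_of_mem_tangentConeAt ht
    have h1 := (hG.hasFDerivAt.hasFDerivWithinAt (s := univ)).lim hd (by simp) hcd
    have hyd : Tendsto (fun n => y + d n) l (𝓝 y) := by
      simpa using tendsto_const_nhds.add hd
    refine tendsto_nhds_unique h1 (tendsto_const_nhds.congr' ?_)
    filter_upwards [hds, hyd.eventually hS] with n h2 h3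
    rw [h3.1 h2, hy]; simp
  · intro ht
    -- The implicit function parametrises the level set by the kernel and has the inclusion as
    -- derivative at 0, so it carries kernel vectors to tangent vectors.
    have hr : G'.range = ⊤ := LinearMap.range_eq_top.2 hsurj
    set φ := HasStrictFDerivAt.implicitFunction G G' hG hr (G y) with hφ
    have hφ' : HasStrictFDerivAt φ G'.ker.subtypeL 0 := hG.to_implicitFunction hr
    have hφ0 : φ 0 = y := by
      exact hG.implicitFunction_apply_image hr
    have h0 : ∀ᶠ k in 𝓝 (0 : G'.ker), G (φ k) = 0 := by
      have h1 := hG.map_implicitFunction_eq hr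
      have h2 : Tendsto (fun k : G'.ker => (G y, k)) (𝓝 0) (𝓝 (G y, 0)) := by
        exact (Continuous.prodMk_right (G y)).tendsto 0
      filter_upwards [h2.eventually h1] with k hk
      rw [← hy]; exact hk
    have hφc : Tendsto φ (𝓝 0) (𝓝 y) := by
      have := hφ'.continuousAt.tendsto
      rwa [hφ0] at this
    have hmem : ∀ᶠ k in 𝓝 (0 : G'.ker), φ k ∈ S := by
      filter_upwards [h0, hφc.eventually hS] with k h1 h2
      exact h2.2 h1
    have htk : (⟨t, ht⟩ : G'.ker) ∈ tangentConeAt 𝕜 {k : G'.ker | φ k ∈ S} 0 := by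
      rw [tangentConeAt_of_mem_nhds hmem]; trivial
    have h3 := (hφ'.hasFDerivAt.hasFDerivWithinAt
      (s := {k : G'.ker | φ k ∈ S})).mapsTo_tangent_cone htk
    rw [hφ0] at h3
    exact tangentConeAt_mono (by rintro _ ⟨k, hk, rfl⟩; exact hk) h3

/-- A function whose square-root-size increments are controlled by those of another function along
`S` has its derivative controlled along the tangent cone. -/
theorem norm_fderiv_eq_of_norm_sub_eq {F₂ : Type*} [NormedAddCommGroup F₂] [NormedSpace 𝕜 F₂]
    {S : Set E} {y t : E} {G : E → F} {G' : E →L[𝕜] F} {H : E → F₂} {H' : E →L[𝕜] F₂}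
    (hG : HasFDerivAt G G' y) (hH : HasFDerivAt H H' y) {C : ℝ → ℝ} (hC : HasDerivAt C 1 0)
    (hC0 : C 0 = 0)
    (hS : ∀ᶠ w in 𝓝 y, w ∈ S → ‖G w - G y‖ = C ‖H w - H y‖) (ht : t ∈ tangentConeAt 𝕜 S y) :
    ‖G' t‖ = ‖H' t‖ := by
  obtain ⟨α, l, hl, c, d, hd, hds, hcd⟩ := exists_fun_of_mem_tangentConeAt ht
  have h1 := ((hG.hasFDerivWithinAt (s := univ)).lim hd (by simp) hcd).norm
  have h2 := ((hH.hasFDerivWithinAt (s := univ)).lim hd (by simp) hcd).norm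
  have hyd : Tendsto (fun n => y + d n) l (𝓝 y) := by
    simpa using tendsto_const_nhds.add hd
  have h3 : Tendsto (fun n => ‖H (y + d n) - H y‖) l (𝓝 0) := by
    have := ((hH.continuousAt.tendsto.comp hyd).sub_const (H y)).norm
    simpa using this
  -- As C has derivative 1 at 0, C(s) - s = o(s); after scaling by `c n` the error still tends to 0.
  have h4 : (fun n => C ‖H (y + d n) - H y‖ - ‖H (y + d n) - H y‖) =o[l]
      (fun n => ‖H (y + d n) - H y‖) := by
    have := (hasDerivAt_iff_isLittleO.1 hC).comp_tendsto h3
    simpa [Function.comp_def, hC0] using this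
  have h5 : Tendsto (fun n => ‖c n‖ * (C ‖H (y + d n) - H y‖ - ‖H (y + d n) - H y‖)) l (𝓝 0) := by
    have h6 : (fun n => ‖c n‖ * (C ‖H (y + d n) - H y‖ - ‖H (y + d n) - H y‖)) =o[l]
        (fun n => ‖c n‖ * ‖H (y + d n) - H y‖) := (Asymptotics.isBigO_refl _ _).mul_isLittleO h4
    have h7 : (fun n => ‖c n‖ * ‖H (y + d n) - H y‖) =O[l] (fun _ => (1 : ℝ)) := by
      simp only [norm_smul] at h2
      exact h2.isBigO_one ℝ
    exact (Asymptotics.isLittleO_one_iff ℝ).1 (h6.trans_isBigO h7)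
  have h8 : Tendsto (fun n => ‖c n • (G (y + d n) - G y)‖) l (𝓝 (0 + ‖H' t‖)) := by
    refine (h5.add h2).congr' ?_
    filter_upwards [hds, hyd.eventually hS] with n h9 h10
    rw [norm_smul, norm_smul, h10 h9]; ring
  rw [zero_add] at h8
  exact tendsto_nhds_unique h1 h8

/-- A function that is constant to second order along `S` has zero derivative on the tangent
cone. -/
theorem fderiv_eq_zero_of_quadratic {S : Set E} {y t : E} {G : E → F} {G' : E →L[𝕜] F}
    (hG : HasFDerivAt G G' y) {C : ℝ}
    (hS : ∀ᶠ w in 𝓝 y, w ∈ S → ‖G w - G y‖ ≤ C * ‖w - y‖ ^ 2) (ht : t ∈ tangentConeAt 𝕜 S y) :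
    G' t = 0 := by
  obtain ⟨α, l, hl, c, d, hd, hds, hcd⟩ := exists_fun_of_mem_tangentConeAt ht
  have h1 := ((hG.hasFDerivWithinAt (s := univ)).lim hd (by simp) hcd)
  have hyd : Tendsto (fun n => y + d n) l (𝓝 y) := by
    simpa using tendsto_const_nhds.add hd
  -- The scaled quadratic bound ‖c‖ ‖d‖² splits into the convergent factor ‖c d‖ and the null factor
  -- ‖d‖.
  have h2 : Tendsto (fun n => C * ‖c n • d n‖ * ‖d n‖) l (𝓝 (C * ‖t‖ * 0)) :=
    (hcd.norm.const_mul C).mul (by simpa using hd.norm)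
  rw [mul_zero] at h2
  refine tendsto_nhds_unique h1 (squeeze_zero_norm' ?_ h2)
  filter_upwards [hds, hyd.eventually hS] with n h9 h10
  have := h10 h9
  rw [norm_smul, norm_smul]
  simp only [add_sub_cancel_left] at this
  nlinarith [norm_nonneg (c n)]

/-- A strictly differentiable function that takes equal values at pairs of distinct points on
lines of direction `v` has zero derivative in direction `v`. -/
theorem strictFDeriv_eq_zero {y v : E} {G : E → F} {G' : E →L[𝕜] F}
    (hG : HasStrictFDerivAt G G' y)
    (h : ∃ᶠ p in 𝓝 (y, y), ∃ c : 𝕜, c ≠ 0 ∧ p.1 - p.2 = c • v ∧ G p.1 = G p.2) : G' v = 0 := by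
  by_contra hv
  have hv' : 0 < ‖G' v‖ := norm_pos_iff.2 hv
  have hvn : 0 < ‖v‖ := by
    rw [norm_pos_iff]; rintro rfl; simp at hv
  -- With half of ‖G' v‖ / ‖v‖ as constant, the strict bound would give ‖c‖ ‖G' v‖ ≤ ‖c‖ ‖G' v‖ / 2.
  have hO := hG.isLittleO.def (c := ‖G' v‖ / (2 * ‖v‖)) (by positivity)
  obtain ⟨p, ⟨c, hc, hpc, hpG⟩, hp⟩ := (h.and_eventually hO).exists
  have hcn : 0 < ‖c‖ := norm_pos_iff.2 hc
  rw [hpG, hpc, sub_self, zero_sub, norm_neg, map_smul, norm_smul, norm_smul] at hp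
  have : ‖G' v‖ / (2 * ‖v‖) * (‖c‖ * ‖v‖) = ‖c‖ * ‖G' v‖ / 2 := by field_simp
  rw [this] at hp
  nlinarith [mul_pos hcn hv']

/-- Vectors in the kernel of a surjective operator extend continuously to vectors in the kernels
of nearby operators. -/
theorem exists_continuousAt_ker {X : Type*} [TopologicalSpace X] [CompleteSpace F]
    [FiniteDimensional 𝕜 F]
    {D : X → E →L[𝕜] F} {x : X} (hD : ContinuousAt D x) (hsurj : Function.Surjective (D x))
    {t : E} (ht : D x t = 0) :
    ∃ τ : X → E, ContinuousAt τ x ∧ τ x = t ∧ ∀ᶠ x' in 𝓝 x, D x' (τ x') = 0 := by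
  -- A right inverse R of D x corrects t: near x the operator D x' ∘ R stays invertible, so the
  -- error D x' t can be cancelled by a vector in the range of R.
  obtain ⟨R, hR⟩ := ContinuousLinearMap.exists_rightInverse_of_surjective (D x)
    (LinearMap.range_eq_top.2 hsurj)
  have hDR : ContinuousAt (fun x' => (D x').comp R) x := by
    exact ((ContinuousLinearMap.compL 𝕜 F E F).flip R).continuous.continuousAt.comp hD
  have hx1 : (D x).comp R = 1 := hR
  have hinv : ContinuousAt (fun x' => Ring.inverse ((D x').comp R)) x := by
    refine ContinuousAt.comp (g := Ring.inverse) ?_ hDR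
    rw [hx1]
    exact NormedRing.inverse_continuousAt (1 : (F →L[𝕜] F)ˣ)
  refine ⟨fun x' => t - R (Ring.inverse ((D x').comp R) (D x' t)), ?_, by simp [ht], ?_⟩
  · exact continuousAt_const.sub (R.continuous.continuousAt.comp
      (hinv.clm_apply (hD.clm_apply continuousAt_const)))
  · have hu : ∀ᶠ x' in 𝓝 x, IsUnit ((D x').comp R) := by
      refine hDR.eventually_mem (s := {A | IsUnit A}) (Units.isOpen.mem_nhds ?_)
      simp only [hx1]
      exact isUnit_one
    filter_upwards [hu] with x' hx'
    have h1 := Ring.mul_inverse_cancel _ hx'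
    have h2 := congrArg (fun A : F →L[𝕜] F => A (D x' t)) h1
    simp only [mul_apply_eq_comp, ContinuousLinearMap.comp_apply,
      one_apply_eq_self] at h2
    rw [map_sub, h2, sub_self]

end TangentCone

/-! ### Holomorphic functions on the disc: arguments, zeros and constancy. -/

section Disc

open Complex Metric

/-- A continuous non-vanishing function on the closed disc has a continuous argument. -/
theorem exists_continuousOn_arg {q : ℂ → ℂ} (hq : ContinuousOn q (closedBall 0 1))
    (hq0 : ∀ ζ ∈ closedBall (0 : ℂ) 1, q ζ ≠ 0) :
    ∃ L : ℂ → ℝ, ContinuousOn L (closedBall 0 1) ∧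
      ∀ ζ ∈ closedBall (0 : ℂ) 1, q ζ = ‖q ζ‖ * exp (L ζ * I) := by
  have hconv : Convex ℝ (closedBall (0 : ℂ) 1) := convex_closedBall 0 1
  have h0 : (0 : ℂ) ∈ closedBall (0 : ℂ) 1 := by simp
  have : ContractibleSpace (closedBall (0 : ℂ) 1) := hconv.contractibleSpace ⟨0, h0⟩
  have : LocallyPathConnectedSpace (closedBall (0 : ℂ) 1) :=
    Convex.locallyPathConnectedSpace ℂ hconv
  have hnorm : ∀ ζ : closedBall (0 : ℂ) 1, q ζ / ‖q ζ‖ ∈ Submonoid.unitSphere ℂ := by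
    intro ζ
    have := hq0 ζ ζ.2
    simp [Submonoid.unitSphere, this]
  let f : C(closedBall (0 : ℂ) 1, Circle) :=
    ⟨fun ζ => ⟨q ζ / ‖q ζ‖, hnorm ζ⟩, by
      refine Continuous.subtype_mk ?_ _
      have h1 : Continuous (fun ζ : closedBall (0 : ℂ) 1 => q ζ) := hq.domRestrict
      refine h1.div (continuous_ofReal.comp h1.norm) fun ζ => ?_
      simpa using hq0 ζ ζ.2⟩
  obtain ⟨e, he⟩ := Circle.exp_surjective (f ⟨0, h0⟩)
  -- The disc is contractible and locally path connected, so q/|q| lifts through the covering of the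
  -- circle by the line.
  obtain ⟨L, ⟨-, hL⟩, -⟩ :=
    Circle.isCoveringMap_exp.existsUnique_continuousMap_lifts f ⟨0, h0⟩ e he
  classical
  refine ⟨fun ζ => if h : ζ ∈ closedBall (0 : ℂ) 1 then L ⟨ζ, h⟩ else 0, ?_, ?_⟩
  · rw [continuousOn_iff_continuous_domRestrict]
    refine L.continuous.congr fun ζ => ?_
    have := ζ.2
    simp only [domRestrict_apply]
    rw [dif_pos this]
  · intro ζ hζ
    have h2 := congrFun hL ⟨ζ, hζ⟩
    have h3 : exp (L ⟨ζ, hζ⟩ * I) = q ζ / ‖q ζ‖ := by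
      have := congrArg (fun z : Circle => (z : ℂ)) h2
      simp only [Function.comp_apply, Circle.coe_exp] at this
      exact this
    have h4 : (‖q ζ‖ : ℂ) ≠ 0 := by simpa using hq0 ζ hζ
    simp only [dif_pos hζ, h3]
    field_simp

/-- Continuous periodic functions are uniformly approximated by real parts of polynomials on the
unit circle. -/
theorem exists_polynomial_re_approx {ψ : ℝ → ℝ} (hψ : Continuous ψ)
    (hper : ψ (2 * Real.pi) = ψ 0) :
    ∃ P : ℂ[X], ∀ θ ∈ Icc 0 (2 * Real.pi), |ψ θ - (P.eval (exp (θ * I))).re| < 1 := by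
  have : Fact (0 < 2 * Real.pi) := ⟨Real.two_pi_pos⟩
  let Ψ : C(AddCircle (2 * Real.pi), ℂ) :=
    ⟨AddCircle.liftIco (2 * Real.pi) 0 (fun θ => (ψ θ : ℂ)), by
      refine AddCircle.liftIco_continuous (by simp [hper]) ?_
      exact (continuous_ofReal.comp hψ).continuousOn⟩
  have hspan : Ψ ∈ (Submodule.span ℂ (range (fourier (T := 2 * Real.pi)))).topologicalClosure := by
    rw [span_fourier_closure_eq_top]; trivial
  obtain ⟨g, hg, hdist⟩ := Metric.mem_closure_iff.1 hspan 1 one_pos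
  have key : ∀ g ∈ Submodule.span ℂ (range (fourier (T := 2 * Real.pi))),
      ∃ P : ℂ[X], ∀ θ : ℝ, (g (θ : AddCircle (2 * Real.pi))).re = (P.eval (exp (θ * I))).re := by
    intro g hg
    -- Negative Fourier modes are conjugates of positive ones, and the real part does not see
    -- conjugation; hence P + Q serves.
    suffices h : ∃ P Q : ℂ[X], ∀ θ : ℝ, g (θ : AddCircle (2 * Real.pi)) =
        P.eval (exp (θ * I)) + (starRingEnd ℂ) (Q.eval (exp (θ * I))) by
      obtain ⟨P, Q, h⟩ := h
      exact ⟨P + Q, fun θ => by rw [h]; simp⟩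
    induction hg using Submodule.span_induction with
    | mem x hx =>
      obtain ⟨n, rfl⟩ := hx
      have hpi : (Real.pi : ℂ) ≠ 0 := by simp [Real.pi_ne_zero]
      rcases Int.eq_nat_or_neg n with ⟨m, rfl | rfl⟩
      · refine ⟨Polynomial.X ^ m, 0, fun θ => ?_⟩
        rw [fourier_coe_apply]
        simp only [Polynomial.eval_pow, Polynomial.eval_X, ← exp_nat_mul]
        simp only [Polynomial.eval_zero, map_zero, add_zero]
        congr 1
        push_cast
        field_simp
      · refine ⟨0, Polynomial.X ^ m, fun θ => ?_⟩
        rw [fourier_neg, fourier_coe_apply]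
        simp only [Polynomial.eval_pow, Polynomial.eval_X, ← exp_nat_mul]
        simp only [Polynomial.eval_zero, zero_add]
        congr 2
        push_cast
        field_simp
    | zero => exact ⟨0, 0, fun θ => by simp⟩
    | add x y _ _ hx hy =>
      obtain ⟨P, Q, h⟩ := hx
      obtain ⟨P', Q', h'⟩ := hy
      exact ⟨P + P', Q + Q', fun θ => by simp [h, h']; ring⟩
    | smul a x _ hx =>
      obtain ⟨P, Q, h⟩ := hx
      refine ⟨Polynomial.C a * P, Polynomial.C ((starRingEnd ℂ) a) * Q, fun θ => ?_⟩
      simp [h]; ring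
  obtain ⟨P, hP⟩ := key g hg
  refine ⟨P, fun θ hθ => ?_⟩
  have hΨ : Ψ (θ : AddCircle (2 * Real.pi)) = ψ θ := by
    -- The function on the circle is defined from the half-open interval, so the endpoint 2π is
    -- treated through periodicity.
    rcases eq_or_lt_of_le hθ.2 with h | h
    · have h0 : Ψ ((0 : ℝ) : AddCircle (2 * Real.pi)) = ψ 0 :=
        AddCircle.liftIco_coe_apply (p := 2 * Real.pi) (a := 0) (f := fun θ => (ψ θ : ℂ))
          ⟨le_rfl, by simp [Real.pi_pos]⟩
      have : ((θ : ℝ) : AddCircle (2 * Real.pi)) = ((0 : ℝ) : AddCircle (2 * Real.pi)) := by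
        rw [h]; simp
      rw [this, h, hper, h0]
    · exact AddCircle.liftIco_coe_apply (p := 2 * Real.pi) (a := 0) (f := fun θ => (ψ θ : ℂ))
        ⟨hθ.1, by simpa using h⟩
  rw [← hP θ]
  have h1 : ‖Ψ (θ : AddCircle (2 * Real.pi)) - g (θ : AddCircle (2 * Real.pi))‖ < 1 := by
    rw [← dist_eq_norm]
    exact lt_of_le_of_lt (ContinuousMap.dist_apply_le_dist _) hdist
  rw [hΨ] at h1
  refine lt_of_le_of_lt ?_ h1
  have := Complex.abs_re_le_norm (ψ θ - g (θ : AddCircle (2 * Real.pi)))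
  simpa using this

theorem exists_arg_mem_Icc {ζ : ℂ} (hζ : ζ ∈ sphere (0 : ℂ) 1) :
    ∃ θ ∈ Icc 0 (2 * Real.pi), ζ = exp (θ * I) := by
  have h1 : ‖ζ‖ = 1 := by simpa using hζ
  have h2 : ζ = exp (arg ζ * I) := by
    have := norm_mul_exp_arg_mul_I ζ
    rw [h1] at this
    simpa using this.symm
  rcases le_or_gt 0 (arg ζ) with h | h
  · exact ⟨arg ζ, ⟨h, by linarith [arg_le_pi ζ, Real.pi_pos]⟩, h2⟩
  · refine ⟨arg ζ + 2 * Real.pi, ⟨by linarith [neg_pi_lt_arg ζ], by linarith⟩, ?_⟩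
    push_cast
    rw [add_mul, exp_add, exp_two_pi_mul_I, mul_one, ← h2]

/-- A holomorphic function with positive real part on the unit circle has no zeros in the disc. -/
theorem ne_zero_of_re_pos {h : ℂ → ℂ} (hd : DiffContOnCl ℂ h (ball 0 1))
    (hpos : ∀ ζ ∈ sphere (0 : ℂ) 1, 0 < (h ζ).re) : ∀ ζ ∈ closedBall (0 : ℂ) 1, h ζ ≠ 0 := by
  have hc : ContinuousOn h (closedBall 0 1) := hd.continuousOn_ball
  have hne : (sphere (0 : ℂ) 1).Nonempty := ⟨1, by simp⟩
  obtain ⟨ζ₀, hζ₀, hmin⟩ := (isCompact_sphere (0 : ℂ) 1).exists_isMinOn hne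
    (f := fun ζ => (h ζ).re) (continuous_re.comp_continuousOn (hc.mono sphere_subset_closedBall))
  intro ζ hζ h0
  -- On the circle |exp(-h)| = exp(-Re h) is bounded by a constant below 1, while at a zero of h it
  -- equals 1; the maximum principle forbids this.
  have h1 : DiffContOnCl ℂ (fun ζ => exp (-h ζ)) (ball 0 1) := by
    exact differentiable_exp.comp_diffContOnCl hd.neg
  have h2 := Complex.norm_le_of_forall_mem_frontier_norm_le isBounded_ball h1
    (C := Real.exp (-(h ζ₀).re)) ?_ (z := ζ) (by rwa [closure_ball _ one_ne_zero])
  · rw [h0, neg_zero, exp_zero, norm_one] at h2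
    have := Real.exp_lt_one_iff.2 (neg_lt_zero.2 (hpos ζ₀ hζ₀))
    linarith
  · intro z hz
    rw [frontier_ball _ one_ne_zero] at hz
    have h3 : (h ζ₀).re ≤ (h z).re := hmin hz
    rw [norm_exp, neg_re]
    exact Real.exp_le_exp.2 (by linarith)

/-- A holomorphic function on the disc whose boundary values have a continuous periodic argument
has no zeros. -/
theorem ne_zero_of_periodic_arg {h : ℂ → ℂ} (hd : DiffContOnCl ℂ h (ball 0 1)) {ψ : ℝ → ℝ}
    (hψ : Continuous ψ) (hper : ψ (2 * Real.pi) = ψ 0)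
    (h0 : ∀ ζ ∈ sphere (0 : ℂ) 1, h ζ ≠ 0)
    (harg : ∀ θ ∈ Icc 0 (2 * Real.pi), h (exp (θ * I)) = ‖h (exp (θ * I))‖ * exp (ψ θ * I)) :
    ∀ ζ ∈ closedBall (0 : ℂ) 1, h ζ ≠ 0 := by
  -- Multiplication by exp(-iP) lowers the boundary argument by Re P, leaving it in (-1, 1), where
  -- the cosine is positive. This takes the place of the argument principle.
  obtain ⟨P, hP⟩ := exists_polynomial_re_approx hψ hper
  have hE : DiffContOnCl ℂ (fun ζ => exp (-I * P.eval ζ)) (ball 0 1) :=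
    (differentiable_exp.comp ((P.differentiable).const_mul (-I))).diffContOnCl
  have h1 : DiffContOnCl ℂ (fun ζ => h ζ * exp (-I * P.eval ζ)) (ball 0 1) := by
    simpa [smul_eq_mul] using hd.smul hE
  intro ζ hζ h2
  refine ne_zero_of_re_pos h1 ?_ ζ hζ (by simp [h2])
  intro z hz
  obtain ⟨θ, hθ, rfl⟩ := exists_arg_mem_Icc hz
  have h3 := h0 _ hz
  set w := P.eval (exp (θ * I)) with hw
  have h4 : h (exp (θ * I)) * exp (-I * w) =
      ((‖h (exp (θ * I))‖ * Real.exp w.im : ℝ) : ℂ) * exp ((ψ θ - w.re : ℝ) * I) := by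
    rw [harg θ hθ]
    have h5 : (‖(‖h (exp (θ * I))‖ : ℂ) * exp (ψ θ * I)‖ : ℝ) = ‖h (exp (θ * I))‖ := by
      rw [norm_mul, norm_exp_ofReal_mul_I]; simp
    rw [h5]
    push_cast
    rw [mul_assoc, mul_assoc, ← exp_add, ← exp_add]
    congr 2
    conv_lhs => rw [← re_add_im w]
    ring_nf
    rw [I_sq]; ring
  rw [h4, re_ofReal_mul, exp_ofReal_mul_I_re]
  have h6 := hP θ hθ
  rw [← hw, abs_lt] at h6
  refine mul_pos (mul_pos (norm_pos_iff.2 h3) (Real.exp_pos _)) (Real.cos_pos_of_mem_Ioo ⟨?_, ?_⟩)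
  · linarith [Real.pi_gt_three]
  · linarith [Real.pi_gt_three]

/-- A non-vanishing holomorphic function on the disc with constant modulus on the boundary circle
is constant. -/
theorem eq_const_of_norm_eq_const {h : ℂ → ℂ} (hd : DiffContOnCl ℂ h (ball 0 1))
    (h0 : ∀ ζ ∈ closedBall (0 : ℂ) 1, h ζ ≠ 0) {c : ℝ}
    (hc : ∀ ζ ∈ sphere (0 : ℂ) 1, ‖h ζ‖ = c) : ∀ ζ ∈ closedBall (0 : ℂ) 1, h ζ = h 0 := by
  have hcl : closure (ball (0 : ℂ) 1) = closedBall 0 1 := closure_ball _ one_ne_zero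
  have hfr : frontier (ball (0 : ℂ) 1) = sphere 0 1 := frontier_ball _ one_ne_zero
  have hle : ∀ ζ ∈ closedBall (0 : ℂ) 1, ‖h ζ‖ ≤ c := fun ζ hζ =>
    Complex.norm_le_of_forall_mem_frontier_norm_le isBounded_ball hd
      (fun z hz => (hc z (hfr ▸ hz)).le) (hcl ▸ hζ)
  have hcpos : 0 < c := by
    rw [← hc 1 (by simp)]; exact norm_pos_iff.2 (h0 1 (by simp))
  -- The maximum principle for both h and 1/h gives |h| = c on the whole disc, so the modulus is
  -- maximal at the centre.
  have hinv : DiffContOnCl ℂ (fun ζ => (h ζ)⁻¹) (ball 0 1) := hd.inv (by rwa [hcl])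
  have hge : ∀ ζ ∈ closedBall (0 : ℂ) 1, c ≤ ‖h ζ‖ := by
    intro ζ hζ
    have := Complex.norm_le_of_forall_mem_frontier_norm_le isBounded_ball hinv (C := c⁻¹)
      (fun z hz => by rw [norm_inv, hc z (hfr ▸ hz)]) (hcl.symm ▸ hζ)
    rw [norm_inv] at this
    exact (inv_le_inv₀ (norm_pos_iff.2 (h0 ζ hζ)) hcpos).1 this
  have heq := Complex.eqOn_of_isPreconnected_of_isMaxOn_norm (convex_ball (0 : ℂ) 1).isPreconnected
    isOpen_ball hd.differentiableOn (c := 0) (by simp) (fun ζ hζ => by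
      simp only [mem_ofPred_eq, Function.comp]
      exact (hle ζ (ball_subset_closedBall hζ)).trans (hge 0 (by simp)))
  have heq2 : EqOn h (Function.const ℂ (h 0)) (closure (ball 0 1)) :=
    heq.of_subset_closure hd.continuousOn continuousOn_const subset_closure le_rfl
  intro ζ hζ
  exact heq2 (hcl ▸ hζ)

end Disc

end Analysis

/-! ### Topology of the ambient space, read on homogeneous coordinates. -/

section Ambient

open Set Filter

section ProjectiveTopology

variable {V : Type*} [NormedAddCommGroup V] [NormedSpace ℂ V]

theorem continuous_projectivization_mk :
    Continuous (fun v : {v : V // v ≠ 0} => Projectivization.mk ℂ v.1 v.2) :=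
  continuous_quotient_mk'

/-- The saturation of an open set is the union of its dilates by units, which are open. -/
theorem isOpenMap_projectivization_mk :
    IsOpenMap (fun v : {v : V // v ≠ 0} => Projectivization.mk ℂ v.1 v.2) := by
  intro U hU
  have hq : Topology.IsQuotientMap (fun v : {v : V // v ≠ 0} => Projectivization.mk ℂ v.1 v.2) :=
    isQuotientMap_quotient_mk'
  rw [← hq.isOpen_preimage]
  have : (fun v : {v : V // v ≠ 0} => Projectivization.mk ℂ v.1 v.2) ⁻¹'
      ((fun v : {v : V // v ≠ 0} => Projectivization.mk ℂ v.1 v.2) '' U) =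
      ⋃ a : ℂˣ, (fun v : {v : V // v ≠ 0} =>
        (⟨(a : ℂ) • v.1, smul_ne_zero a.ne_zero v.2⟩ : {v : V // v ≠ 0})) ⁻¹' U := by
    ext v
    simp only [mem_preimage, mem_image, mem_iUnion]
    constructor
    · rintro ⟨w, hw, hwv⟩
      obtain ⟨a, ha⟩ := (Projectivization.mk_eq_mk_iff' ℂ _ _ w.2 v.2).1 hwv
      have ha0 : a ≠ 0 := by
        rintro rfl
        exact w.2 (by rw [← ha, zero_smul])
      refine ⟨Units.mk0 a ha0, ?_⟩
      convert hw using 1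
      exact Subtype.ext ha
    · rintro ⟨a, ha⟩
      exact ⟨_, ha, (Projectivization.mk_eq_mk_iff' ℂ _ _ _ _).2 ⟨a, rfl⟩⟩
  rw [this]
  refine isOpen_iUnion fun a => hU.preimage ?_
  exact Continuous.subtype_mk (continuous_subtype_val.const_smul _) _

/-- The unit sphere is compact and surjects onto projective space. -/
instance compactSpace_projectivization {n : ℕ} : CompactSpace (ℙ ℂ (Fin n → ℂ)) := by
  let e : Metric.sphere (0 : Fin n → ℂ) 1 → {v : Fin n → ℂ // v ≠ 0} := fun v =>
    ⟨v.1, by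
      have := v.2
      intro h
      simp [h] at this⟩
  have he : Continuous e := Continuous.subtype_mk continuous_subtype_val _
  have hc := continuous_projectivization_mk.comp he
  have hs : Function.Surjective
      ((fun v : {v : Fin n → ℂ // v ≠ 0} => Projectivization.mk ℂ v.1 v.2) ∘ e) := by
    intro p
    induction p using Projectivization.ind with
    | h v hv =>
      have hv' : ‖v‖ ≠ 0 := norm_ne_zero_iff.2 hv
      refine ⟨⟨((‖v‖⁻¹ : ℝ) : ℂ) • v, ?_⟩, ?_⟩
      · rw [mem_sphere_zero_iff_norm, norm_smul]
        simp [hv']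
      · exact (Projectivization.mk_eq_mk_iff' ℂ _ _ _ _).2 ⟨_, rfl⟩
  exact hs.compactSpace hc

end ProjectiveTopology

/-- The homogeneous coordinates that define a point. -/
def nonzeroCoord : Set HomCoord := {y | y.1 ≠ 0 ∧ y.2.1 ≠ 0 ∧ y.2.2 ≠ 0}

theorem isOpen_nonzeroCoord : IsOpen nonzeroCoord := by
  refine IsOpen.inter (isOpen_ne_fun continuous_fst continuous_const) (IsOpen.inter ?_ ?_)
  · exact isOpen_ne_fun (continuous_fst.comp continuous_snd) continuous_const
  · exact isOpen_ne_fun (continuous_snd.comp continuous_snd) continuous_const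

/-- The point with given homogeneous coordinates. -/
def toAmbient (y : nonzeroCoord) : Ambient :=
  (Projectivization.mk ℂ y.1.1 y.2.1, Projectivization.mk ℂ y.1.2.1 y.2.2.1,
    Projectivization.mk ℂ y.1.2.2 y.2.2.2)

theorem continuous_toAmbient : Continuous toAmbient := by
  refine Continuous.prodMk ?_ (Continuous.prodMk ?_ ?_)
  · exact continuous_projectivization_mk.comp
      (Continuous.subtype_mk (continuous_fst.comp continuous_subtype_val) fun y => y.2.1)
  · exact continuous_projectivization_mk.comp (Continuous.subtype_mk
      (continuous_fst.comp (continuous_snd.comp continuous_subtype_val)) fun y => y.2.2.1)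
  · exact continuous_projectivization_mk.comp (Continuous.subtype_mk
      (continuous_snd.comp (continuous_snd.comp continuous_subtype_val)) fun y => y.2.2.2)

theorem isOpenMap_toAmbient : IsOpenMap toAmbient := by
  let e : nonzeroCoord ≃ₜ
      {v : Fin 3 → ℂ // v ≠ 0} × {v : Fin 3 → ℂ // v ≠ 0} × {v : Fin 2 → ℂ // v ≠ 0} :=
    { toFun := fun y => (⟨y.1.1, y.2.1⟩, ⟨y.1.2.1, y.2.2.1⟩, ⟨y.1.2.2, y.2.2.2⟩)
      invFun := fun p => ⟨(p.1.1, p.2.1.1, p.2.2.1), p.1.2, p.2.1.2, p.2.2.2⟩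
      left_inv := fun y => rfl
      right_inv := fun p => rfl
      continuous_toFun := by fun_prop
      continuous_invFun := by fun_prop }
  have := (isOpenMap_projectivization_mk (V := Fin 3 → ℂ)).prodMap
    ((isOpenMap_projectivization_mk (V := Fin 3 → ℂ)).prodMap
      (isOpenMap_projectivization_mk (V := Fin 2 → ℂ)))
  exact this.comp e.isOpenMap

theorem mem_cone_iff {S : Set Ambient} {y : HomCoord} :
    y ∈ cone S ↔ ∃ h : y ∈ nonzeroCoord, toAmbient ⟨y, h⟩ ∈ S :=
  ⟨fun ⟨h₁, h₂, h₃, h⟩ => ⟨⟨h₁, h₂, h₃⟩, h⟩, fun ⟨⟨h₁, h₂, h₃⟩, h⟩ => ⟨h₁, h₂, h₃, h⟩⟩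

theorem cone_eq_image (S : Set Ambient) : cone S = Subtype.val '' (toAmbient ⁻¹' S) := by
  ext y
  simp [mem_cone_iff]

theorem toAmbient_surjective : Function.Surjective toAmbient := by
  rintro ⟨p, q, t⟩
  induction p using Projectivization.ind with
  | h a ha =>
    induction q using Projectivization.ind with
    | h b hb =>
      induction t using Projectivization.ind with
      | h c hc => exact ⟨⟨(a, b, c), ha, hb, hc⟩, rfl⟩

/-- For an open continuous map, preimages commute with closures. This lets all limits be taken in a
vector space instead of in projective spaces. -/
theorem mem_cone_closure {S : Set Ambient} {y : HomCoord} :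
    y ∈ cone (closure S) ↔ y ∈ nonzeroCoord ∧ y ∈ closure (cone S) := by
  rw [mem_cone_iff, cone_eq_image]
  constructor
  · rintro ⟨h, h1⟩
    refine ⟨h, ?_⟩
    have h2 : (⟨y, h⟩ : nonzeroCoord) ∈ toAmbient ⁻¹' closure S := h1
    rw [isOpenMap_toAmbient.preimage_closure_eq_closure_preimage continuous_toAmbient,
      Topology.IsEmbedding.subtypeVal.closure_eq_preimage_closure_image] at h2
    exact h2
  · rintro ⟨h, h1⟩
    refine ⟨h, ?_⟩
    change (⟨y, h⟩ : nonzeroCoord) ∈ toAmbient ⁻¹' closure S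
    rw [isOpenMap_toAmbient.preimage_closure_eq_closure_preimage continuous_toAmbient,
      Topology.IsEmbedding.subtypeVal.closure_eq_preimage_closure_image]
    exact h1

/-- Homogeneous coordinates with non-zero last entries. -/
def finiteCoord : Set HomCoord := {y | y.1 2 ≠ 0 ∧ y.2.1 2 ≠ 0 ∧ y.2.2 1 ≠ 0}

theorem isOpen_finiteCoord : IsOpen finiteCoord := by
  refine IsOpen.inter (isOpen_ne_fun (by fun_prop) continuous_const) (IsOpen.inter ?_ ?_)
  · exact isOpen_ne_fun (by fun_prop) continuous_const
  · exact isOpen_ne_fun (by fun_prop) continuous_const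

theorem finiteCoord_subset : finiteCoord ⊆ nonzeroCoord := by
  rintro y ⟨h1, h2, h3⟩
  exact ⟨fun h => h1 (by rw [h]; rfl), fun h => h2 (by rw [h]; rfl), fun h => h3 (by rw [h]; rfl)⟩

theorem embed_affineCoord {y : HomCoord} (hy : y ∈ finiteCoord) :
    embed (affineCoord y) = toAmbient ⟨y, finiteCoord_subset hy⟩ := by
  obtain ⟨h1, h2, h3⟩ := hy
  refine Prod.ext ?_ (Prod.ext ?_ ?_)
  · refine (Projectivization.mk_eq_mk_iff' ℂ _ _ _ _).2 ⟨(y.1 2)⁻¹, ?_⟩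
    ext i
    fin_cases i <;> simp [affineCoord, h1, div_eq_inv_mul]
  · refine (Projectivization.mk_eq_mk_iff' ℂ _ _ _ _).2 ⟨(y.2.1 2)⁻¹, ?_⟩
    ext i
    fin_cases i <;> simp [affineCoord, h2, div_eq_inv_mul]
  · refine (Projectivization.mk_eq_mk_iff' ℂ _ _ _ _).2 ⟨(y.2.2 1)⁻¹, ?_⟩
    ext i
    fin_cases i <;> simp [affineCoord, h3, div_eq_inv_mul]

theorem eq_affineCoord_of_embed_eq {x : Fin 5 → ℂ} {y : HomCoord} (hy : y ∈ nonzeroCoord)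
    (h : embed x = toAmbient ⟨y, hy⟩) : y ∈ finiteCoord ∧ affineCoord y = x := by
  have h1 := congrArg Prod.fst h
  have h2 := congrArg (fun p => p.2.1) h
  have h3 := congrArg (fun p => p.2.2) h
  obtain ⟨a, ha⟩ := (Projectivization.mk_eq_mk_iff' ℂ _ _ _ _).1 h1
  obtain ⟨b, hb⟩ := (Projectivization.mk_eq_mk_iff' ℂ _ _ _ _).1 h2
  obtain ⟨c, hc⟩ := (Projectivization.mk_eq_mk_iff' ℂ _ _ _ _).1 h3
  have a0 := congrFun ha 0
  have a1 := congrFun ha 1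
  have a2 := congrFun ha 2
  have b0 := congrFun hb 0
  have b1 := congrFun hb 1
  have b2 := congrFun hb 2
  have c0 := congrFun hc 0
  have c1 := congrFun hc 1
  simp only [Pi.smul_apply, smul_eq_mul, Matrix.cons_val] at a0 a1 a2 b0 b1 b2 c0 c1
  have ha2 : y.1 2 ≠ 0 := right_ne_zero_of_mul (a2 ▸ one_ne_zero)
  have hb2 : y.2.1 2 ≠ 0 := right_ne_zero_of_mul (b2 ▸ one_ne_zero)
  have hc1 : y.2.2 1 ≠ 0 := right_ne_zero_of_mul (c1 ▸ one_ne_zero)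
  have ha' : a = (y.1 2)⁻¹ := eq_inv_of_mul_eq_one_left a2
  have hb' : b = (y.2.1 2)⁻¹ := eq_inv_of_mul_eq_one_left b2
  have hc' : c = (y.2.2 1)⁻¹ := eq_inv_of_mul_eq_one_left c1
  refine ⟨⟨ha2, hb2, hc1⟩, ?_⟩
  ext i
  fin_cases i
  · simpa [affineCoord, div_eq_inv_mul, ha'] using a0
  · simpa [affineCoord, div_eq_inv_mul, ha'] using a1
  · simpa [affineCoord, div_eq_inv_mul, hb'] using b0
  · simpa [affineCoord, div_eq_inv_mul, hb'] using b1
  · simpa [affineCoord, div_eq_inv_mul, hc'] using c0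

theorem mem_cone_embed_image {S : Set (Fin 5 → ℂ)} {y : HomCoord} :
    y ∈ cone (embed '' S) ↔ y ∈ finiteCoord ∧ affineCoord y ∈ S := by
  rw [mem_cone_iff]
  constructor
  · rintro ⟨h, x, hx, hxy⟩
    obtain ⟨h1, rfl⟩ := eq_affineCoord_of_embed_eq h hxy
    exact ⟨h1, hx⟩
  · rintro ⟨h, hx⟩
    exact ⟨finiteCoord_subset h, _, hx, embed_affineCoord h⟩

theorem mem_cone_openPart {f g : ℂ[X]} {y : HomCoord} :
    y ∈ cone (openPart f g) ↔ y ∈ finiteCoord ∧ affineCoord y ∈ conifold f g :=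
  mem_cone_embed_image

theorem embed_injective : Function.Injective embed := by
  intro x x' h
  have hx : ∀ x : Fin 5 → ℂ, ((![x 0, x 1, 1], ![x 2, x 3, 1], ![x 4, 1]) : HomCoord) ∈
      finiteCoord := fun x => by simp [finiteCoord]
  have h1 : ∀ x : Fin 5 → ℂ, embed x = toAmbient ⟨_, finiteCoord_subset (hx x)⟩ := fun x => rfl
  have h2 := (eq_affineCoord_of_embed_eq _ (h1 x)).2
  have h3 := (eq_affineCoord_of_embed_eq _ (h.symm.trans (h1 x))).2
  exact h2.symm.trans h3

/-- Membership in the fibre, in homogeneous coordinates. -/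
theorem mem_cone_fiber {f g : ℂ[X]} {b : Base} {y : HomCoord} :
    y ∈ cone (fiber f g b) ↔ y ∈ nonzeroCoord ∧
      (y, b) ∈ closure ((fun w => (w, fibration (affineCoord w))) '' cone (openPart f g)) := by
  have hset : ∀ h : y ∈ nonzeroCoord, (toAmbient ⟨y, h⟩ ∈ fiber f g b ↔
      (y, b) ∈ closure ((fun w => (w, fibration (affineCoord w))) '' cone (openPart f g))) := by
    intro h
    -- The closure argument used for cones is repeated for the graph, with the base as a passive
    -- factor.
    let q : nonzeroCoord × Base → Ambient × Base := Prod.map toAmbient id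
    have hqo : IsOpenMap q := isOpenMap_toAmbient.prodMap IsOpenMap.id
    have hqc : Continuous q := continuous_toAmbient.prodMap continuous_id
    let j : nonzeroCoord × Base → HomCoord × Base := Prod.map Subtype.val id
    have hj : Topology.IsEmbedding j := Topology.IsEmbedding.subtypeVal.prodMap .id
    change (⟨y, h⟩, b) ∈ q ⁻¹' closure _ ↔ (⟨y, h⟩, b) ∈ j ⁻¹' closure _
    rw [hqo.preimage_closure_eq_closure_preimage hqc, hj.closure_eq_preimage_closure_image]
    have : (fun w => (w, fibration (affineCoord w))) '' cone (openPart f g) =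
        j '' (q ⁻¹' ((fun x => (embed x, fibration x)) '' conifold f g)) := by
      ext ⟨w, b'⟩
      constructor
      · rintro ⟨w, hw, h0⟩
        obtain ⟨rfl, rfl⟩ := Prod.mk.inj h0
        obtain ⟨h1, h2⟩ := mem_cone_openPart.1 hw
        exact ⟨(⟨w, finiteCoord_subset h1⟩, _),
          ⟨_, h2, Prod.ext (embed_affineCoord h1) rfl⟩, rfl⟩
      · rintro ⟨⟨w, b'⟩, ⟨x, hx, h1⟩, h0⟩
        obtain ⟨rfl, rfl⟩ := Prod.mk.inj h0
        obtain ⟨h3, rfl⟩ := Prod.mk.inj h1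
        obtain ⟨h2, rfl⟩ := eq_affineCoord_of_embed_eq w.2 h3
        exact ⟨w, mem_cone_openPart.2 ⟨h2, hx⟩, rfl⟩
    rw [this]
  rw [mem_cone_iff]
  constructor
  · rintro ⟨h, h1⟩
    exact ⟨h, (hset h).1 h1⟩
  · rintro ⟨h, h1⟩
    exact ⟨h, (hset h).2 h1⟩

theorem cone_fiber_subset (f g : ℂ[X]) (b : Base) :
    cone (fiber f g b) ⊆ cone (compactification f g) := by
  intro y hy
  obtain ⟨h, h1⟩ := mem_cone_fiber.1 hy
  refine mem_cone_closure.2 ⟨h, ?_⟩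
  have := image_closure_subset_closure_image continuous_fst (mem_image_of_mem Prod.fst h1)
  rw [image_image] at this
  simpa using this

theorem cone_openPart_subset (f g : ℂ[X]) :
    cone (openPart f g) ⊆ cone (compactification f g) := by
  intro y hy
  exact mem_cone_closure.2 ⟨finiteCoord_subset (mem_cone_openPart.1 hy).1, subset_closure hy⟩

end Ambient

/-! ### Equations of the compactification over finite z. -/

section Equations

open Set Filter

/-- The conditions on the two polynomials: the roots of `f` and `g` are simple, non-zero and
pairwise distinct, and neither polynomial is constant. -/
structure IsAdmissible (f g : ℂ[X]) : Prop where
  separable : (f * g).Separable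
  left_zero : f.eval 0 ≠ 0
  right_zero : g.eval 0 ≠ 0
  left_degree : 0 < f.natDegree
  right_degree : 0 < g.natDegree

namespace IsAdmissible

variable {f g : ℂ[X]} (h : IsAdmissible f g)

include h

theorem symm : IsAdmissible g f :=
  ⟨mul_comm f g ▸ h.separable, h.right_zero, h.left_zero, h.right_degree, h.left_degree⟩

/-- The identity excludes double and common roots, and its coefficients also enter the volume form.
-/
theorem exists_bezout : ∃ A B : ℂ[X], ∀ z : ℂ, A.eval z * (f.eval z * g.eval z) +
    B.eval z * (f.eval z * g.derivative.eval z + f.derivative.eval z * g.eval z) = 1 := by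
  obtain ⟨A, B, hAB⟩ := h.separable
  refine ⟨A, B, fun z => ?_⟩
  have := congrArg (Polynomial.eval z) hAB
  simp only [Polynomial.derivative_mul, Polynomial.eval_add, Polynomial.eval_mul,
    Polynomial.eval_one] at this
  rw [← this]; ring

theorem right_ne_zero {z : ℂ} (hz : f.eval z = 0) : g.eval z ≠ 0 := by
  obtain ⟨A, B, hAB⟩ := h.exists_bezout
  intro hg
  simpa [hz, hg] using hAB z

theorem left_derivative_ne_zero {z : ℂ} (hz : f.eval z = 0) : f.derivative.eval z ≠ 0 := by
  obtain ⟨A, B, hAB⟩ := h.exists_bezout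
  intro hg
  simpa [hz, hg] using hAB z

end IsAdmissible

/-- The affine coordinate `z`. -/
def zCoord (y : HomCoord) : ℂ := y.2.2 0 / y.2.2 1

/-- The equations of the compactification over the finite points of `ℙ¹`. -/
def homEq (f g : ℂ[X]) (y : HomCoord) : Fin 2 → ℂ :=
  ![y.1 0 * y.1 1 - y.1 2 ^ 2 * f.eval (zCoord y),
    y.2.1 0 * y.2.1 1 - y.2.1 2 ^ 2 * g.eval (zCoord y)]

/-- The derivative of `zCoord`. -/
def zDeriv (y : HomCoord) : HomCoord →L[ℂ] ℂ :=
  LinearMap.toContinuousLinearMap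
    { toFun := fun t => (t.2.2 0 * y.2.2 1 - y.2.2 0 * t.2.2 1) / y.2.2 1 ^ 2
      map_add' := fun t t' => by simp; ring
      map_smul' := fun c t => by simp; ring }

@[simp] theorem zDeriv_apply (y t : HomCoord) :
    zDeriv y t = (t.2.2 0 * y.2.2 1 - y.2.2 0 * t.2.2 1) / y.2.2 1 ^ 2 := rfl

/-- The derivative of `homEq`. -/
def homEqDeriv (f g : ℂ[X]) (y : HomCoord) : HomCoord →L[ℂ] (Fin 2 → ℂ) :=
  LinearMap.toContinuousLinearMap
    { toFun := fun t =>
        ![t.1 0 * y.1 1 + y.1 0 * t.1 1 - 2 * y.1 2 * t.1 2 * f.eval (zCoord y)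
            - y.1 2 ^ 2 * f.derivative.eval (zCoord y) * zDeriv y t,
          t.2.1 0 * y.2.1 1 + y.2.1 0 * t.2.1 1 - 2 * y.2.1 2 * t.2.1 2 * g.eval (zCoord y)
            - y.2.1 2 ^ 2 * g.derivative.eval (zCoord y) * zDeriv y t]
      map_add' := fun t t' => by
        rw [map_add]
        ext i
        fin_cases i <;> simp <;> ring
      map_smul' := fun c t => by
        rw [map_smul]
        ext i
        fin_cases i <;> simp <;> ring }

theorem homEqDeriv_apply (f g : ℂ[X]) (y t : HomCoord) : homEqDeriv f g y t =
    ![t.1 0 * y.1 1 + y.1 0 * t.1 1 - 2 * y.1 2 * t.1 2 * f.eval (zCoord y)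
        - y.1 2 ^ 2 * f.derivative.eval (zCoord y) * zDeriv y t,
      t.2.1 0 * y.2.1 1 + y.2.1 0 * t.2.1 1 - 2 * y.2.1 2 * t.2.1 2 * g.eval (zCoord y)
        - y.2.1 2 ^ 2 * g.derivative.eval (zCoord y) * zDeriv y t] := rfl

theorem hasStrictFDerivAt_zCoord {y : HomCoord} (hy : y.2.2 1 ≠ 0) :
    HasStrictFDerivAt zCoord (zDeriv y) y := by
  have h0 : HasStrictFDerivAt (fun y : HomCoord => y.2.2 0) _ y :=
    ((ContinuousLinearMap.proj (R := ℂ) (φ := fun _ : Fin 2 => ℂ) 0).comp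
      ((ContinuousLinearMap.snd ℂ (Fin 3 → ℂ) (Fin 2 → ℂ)).comp
        (ContinuousLinearMap.snd ℂ (Fin 3 → ℂ) _))).hasStrictFDerivAt
  have h1 : HasStrictFDerivAt (fun y : HomCoord => y.2.2 1) _ y :=
    ((ContinuousLinearMap.proj (R := ℂ) (φ := fun _ : Fin 2 => ℂ) 1).comp
      ((ContinuousLinearMap.snd ℂ (Fin 3 → ℂ) (Fin 2 → ℂ)).comp
        (ContinuousLinearMap.snd ℂ (Fin 3 → ℂ) _))).hasStrictFDerivAt
  have h2 := h0.mul ((hasStrictDerivAt_inv hy).comp_hasStrictFDerivAt y h1)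
  refine (h2.congr_fderiv (ContinuousLinearMap.ext fun t => ?_))
  simp
  field_simp
  ring

theorem hasStrictFDerivAt_fst (i : Fin 3) (y : HomCoord) :
    HasStrictFDerivAt (fun y : HomCoord => y.1 i)
      ((ContinuousLinearMap.proj (R := ℂ) (φ := fun _ : Fin 3 => ℂ) i).comp
        (ContinuousLinearMap.fst ℂ (Fin 3 → ℂ) ((Fin 3 → ℂ) × (Fin 2 → ℂ)))) y :=
  ((ContinuousLinearMap.proj (R := ℂ) (φ := fun _ : Fin 3 => ℂ) i).comp
    (ContinuousLinearMap.fst ℂ (Fin 3 → ℂ) ((Fin 3 → ℂ) × (Fin 2 → ℂ)))).hasStrictFDerivAt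

theorem hasStrictFDerivAt_snd (i : Fin 3) (y : HomCoord) :
    HasStrictFDerivAt (fun y : HomCoord => y.2.1 i)
      ((ContinuousLinearMap.proj (R := ℂ) (φ := fun _ : Fin 3 => ℂ) i).comp
        ((ContinuousLinearMap.fst ℂ (Fin 3 → ℂ) (Fin 2 → ℂ)).comp
          (ContinuousLinearMap.snd ℂ (Fin 3 → ℂ) ((Fin 3 → ℂ) × (Fin 2 → ℂ))))) y :=
  ((ContinuousLinearMap.proj (R := ℂ) (φ := fun _ : Fin 3 => ℂ) i).comp
    ((ContinuousLinearMap.fst ℂ (Fin 3 → ℂ) (Fin 2 → ℂ)).comp (ContinuousLinearMap.snd ℂ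
      (Fin 3 → ℂ) ((Fin 3 → ℂ) × (Fin 2 → ℂ))))).hasStrictFDerivAt

theorem hasStrictFDerivAt_homEq (f g : ℂ[X]) {y : HomCoord} (hy : y.2.2 1 ≠ 0) :
    HasStrictFDerivAt (homEq f g) (homEqDeriv f g y) y := by
  have hz := hasStrictFDerivAt_zCoord hy
  rw [hasStrictFDerivAt_pi']
  intro i
  fin_cases i
  · have h1 := ((hasStrictFDerivAt_fst 0 y).mul (hasStrictFDerivAt_fst 1 y)).sub
      (((hasStrictFDerivAt_fst 2 y).pow 2).mul
        ((f.hasStrictDerivAt (zCoord y)).comp_hasStrictFDerivAt y hz))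
    refine h1.congr_fderiv (ContinuousLinearMap.ext fun t => ?_)
    simp [homEqDeriv_apply]
    ring
  · have h1 := ((hasStrictFDerivAt_snd 0 y).mul (hasStrictFDerivAt_snd 1 y)).sub
      (((hasStrictFDerivAt_snd 2 y).pow 2).mul
        ((g.hasStrictDerivAt (zCoord y)).comp_hasStrictFDerivAt y hz))
    refine h1.congr_fderiv (ContinuousLinearMap.ext fun t => ?_)
    simp [homEqDeriv_apply]
    ring

theorem analyticAt_fst (i : Fin 3) (y : HomCoord) : AnalyticAt ℂ (fun y : HomCoord => y.1 i) y :=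
  ((ContinuousLinearMap.proj (R := ℂ) (φ := fun _ : Fin 3 => ℂ) i).comp
    (ContinuousLinearMap.fst ℂ (Fin 3 → ℂ) ((Fin 3 → ℂ) × (Fin 2 → ℂ)))).analyticAt y

theorem analyticAt_snd (i : Fin 3) (y : HomCoord) : AnalyticAt ℂ (fun y : HomCoord => y.2.1 i) y :=
  ((ContinuousLinearMap.proj (R := ℂ) (φ := fun _ : Fin 3 => ℂ) i).comp
    ((ContinuousLinearMap.fst ℂ (Fin 3 → ℂ) (Fin 2 → ℂ)).comp
      (ContinuousLinearMap.snd ℂ (Fin 3 → ℂ) ((Fin 3 → ℂ) × (Fin 2 → ℂ))))).analyticAt y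

theorem analyticAt_thd (i : Fin 2) (y : HomCoord) : AnalyticAt ℂ (fun y : HomCoord => y.2.2 i) y :=
  ((ContinuousLinearMap.proj (R := ℂ) (φ := fun _ : Fin 2 => ℂ) i).comp
    ((ContinuousLinearMap.snd ℂ (Fin 3 → ℂ) (Fin 2 → ℂ)).comp
      (ContinuousLinearMap.snd ℂ (Fin 3 → ℂ) ((Fin 3 → ℂ) × (Fin 2 → ℂ))))).analyticAt y

theorem analyticAt_zCoord {y : HomCoord} (hy : y.2.2 1 ≠ 0) : AnalyticAt ℂ zCoord y :=
  (analyticAt_thd 0 y).div (analyticAt_thd 1 y) hy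

theorem analyticAt_eval_zCoord (f : ℂ[X]) {y : HomCoord} (hy : y.2.2 1 ≠ 0) :
    AnalyticAt ℂ (fun y => f.eval (zCoord y)) y :=
  (f.differentiable.analyticAt (zCoord y)).comp (analyticAt_zCoord hy)

theorem analyticAt_homEq (f g : ℂ[X]) {y : HomCoord} (hy : y.2.2 1 ≠ 0) :
    AnalyticAt ℂ (homEq f g) y := by
  rw [analyticAt_pi_iff]
  intro i
  fin_cases i
  · exact ((analyticAt_fst 0 y).mul (analyticAt_fst 1 y)).sub
      (((analyticAt_fst 2 y).pow 2).mul (analyticAt_eval_zCoord f hy))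
  · exact ((analyticAt_snd 0 y).mul (analyticAt_snd 1 y)).sub
      (((analyticAt_snd 2 y).pow 2).mul (analyticAt_eval_zCoord g hy))

theorem homEq_eq_zero_iff {f g : ℂ[X]} {y : HomCoord} : homEq f g y = 0 ↔
    y.1 0 * y.1 1 = y.1 2 ^ 2 * f.eval (zCoord y) ∧
      y.2.1 0 * y.2.1 1 = y.2.1 2 ^ 2 * g.eval (zCoord y) := by
  rw [funext_iff, Fin.forall_fin_two]
  simp [homEq, sub_eq_zero]

theorem ne_zero_or_of_eval_ne_zero {p : Fin 3 → ℂ} (hp : p ≠ 0) {c : ℂ} (hc : c ≠ 0)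
    (h : p 0 * p 1 = p 2 ^ 2 * c) : p 0 ≠ 0 ∨ p 1 ≠ 0 := by
  by_contra! h0
  apply hp
  ext i
  fin_cases i
  · exact h0.1
  · exact h0.2
  · simpa [h0.1, hc] using h

theorem exists_solve {a b : ℂ} (h : a ≠ 0 ∨ b ≠ 0) (c : ℂ) : ∃ s t : ℂ, s * b + a * t = c := by
  rcases h with h | h
  · exact ⟨0, c / a, by field_simp; ring⟩
  · exact ⟨c / b, 0, by field_simp; ring⟩

/-- Each equation is solved in its own U, V directions unless both coordinates vanish. In that case
z is a simple root of the polynomial, and the z direction serves; as f and g have no common root,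
this happens for at most one of the two equations. -/
theorem homEqDeriv_surjective {f g : ℂ[X]} (hfg : IsAdmissible f g) {y : HomCoord}
    (hy : y ∈ nonzeroCoord) (hy1 : y.2.2 1 ≠ 0) (h0 : homEq f g y = 0) :
    Function.Surjective (homEqDeriv f g y) := by
  obtain ⟨h1, h2⟩ := homEq_eq_zero_iff.1 h0
  intro c
  by_cases hf : y.1 0 ≠ 0 ∨ y.1 1 ≠ 0
  · by_cases hg : y.2.1 0 ≠ 0 ∨ y.2.1 1 ≠ 0
    · obtain ⟨s, t, hst⟩ := exists_solve hf (c 0)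
      obtain ⟨s', t', hst'⟩ := exists_solve hg (c 1)
      refine ⟨(![s, t, 0], ![s', t', 0], 0), ?_⟩
      ext i
      fin_cases i <;> simp [homEqDeriv_apply, hst, hst']
    · push Not at hg
      have hW : y.2.1 2 ≠ 0 := fun h => hy.2.1 (by ext i; fin_cases i <;> simp [hg, h])
      have hg0 : g.eval (zCoord y) = 0 := by simpa [hg, hW] using h2.symm
      have hg' := hfg.symm.left_derivative_ne_zero hg0
      set d := -c 1 * y.2.2 1 / (y.2.1 2 ^ 2 * g.derivative.eval (zCoord y)) with hd
      obtain ⟨s, t, hst⟩ := exists_solve hf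
        (c 0 + y.1 2 ^ 2 * f.derivative.eval (zCoord y) * (d * y.2.2 1 / y.2.2 1 ^ 2))
      refine ⟨(![s, t, 0], 0, ![d, 0]), ?_⟩
      ext i
      fin_cases i
      · simp [homEqDeriv_apply, hst]
      · simp [homEqDeriv_apply, hd]
        field_simp
  · push Not at hf
    have hW : y.1 2 ≠ 0 := fun h => hy.1 (by ext i; fin_cases i <;> simp [hf, h])
    have hf0 : f.eval (zCoord y) = 0 := by simpa [hf, hW] using h1.symm
    have hf' := hfg.left_derivative_ne_zero hf0
    have hg := ne_zero_or_of_eval_ne_zero hy.2.1 (hfg.right_ne_zero hf0) h2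
    set d := -c 0 * y.2.2 1 / (y.1 2 ^ 2 * f.derivative.eval (zCoord y)) with hd
    obtain ⟨s, t, hst⟩ := exists_solve hg
      (c 1 + y.2.1 2 ^ 2 * g.derivative.eval (zCoord y) * (d * y.2.2 1 / y.2.2 1 ^ 2))
    refine ⟨(0, ![s, t, 0], ![d, 0]), ?_⟩
    ext i
    fin_cases i
    · simp [homEqDeriv_apply, hd]
      field_simp
    · simp [homEqDeriv_apply, hst]

theorem homEq_eq_zero_iff_conifold {f g : ℂ[X]} {y : HomCoord} (hy : y ∈ finiteCoord) :
    affineCoord y ∈ conifold f g ↔ homEq f g y = 0 ∧ y.2.2 0 ≠ 0 := by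
  obtain ⟨h1, h2, h3⟩ := hy
  rw [homEq_eq_zero_iff, and_assoc]
  have e1 : ∀ a b c d : ℂ, c ≠ 0 → (a / c * (b / c) = d ↔ a * b = c ^ 2 * d) := by
    intro a b c d hc
    rw [div_mul_div_comm, div_eq_iff (mul_ne_zero hc hc)]
    constructor <;> intro h <;> rw [h] <;> ring
  refine and_congr (e1 _ _ _ _ h1) (and_congr (e1 _ _ _ _ h2) ?_)
  simp [affineCoord, h3]

/-- A deformation of a solution to one with W ≠ 0: W moves by ε, a non-zero one of U, V stays fixed,
and the other absorbs the change. If U = V = 0, then W ≠ 0 already and the point need not move,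
provided that z does not. -/
theorem exists_path_factor {f : ℂ[X]} {p : Fin 3 → ℂ} (hp : p ≠ 0) {z : ℂ}
    (h : p 0 * p 1 = p 2 ^ 2 * f.eval z) {ζ : ℂ → ℂ} (hζ : ContinuousAt ζ 0) (hζ0 : ζ 0 = z)
    (hz : p 0 = 0 → p 1 = 0 → ∀ ε, ζ ε = z) :
    ∃ P : ℂ → Fin 3 → ℂ, ContinuousAt P 0 ∧ P 0 = p ∧
      ∀ᶠ ε in 𝓝 0, ε ≠ 0 → P ε 2 ≠ 0 ∧ P ε 0 * P ε 1 = P ε 2 ^ 2 * f.eval (ζ ε) := by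
  have hne : ∀ᶠ ε : ℂ in 𝓝 0, ε ≠ 0 → p 2 + ε ≠ 0 := by
    by_cases hp2 : p 2 = 0
    · exact Eventually.of_forall fun ε hε => by simpa [hp2] using hε
    · have : ContinuousAt (fun ε : ℂ => p 2 + ε) 0 := by fun_prop
      filter_upwards [this.eventually_ne (by simpa using hp2)] with ε hε _ using hε
  have hc : ContinuousAt (fun ε : ℂ => (p 2 + ε) ^ 2 * f.eval (ζ ε)) 0 := by
    have h1 : ContinuousAt (fun ε => f.eval (ζ ε)) 0 :=
      ContinuousAt.comp (g := fun z => f.eval z) f.continuous.continuousAt hζ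
    have h2 : ContinuousAt (fun ε : ℂ => (p 2 + ε) ^ 2) 0 := by fun_prop
    exact h2.mul h1
  by_cases h0 : p 0 = 0
  · by_cases h1 : p 1 = 0
    · refine ⟨fun _ => p, continuousAt_const, rfl, Eventually.of_forall fun ε _ => ⟨?_, ?_⟩⟩
      · intro h2
        exact hp (by ext i; fin_cases i <;> simp [h0, h1, h2])
      · rw [hz h0 h1, h]
    · refine ⟨fun ε => ![(p 2 + ε) ^ 2 * f.eval (ζ ε) / p 1, p 1, p 2 + ε], ?_, ?_, ?_⟩
      · rw [continuousAt_pi]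
        intro i
        fin_cases i
        · exact hc.div_const _
        · exact continuousAt_const
        · exact continuousAt_const.add continuousAt_id
      · ext i
        fin_cases i
        · simp [hζ0, ← h, h1]
        · rfl
        · simp
      · filter_upwards [hne] with ε hε hε0
        exact ⟨hε hε0, by simp [h1]⟩
  · refine ⟨fun ε => ![p 0, (p 2 + ε) ^ 2 * f.eval (ζ ε) / p 0, p 2 + ε], ?_, ?_, ?_⟩
    · rw [continuousAt_pi]
      intro i
      fin_cases i
      · exact continuousAt_const
      · exact hc.div_const _
      · exact continuousAt_const.add continuousAt_id
    · ext i
      fin_cases i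
      · rfl
      · simp only [Fin.mk_one, Matrix.cons_val_one, Matrix.cons_val_zero, hζ0, add_zero, ← h]
        field_simp
      · simp
    · filter_upwards [hne] with ε hε hε0
      refine ⟨hε hε0, ?_⟩
      simp only [Matrix.cons_val]
      field_simp

/-- The equations are closed conditions. Conversely, every solution is a limit of points of the
conifold, reached by making W₁, W₂ and z non-zero along a path. -/
theorem mem_cone_compactification {f g : ℂ[X]} (hfg : IsAdmissible f g) {y : HomCoord}
    (hy1 : y.2.2 1 ≠ 0) :
    y ∈ cone (compactification f g) ↔ y ∈ nonzeroCoord ∧ homEq f g y = 0 := by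
  rw [compactification, mem_cone_closure]
  refine and_congr_right fun hy => ⟨fun h => ?_, fun h => ?_⟩
  · by_contra hne
    have h1 := (hasStrictFDerivAt_homEq f g hy1).continuousAt.eventually_ne hne
    obtain ⟨w, hw, hw'⟩ := ((mem_closure_iff_frequently.1 h).and_eventually h1).exists
    obtain ⟨hw1, hw2⟩ := mem_cone_openPart.1 hw
    exact hw' ((homEq_eq_zero_iff_conifold hw1).1 hw2).1
  · obtain ⟨h1, h2⟩ := homEq_eq_zero_iff.1 h
    set z := zCoord y with hz
    -- The coordinate z moves only when it is 0; there f and g do not vanish, which rules out the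
    -- case U = V = 0 that requires a fixed z.
    let ζ : ℂ → ℂ := fun ε => if z = 0 then ε else z
    have hζ : ContinuousAt ζ 0 := by
      by_cases h0 : z = 0
      · simp only [ζ, h0, if_true]
        exact continuousAt_id
      · simpa [ζ, h0] using continuousAt_const
    have hζ0 : ζ 0 = z := by simp only [ζ]; split_ifs with h <;> simp [h]
    have hζne : ∀ ε, ε ≠ 0 → ζ ε ≠ 0 := by
      intro ε hε; simp only [ζ]; split_ifs with h <;> assumption
    obtain ⟨P, hP, hP0, hPe⟩ := exists_path_factor hy.1 h1 hζ hζ0 (fun h3 h4 ε => by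
      have hz0 : z ≠ 0 := fun h => by
        rw [h] at h1
        exact (ne_zero_or_of_eval_ne_zero hy.1 hfg.left_zero h1).elim (· h3) (· h4)
      simp [ζ, hz0])
    obtain ⟨Q, hQ, hQ0, hQe⟩ := exists_path_factor hy.2.1 h2 hζ hζ0 (fun h3 h4 ε => by
      have hz0 : z ≠ 0 := fun h => by
        rw [h] at h2
        exact (ne_zero_or_of_eval_ne_zero hy.2.1 hfg.right_zero h2).elim (· h3) (· h4)
      simp [ζ, hz0])
    let γ : ℂ → HomCoord := fun ε => (P ε, Q ε, ![ζ ε * y.2.2 1, y.2.2 1])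
    have hγ : ContinuousAt γ 0 := by
      refine hP.prodMk (hQ.prodMk ?_)
      rw [continuousAt_pi]
      intro i
      fin_cases i
      · exact hζ.mul continuousAt_const
      · exact continuousAt_const
    have hγ0 : γ 0 = y := by
      refine Prod.ext hP0 (Prod.ext hQ0 ?_)
      ext i
      fin_cases i
      · simp [γ, hζ0, hz, zCoord, hy1]
      · rfl
    have hev : ∀ᶠ ε in 𝓝[≠] (0 : ℂ), γ ε ∈ cone (openPart f g) := by
      filter_upwards [hPe.filter_mono nhdsWithin_le_nhds, hQe.filter_mono nhdsWithin_le_nhds,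
        self_mem_nhdsWithin] with ε h3 h4 h5
      have h6 : γ ε ∈ finiteCoord := ⟨(h3 h5).1, (h4 h5).1, hy1⟩
      have h7 : zCoord (γ ε) = ζ ε := by simp [γ, zCoord, hy1]
      refine mem_cone_openPart.2 ⟨h6, (homEq_eq_zero_iff_conifold h6).2 ⟨?_, ?_⟩⟩
      · rw [homEq_eq_zero_iff, h7]
        exact ⟨(h3 h5).2, (h4 h5).2⟩
      · exact mul_ne_zero (hζne ε h5) hy1
    have ht : Tendsto γ (𝓝[≠] 0) (𝓝 y) := by
      have := hγ.tendsto.mono_left (nhdsWithin_le_nhds (s := {0}ᶜ))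
      rwa [hγ0] at this
    exact mem_closure_of_tendsto ht hev

end Equations

/-! ### Smooth points and tangent spaces over finite z. -/

section SmoothLocus

open Set Filter

variable {f g : ℂ[X]}

theorem eventually_mem_compactification (hfg : IsAdmissible f g) {y : HomCoord}
    (hy : y ∈ nonzeroCoord) (hy1 : y.2.2 1 ≠ 0) :
    ∀ᶠ w in 𝓝 y, (w ∈ cone (compactification f g) ↔ homEq f g w = 0) := by
  have h1 : ContinuousAt (fun w : HomCoord => w.2.2 1) y := by fun_prop
  filter_upwards [isOpen_nonzeroCoord.mem_nhds hy, h1.eventually_ne hy1] with w hw hw1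
  rw [mem_cone_compactification hfg hw1]
  exact and_iff_right hw

theorem tangentConeAt_compactification (hfg : IsAdmissible f g) {y : HomCoord}
    (hy : y ∈ cone (compactification f g)) (hy1 : y.2.2 1 ≠ 0) :
    tangentConeAt ℂ (cone (compactification f g)) y = {t | homEqDeriv f g y t = 0} := by
  obtain ⟨h1, h2⟩ := (mem_cone_compactification hfg hy1).1 hy
  exact tangentConeAt_eq_ker (hasStrictFDerivAt_homEq f g hy1) h2
    (homEqDeriv_surjective hfg h1 hy1 h2) (eventually_mem_compactification hfg h1 hy1)

theorem tangentConeAt_real_compactification (hfg : IsAdmissible f g) {y : HomCoord}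
    (hy : y ∈ cone (compactification f g)) (hy1 : y.2.2 1 ≠ 0) :
    tangentConeAt ℝ (cone (compactification f g)) y = {t | homEqDeriv f g y t = 0} := by
  obtain ⟨h1, h2⟩ := (mem_cone_compactification hfg hy1).1 hy
  exact tangentConeAt_eq_ker ((hasStrictFDerivAt_homEq f g hy1).restrictScalars ℝ) h2
    (homEqDeriv_surjective hfg h1 hy1 h2) (eventually_mem_compactification hfg h1 hy1)

theorem isSmoothPoint_of_finite (hfg : IsAdmissible f g) {y : HomCoord}
    (hy : y ∈ cone (compactification f g)) (hy1 : y.2.2 1 ≠ 0) : IsSmoothPoint f g y := by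
  obtain ⟨h1, h2⟩ := (mem_cone_compactification hfg hy1).1 hy
  refine ⟨hy, homEq f g, analyticAt_homEq f g hy1, ?_,
    eventually_mem_compactification hfg h1 hy1⟩
  rw [(hasStrictFDerivAt_homEq f g hy1).hasFDerivAt.fderiv]
  exact homEqDeriv_surjective hfg h1 hy1 h2

/-! ### The points with z = ∞ and their singularity. -/

section Infinity

theorem tendsto_norm_eval_atTop (hf : 0 < f.natDegree) {α : Type*} {l : Filter α} {u : α → ℂ}
    (hu : Tendsto (fun a => ‖u a‖) l atTop) : Tendsto (fun a => ‖f.eval (u a)‖) l atTop :=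
  f.tendsto_norm_atTop (Polynomial.natDegree_pos_iff_degree_pos.1 hf) hu

/-- Solving for W² gives c / f(z₀/ε), which tends to 0 since f has positive degree; any choice of
square roots then tends to 0. -/
theorem exists_small_sqrt (hf : 0 < f.natDegree) {c z₀ : ℂ} (hc : c ≠ 0) (hz₀ : z₀ ≠ 0) :
    ∃ W : ℂ → ℂ, Tendsto W (𝓝[≠] 0) (𝓝 0) ∧
      ∀ᶠ ε in 𝓝[≠] (0 : ℂ), W ε ≠ 0 ∧ c = W ε ^ 2 * f.eval (z₀ / ε) := by
  have h1 : Tendsto (fun ε : ℂ => ‖z₀ / ε‖) (𝓝[≠] 0) atTop := by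
    simp_rw [div_eq_mul_inv, norm_mul]
    refine Tendsto.const_mul_atTop (norm_pos_iff.2 hz₀) ?_
    exact tendsto_norm_inv_nhdsNE_zero_atTop
  have h2 := tendsto_norm_eval_atTop hf h1
  have hsq : ∀ a : ℂ, ∃ w : ℂ, w ^ 2 = a := fun a => IsAlgClosed.exists_pow_nat_eq a two_pos
  choose s hs using hsq
  refine ⟨fun ε => s (c / f.eval (z₀ / ε)), ?_, ?_⟩
  · rw [tendsto_zero_iff_norm_tendsto_zero]
    have h3 : Tendsto (fun ε : ℂ => ‖c‖ / ‖f.eval (z₀ / ε)‖) (𝓝[≠] 0) (𝓝 0) :=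
      h2.const_div_atTop _
    have h4 : Tendsto (fun ε : ℂ => √(‖c‖ / ‖f.eval (z₀ / ε)‖)) (𝓝[≠] 0) (𝓝 0) := by
      simpa using h3.sqrt
    refine h4.congr fun ε => ?_
    rw [← norm_div, ← hs (c / f.eval (z₀ / ε)), norm_pow, Real.sqrt_sq (norm_nonneg _), hs]
  · filter_upwards [h2.eventually_gt_atTop 0] with ε hε
    have h5 : f.eval (z₀ / ε) ≠ 0 := norm_pos_iff.1 hε
    refine ⟨fun h => ?_, ?_⟩
    · have := hs (c / f.eval (z₀ / ε))
      rw [h, zero_pow two_ne_zero, eq_comm, div_eq_zero_iff] at this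
      exact this.elim hc h5
    · rw [hs]; field_simp

theorem mem_closure_of_infinite_of_ne_zero (hfg : IsAdmissible f g) {y : HomCoord}
    (h1 : y.1 2 = 0) (h2 : y.2.1 2 = 0) (h3 : y.2.2 1 = 0) (hz : y.2.2 0 ≠ 0)
    (hu : y.1 0 * y.1 1 ≠ 0) (hv : y.2.1 0 * y.2.1 1 ≠ 0) : y ∈ closure (cone (openPart f g)) := by
  obtain ⟨W, hW, hWe⟩ := exists_small_sqrt hfg.left_degree hu hz
  obtain ⟨W', hW', hWe'⟩ := exists_small_sqrt hfg.right_degree hv hz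
  let γ : ℂ → HomCoord := fun ε =>
    (![y.1 0, y.1 1, W ε], ![y.2.1 0, y.2.1 1, W' ε], ![y.2.2 0, ε])
  have hγ : Tendsto γ (𝓝[≠] 0) (𝓝 y) := by
    refine Tendsto.prodMk_nhds ?_ (Tendsto.prodMk_nhds ?_ ?_)
    · rw [tendsto_pi_nhds]
      intro i
      fin_cases i
      · exact tendsto_const_nhds
      · exact tendsto_const_nhds
      · simpa [h1] using hW
    · rw [tendsto_pi_nhds]
      intro i
      fin_cases i
      · exact tendsto_const_nhds
      · exact tendsto_const_nhds
      · simpa [h2] using hW'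
    · rw [tendsto_pi_nhds]
      intro i
      fin_cases i
      · exact tendsto_const_nhds
      · simp only [Fin.mk_one, Matrix.cons_val_one, Matrix.cons_val_zero, h3]
        exact tendsto_id.mono_left nhdsWithin_le_nhds
  refine mem_closure_of_tendsto hγ ?_
  filter_upwards [hWe, hWe', self_mem_nhdsWithin] with ε h4 h5 h6
  have h7 : γ ε ∈ finiteCoord := ⟨h4.1, h5.1, h6⟩
  refine mem_cone_openPart.2 ⟨h7, (homEq_eq_zero_iff_conifold h7).2 ⟨?_, hz⟩⟩
  rw [homEq_eq_zero_iff]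
  exact ⟨h4.2, h5.2⟩

/-- Such points with all U, V non-zero are limits of conifold points through small square roots W;
the remaining ones are limits of these, after a shift of all U and V by ε. -/
theorem mem_compactification_of_infinite (hfg : IsAdmissible f g) {y : HomCoord}
    (hy : y ∈ nonzeroCoord) (h1 : y.1 2 = 0) (h2 : y.2.1 2 = 0) (h3 : y.2.2 1 = 0) :
    y ∈ cone (compactification f g) := by
  refine mem_cone_closure.2 ⟨hy, ?_⟩
  have hz : y.2.2 0 ≠ 0 := fun h => hy.2.2 (by ext i; fin_cases i <;> simp [h, h3])
  rw [← closure_closure]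
  let γ : ℂ → HomCoord := fun ε =>
    (![y.1 0 + ε, y.1 1 + ε, 0], ![y.2.1 0 + ε, y.2.1 1 + ε, 0], y.2.2)
  have hγ : Continuous γ := by
    refine Continuous.prodMk ?_ (Continuous.prodMk ?_ continuous_const) <;>
    · refine continuous_pi fun i => ?_
      fin_cases i <;> simp <;> fun_prop
  have hγ0 : γ 0 = y := by
    refine Prod.ext ?_ (Prod.ext ?_ rfl) <;>
    · ext i
      fin_cases i <;> simp [γ, h1, h2]
  have hne : ∀ a : ℂ, ∀ᶠ ε : ℂ in 𝓝[≠] 0, a + ε ≠ 0 := by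
    intro a
    by_cases ha : a = 0
    · filter_upwards [self_mem_nhdsWithin] with ε hε
      simpa [ha] using hε
    · have : ContinuousAt (fun ε : ℂ => a + ε) 0 := by fun_prop
      exact (this.eventually_ne (by simpa using ha)).filter_mono nhdsWithin_le_nhds
  have ht : Tendsto γ (𝓝[≠] 0) (𝓝 y) := by
    have := (hγ.tendsto 0).mono_left (nhdsWithin_le_nhds (s := {0}ᶜ))
    rwa [hγ0] at this
  refine mem_closure_of_tendsto ht ?_
  filter_upwards [hne (y.1 0), hne (y.1 1), hne (y.2.1 0), hne (y.2.1 1)] with ε a1 a2 a3 a4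
  exact mem_closure_of_infinite_of_ne_zero hfg rfl rfl h3 hz (mul_ne_zero a1 a2)
    (mul_ne_zero a3 a4)

/-- If W were non-zero at the point, UV/W² would have a finite limit there; on the conifold this
quotient is the value of f or g at z, which is unbounded as z → ∞. -/
theorem eq_zero_of_infinite (hfg : IsAdmissible f g) {y : HomCoord}
    (hy : y ∈ cone (compactification f g)) (h3 : y.2.2 1 = 0) : y.1 2 = 0 ∧ y.2.1 2 = 0 := by
  obtain ⟨hy0, hyc⟩ := mem_cone_closure.1 hy
  have hz : y.2.2 0 ≠ 0 := fun h => hy0.2.2 (by ext i; fin_cases i <;> simp [h, h3])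
  set l := 𝓝[cone (openPart f g)] y with hl
  have : l.NeBot := mem_closure_iff_nhdsWithin_neBot.1 hyc
  have hz1 : Tendsto (fun w : HomCoord => ‖zCoord w‖) l atTop := by
    have h4 : Tendsto (fun w : HomCoord => ‖w.2.2 1‖) l (𝓝[>] 0) := by
      refine tendsto_nhdsWithin_iff.2 ⟨?_, ?_⟩
      · have : ContinuousAt (fun w : HomCoord => ‖w.2.2 1‖) y := by fun_prop
        have := this.tendsto.mono_left (nhdsWithin_le_nhds (s := cone (openPart f g)))
        simpa [h3] using this
      · filter_upwards [self_mem_nhdsWithin] with w hw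
        exact norm_pos_iff.2 (mem_cone_openPart.1 hw).1.2.2
    have h5 : Tendsto (fun w : HomCoord => ‖w.2.2 0‖) l (𝓝 ‖y.2.2 0‖) := by
      have : ContinuousAt (fun w : HomCoord => ‖w.2.2 0‖) y := by fun_prop
      exact this.tendsto.mono_left nhdsWithin_le_nhds
    simp_rw [zCoord, norm_div, div_eq_mul_inv]
    exact Tendsto.pos_mul_atTop (norm_pos_iff.2 hz) h5 (tendsto_inv_nhdsGT_zero.comp h4)
  constructor
  · by_contra h6
    have h7 : ContinuousAt (fun w : HomCoord => ‖w.1 0 * w.1 1 / w.1 2 ^ 2‖) y := by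
      refine (ContinuousAt.div (by fun_prop) (by fun_prop) ?_).norm
      exact pow_ne_zero 2 h6
    refine not_tendsto_nhds_of_tendsto_atTop (tendsto_norm_eval_atTop hfg.left_degree hz1) _
      ((h7.tendsto.mono_left nhdsWithin_le_nhds).congr' ?_)
    filter_upwards [self_mem_nhdsWithin] with w hw
    obtain ⟨h8, h9⟩ := mem_cone_openPart.1 hw
    have h10 := (homEq_eq_zero_iff.1 ((homEq_eq_zero_iff_conifold h8).1 h9).1).1
    rw [h10, mul_div_cancel_left₀ _ (pow_ne_zero 2 h8.1)]
  · by_contra h6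
    have h7 : ContinuousAt (fun w : HomCoord => ‖w.2.1 0 * w.2.1 1 / w.2.1 2 ^ 2‖) y := by
      refine (ContinuousAt.div (by fun_prop) (by fun_prop) ?_).norm
      exact pow_ne_zero 2 h6
    refine not_tendsto_nhds_of_tendsto_atTop (tendsto_norm_eval_atTop hfg.right_degree hz1) _
      ((h7.tendsto.mono_left nhdsWithin_le_nhds).congr' ?_)
    filter_upwards [self_mem_nhdsWithin] with w hw
    obtain ⟨h8, h9⟩ := mem_cone_openPart.1 hw
    have h10 := (homEq_eq_zero_iff.1 ((homEq_eq_zero_iff_conifold h8).1 h9).1).2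
    rw [h10, mul_div_cancel_left₀ _ (pow_ne_zero 2 h8.2.1)]

/-- The reflection of one homogeneous coordinate preserves the conifold. -/
theorem neg_left_mem_openPart {y : HomCoord} (hy : y ∈ cone (openPart f g)) :
    ((![y.1 0, y.1 1, -y.1 2], y.2) : HomCoord) ∈ cone (openPart f g) := by
  obtain ⟨h1, h2⟩ := mem_cone_openPart.1 hy
  have h3 : ((![y.1 0, y.1 1, -y.1 2], y.2) : HomCoord) ∈ finiteCoord :=
    ⟨by simpa using h1.1, h1.2⟩
  rw [homEq_eq_zero_iff_conifold h1, homEq_eq_zero_iff] at h2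
  rw [mem_cone_openPart, homEq_eq_zero_iff_conifold h3, homEq_eq_zero_iff]
  refine ⟨h3, ⟨?_, h2.1.2⟩, h2.2⟩
  simpa [zCoord] using h2.1.1

theorem neg_right_mem_openPart {y : HomCoord} (hy : y ∈ cone (openPart f g)) :
    ((y.1, ![y.2.1 0, y.2.1 1, -y.2.1 2], y.2.2) : HomCoord) ∈ cone (openPart f g) := by
  obtain ⟨h1, h2⟩ := mem_cone_openPart.1 hy
  have h3 : ((y.1, ![y.2.1 0, y.2.1 1, -y.2.1 2], y.2.2) : HomCoord) ∈ finiteCoord :=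
    ⟨h1.1, by simpa using h1.2.1, h1.2.2⟩
  rw [homEq_eq_zero_iff_conifold h1, homEq_eq_zero_iff] at h2
  rw [mem_cone_openPart, homEq_eq_zero_iff_conifold h3, homEq_eq_zero_iff]
  refine ⟨h3, ⟨h2.1.1, ?_⟩, h2.2⟩
  simpa [zCoord] using h2.1.2

/-- The compactification is singular at all points with `z = ∞`. -/
theorem not_isSmoothPoint_of_infinite (hfg : IsAdmissible f g) {y : HomCoord} (h3 : y.2.2 1 = 0) :
    ¬ IsSmoothPoint f g y := by
  rintro ⟨hy, F, hF, hsurj, hFe⟩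
  obtain ⟨h1, h2⟩ := eq_zero_of_infinite hfg hy h3
  obtain ⟨hy0, hyc⟩ := mem_cone_closure.1 hy
  have hst := hF.hasStrictFDerivAt
  -- Both w and σ w lie in the zero set of F and differ by a non-zero multiple of v, arbitrarily
  -- near y; strict differentiability then kills v.
  have hpair : ∀ σ : HomCoord → HomCoord, Continuous σ → σ y = y →
      (∀ w ∈ cone (openPart f g), σ w ∈ cone (openPart f g)) → ∀ v : HomCoord,
      (∀ w ∈ cone (openPart f g), ∃ c : ℂ, c ≠ 0 ∧ w - σ w = c • v) → fderiv ℂ F y v = 0 := by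
    intro σ hσ hσy hσm v hv
    refine strictFDeriv_eq_zero hst ?_
    have ht : Tendsto (fun w => (w, σ w)) (𝓝 y) (𝓝 (y, y)) := by
      have := (continuous_id.prodMk hσ).tendsto y
      simpa [hσy] using this
    refine ht.frequently ?_
    have hσt : Tendsto σ (𝓝 y) (𝓝 y) := by
      have := hσ.tendsto y
      rwa [hσy] at this
    refine ((mem_closure_iff_frequently.1 hyc).and_eventually
      (hFe.and (hσt.eventually hFe))).mono ?_
    rintro w ⟨hw, h4, h5⟩
    obtain ⟨c, hc, hcv⟩ := hv w hw
    refine ⟨c, hc, hcv, ?_⟩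
    rw [h4.1 (cone_openPart_subset f g hw), h5.1 (cone_openPart_subset f g (hσm w hw))]
  have e1 : fderiv ℂ F y (![0, 0, 1], 0, 0) = 0 := by
    refine hpair (fun w => (![w.1 0, w.1 1, -w.1 2], w.2)) ?_ ?_
      (fun w hw => neg_left_mem_openPart hw) _ ?_
    · refine Continuous.prodMk (continuous_pi fun i => ?_) continuous_snd
      fin_cases i <;> simp <;> fun_prop
    · refine Prod.ext ?_ rfl
      ext i
      fin_cases i <;> simp [h1]
    · intro w hw
      refine ⟨2 * w.1 2, mul_ne_zero two_ne_zero (mem_cone_openPart.1 hw).1.1, ?_⟩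
      refine Prod.ext ?_ (by simp; rfl)
      ext i
      fin_cases i <;> simp
      ring
  have e2 : fderiv ℂ F y (0, ![0, 0, 1], 0) = 0 := by
    refine hpair (fun w => (w.1, ![w.2.1 0, w.2.1 1, -w.2.1 2], w.2.2)) ?_ ?_
      (fun w hw => neg_right_mem_openPart hw) _ ?_
    · refine continuous_fst.prodMk (Continuous.prodMk (continuous_pi fun i => ?_) (by fun_prop))
      fin_cases i <;> simp <;> fun_prop
    · refine Prod.ext rfl (Prod.ext ?_ rfl)
      ext i
      fin_cases i <;> simp [h2]
    · intro w hw
      refine ⟨2 * w.2.1 2, mul_ne_zero two_ne_zero (mem_cone_openPart.1 hw).1.2.1, ?_⟩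
      refine Prod.ext (by simp) (Prod.ext ?_ (by simp))
      ext i
      fin_cases i <;> simp
      ring
  -- Directions along the locus W₁ = W₂ = z₁ = 0 stay inside the compactification.
  have e3 : ∀ v : HomCoord, v.1 2 = 0 → v.2.1 2 = 0 → v.2.2 1 = 0 → fderiv ℂ F y v = 0 := by
    intro v hv1 hv2 hv3
    refine strictFDeriv_eq_zero hst ?_
    have hc : Continuous (fun δ : ℂ => y + δ • v) := by fun_prop
    have ht0 : Tendsto (fun δ : ℂ => y + δ • v) (𝓝[≠] 0) (𝓝 y) := by
      have := (hc.tendsto 0).mono_left (nhdsWithin_le_nhds (s := {0}ᶜ))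
      simpa using this
    refine (ht0.prodMk_nhds tendsto_const_nhds).frequently (Eventually.frequently ?_)
    filter_upwards [ht0.eventually hFe, ht0.eventually (isOpen_nonzeroCoord.mem_nhds hy0),
      self_mem_nhdsWithin] with δ h4 h5 h6
    refine ⟨δ, h6, by simp, ?_⟩
    rw [hFe.self_of_nhds.1 hy, h4.1]
    exact mem_compactification_of_infinite hfg h5 (by simp [h1, hv1]) (by simp [h2, hv2])
      (by simp [h3, hv3])
  -- What remains is the direction of z₁, so the differential has rank at most one and cannot be
  -- onto ℂ².
  have e4 : ∀ t : HomCoord, fderiv ℂ F y t = t.2.2 1 • fderiv ℂ F y (0, 0, ![0, 1]) := by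
    intro t
    have ht : t = (![t.1 0, t.1 1, 0], ![t.2.1 0, t.2.1 1, 0], ![t.2.2 0, 0]) +
        t.1 2 • (![0, 0, 1], 0, 0) + t.2.1 2 • (0, ![0, 0, 1], 0) +
        t.2.2 1 • (0, 0, ![0, 1]) := by
      refine Prod.ext ?_ (Prod.ext ?_ ?_) <;>
      · ext i
        fin_cases i <;> simp
    conv_lhs => rw [ht]
    rw [map_add, map_add, map_add, map_smul, map_smul, map_smul, e1, e2,
      e3 _ (by simp) (by simp) (by simp)]
    simp
  obtain ⟨t, ht⟩ := hsurj ![1, 0]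
  obtain ⟨t', ht'⟩ := hsurj ![0, 1]
  rw [e4] at ht ht'
  have a1 := congrFun ht 0
  have a2 := congrFun ht 1
  have a3 := congrFun ht' 1
  simp only [Pi.smul_apply, smul_eq_mul, Matrix.cons_val] at a1 a2 a3
  rcases mul_eq_zero.1 a2 with h | h
  · simp [h] at a1
  · simp [h] at a3

end Infinity

theorem isSmoothPoint_iff (hfg : IsAdmissible f g) {y : HomCoord} :
    IsSmoothPoint f g y ↔ y ∈ cone (compactification f g) ∧ y.2.2 1 ≠ 0 :=
  ⟨fun h => ⟨h.1, fun h3 => not_isSmoothPoint_of_infinite hfg h3 h⟩,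
    fun h => isSmoothPoint_of_finite hfg h.1 h.2⟩

end SmoothLocus

/-! ### Affine equations, moment map and change of coordinates. -/

section AffineGeometry

open Set Filter ComplexConjugate

variable {f g : ℂ[X]}

/-- The equations of the conifold. -/
def conifoldEq (f g : ℂ[X]) (x : Fin 5 → ℂ) : Fin 2 → ℂ :=
  ![x 0 * x 1 - f.eval (x 4), x 2 * x 3 - g.eval (x 4)]

theorem mem_conifold_iff {x : Fin 5 → ℂ} :
    x ∈ conifold f g ↔ conifoldEq f g x = 0 ∧ x 4 ≠ 0 := by
  rw [funext_iff, Fin.forall_fin_two]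
  simp [conifold, conifoldEq, sub_eq_zero, and_assoc]

/-- The derivative of `conifoldEq`. -/
def conifoldEqDeriv (f g : ℂ[X]) (x : Fin 5 → ℂ) : (Fin 5 → ℂ) →L[ℂ] (Fin 2 → ℂ) :=
  ContinuousLinearMap.pi
    ![x 1 • ContinuousLinearMap.proj (R := ℂ) (φ := fun _ : Fin 5 => ℂ) 0
        + x 0 • ContinuousLinearMap.proj (R := ℂ) (φ := fun _ : Fin 5 => ℂ) 1
        - f.derivative.eval (x 4) • ContinuousLinearMap.proj (R := ℂ) (φ := fun _ : Fin 5 => ℂ) 4,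
      x 3 • ContinuousLinearMap.proj (R := ℂ) (φ := fun _ : Fin 5 => ℂ) 2
        + x 2 • ContinuousLinearMap.proj (R := ℂ) (φ := fun _ : Fin 5 => ℂ) 3
        - g.derivative.eval (x 4) • ContinuousLinearMap.proj (R := ℂ) (φ := fun _ : Fin 5 => ℂ) 4]

theorem conifoldEqDeriv_apply (x t : Fin 5 → ℂ) : conifoldEqDeriv f g x t =
    ![t 0 * x 1 + x 0 * t 1 - f.derivative.eval (x 4) * t 4,
      t 2 * x 3 + x 2 * t 3 - g.derivative.eval (x 4) * t 4] := by
  ext i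
  fin_cases i <;> simp [conifoldEqDeriv, mul_comm]

theorem conifoldEqDeriv_eq_zero_iff {x t : Fin 5 → ℂ} : conifoldEqDeriv f g x t = 0 ↔
    t 0 * x 1 + x 0 * t 1 = f.derivative.eval (x 4) * t 4 ∧
      t 2 * x 3 + x 2 * t 3 = g.derivative.eval (x 4) * t 4 := by
  rw [conifoldEqDeriv_apply, funext_iff, Fin.forall_fin_two]
  simp [sub_eq_zero]

theorem continuous_conifoldEqDeriv (f g : ℂ[X]) : Continuous (conifoldEqDeriv f g) := by
  have hp : ∀ p : ℂ[X], Continuous fun x : Fin 5 → ℂ => p.eval (x 4) := fun p =>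
    p.continuous.comp (continuous_apply 4)
  rw [continuous_clm_apply]
  intro t
  simp_rw [conifoldEqDeriv_apply]
  refine continuous_pi fun i => ?_
  have h1 := hp f.derivative
  have h2 := hp g.derivative
  fin_cases i <;> simp <;> fun_prop

theorem hasStrictFDerivAt_conifoldEq (f g : ℂ[X]) (x : Fin 5 → ℂ) :
    HasStrictFDerivAt (conifoldEq f g) (conifoldEqDeriv f g x) x := by
  have hp : ∀ i : Fin 5, HasStrictFDerivAt (fun x : Fin 5 → ℂ => x i)
      (ContinuousLinearMap.proj (R := ℂ) (φ := fun _ : Fin 5 => ℂ) i) x := fun i =>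
    (ContinuousLinearMap.proj (R := ℂ) (φ := fun _ : Fin 5 => ℂ) i).hasStrictFDerivAt
  rw [hasStrictFDerivAt_pi']
  intro i
  fin_cases i
  · refine (((hp 0).mul (hp 1)).sub
      ((f.hasStrictDerivAt (x 4)).comp_hasStrictFDerivAt x (hp 4))).congr_fderiv
      (ContinuousLinearMap.ext fun t => ?_)
    simp [conifoldEqDeriv_apply]
    ring
  · refine (((hp 2).mul (hp 3)).sub
      ((g.hasStrictDerivAt (x 4)).comp_hasStrictFDerivAt x (hp 4))).congr_fderiv
      (ContinuousLinearMap.ext fun t => ?_)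
    simp [conifoldEqDeriv_apply]
    ring

theorem conifold_relations {x : Fin 5 → ℂ} (hx : x ∈ conifold f g) :
    x 0 * x 1 = f.eval (x 4) ∧ x 2 * x 3 = g.eval (x 4) ∧ x 4 ≠ 0 := hx

theorem IsAdmissible.ne_zero_or (hfg : IsAdmissible f g) {x : Fin 5 → ℂ} (hx : x ∈ conifold f g) :
    (x 0 ≠ 0 ∨ x 1 ≠ 0) ∨ (x 2 ≠ 0 ∨ x 3 ≠ 0) := by
  by_contra! h
  obtain ⟨h1, h2, -⟩ := conifold_relations hx
  rw [h.1.1, zero_mul, eq_comm] at h1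
  rw [h.2.1, zero_mul, eq_comm] at h2
  exact hfg.right_ne_zero h1 h2

theorem conifoldEqDeriv_surjective (hfg : IsAdmissible f g) {x : Fin 5 → ℂ}
    (hx : x ∈ conifold f g) : Function.Surjective (conifoldEqDeriv f g x) := by
  obtain ⟨h1, h2, h3⟩ := conifold_relations hx
  intro c
  by_cases hf : x 0 ≠ 0 ∨ x 1 ≠ 0
  · by_cases hg : x 2 ≠ 0 ∨ x 3 ≠ 0
    · obtain ⟨s, t, hst⟩ := exists_solve hf (c 0)
      obtain ⟨s', t', hst'⟩ := exists_solve hg (c 1)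
      refine ⟨![s, t, s', t', 0], ?_⟩
      rw [conifoldEqDeriv_apply]
      ext i
      fin_cases i <;> simp [hst, hst']
    · push Not at hg
      have hg0 : g.eval (x 4) = 0 := by rw [← h2, hg.1, zero_mul]
      have hg' := hfg.symm.left_derivative_ne_zero hg0
      set d := -c 1 / g.derivative.eval (x 4) with hd
      obtain ⟨s, t, hst⟩ := exists_solve hf (c 0 + f.derivative.eval (x 4) * d)
      refine ⟨![s, t, 0, 0, d], ?_⟩
      rw [conifoldEqDeriv_apply]
      ext i
      fin_cases i
      · simp [hst]
      · simp [hd]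
        field_simp
  · push Not at hf
    have hf0 : f.eval (x 4) = 0 := by rw [← h1, hf.1, zero_mul]
    have hf' := hfg.left_derivative_ne_zero hf0
    have hg : x 2 ≠ 0 ∨ x 3 ≠ 0 := by
      refine (hfg.ne_zero_or hx).resolve_left ?_
      simp [hf]
    set d := -c 0 / f.derivative.eval (x 4) with hd
    obtain ⟨s, t, hst⟩ := exists_solve hg (c 1 + g.derivative.eval (x 4) * d)
    refine ⟨![0, 0, s, t, d], ?_⟩
    rw [conifoldEqDeriv_apply]
    ext i
    fin_cases i
    · simp [hd]
      field_simp
    · simp [hst]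

theorem eventually_mem_conifold {x : Fin 5 → ℂ} (hx : x ∈ conifold f g) :
    ∀ᶠ w in 𝓝 x, (w ∈ conifold f g ↔ conifoldEq f g w = 0) := by
  filter_upwards [(continuous_apply (4 : Fin 5)).continuousAt.eventually_ne
    (mem_conifold_iff.1 hx).2] with w hw
  rw [mem_conifold_iff]
  exact and_iff_left hw

theorem tangentConeAt_conifold (hfg : IsAdmissible f g) {x : Fin 5 → ℂ} (hx : x ∈ conifold f g) :
    tangentConeAt ℂ (conifold f g) x = {t | conifoldEqDeriv f g x t = 0} :=
  tangentConeAt_eq_ker (hasStrictFDerivAt_conifoldEq f g x) (mem_conifold_iff.1 hx).1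
    (conifoldEqDeriv_surjective hfg hx) (eventually_mem_conifold hx)

/-- The components of the fibration as smooth real functions; the last one is `|z|²`. -/
def momentMap (x : Fin 5 → ℂ) : Fin 3 → ℝ :=
  ![1 / 2 * (‖x 0‖ ^ 2 - ‖x 1‖ ^ 2), 1 / 2 * (‖x 2‖ ^ 2 - ‖x 3‖ ^ 2), ‖x 4‖ ^ 2]

/-- The real part of `conj a * t i` as a functional of `t`. -/
def reConjProj (i : Fin 5) (a : ℂ) : (Fin 5 → ℂ) →L[ℝ] ℝ :=
  (innerSL ℝ a).comp (ContinuousLinearMap.proj (R := ℝ) (φ := fun _ : Fin 5 => ℂ) i)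

theorem reConjProj_apply (i : Fin 5) (a : ℂ) (t : Fin 5 → ℂ) :
    reConjProj i a t = (conj a * t i).re := by
  simp [reConjProj, Complex.inner, mul_comm]

/-- The derivative of `momentMap`. -/
def momentDeriv (x : Fin 5 → ℂ) : (Fin 5 → ℂ) →L[ℝ] (Fin 3 → ℝ) :=
  ContinuousLinearMap.pi
    ![reConjProj 0 (x 0) - reConjProj 1 (x 1), reConjProj 2 (x 2) - reConjProj 3 (x 3),
      (2 : ℝ) • reConjProj 4 (x 4)]

theorem momentDeriv_apply (x t : Fin 5 → ℂ) : momentDeriv x t =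
    ![(conj (x 0) * t 0).re - (conj (x 1) * t 1).re, (conj (x 2) * t 2).re - (conj (x 3) * t 3).re,
      2 * (conj (x 4) * t 4).re] := by
  ext i
  fin_cases i <;> simp [momentDeriv, reConjProj_apply]

theorem hasStrictFDerivAt_normSq_apply (i : Fin 5) (x : Fin 5 → ℂ) :
    HasStrictFDerivAt (fun x : Fin 5 → ℂ => ‖x i‖ ^ 2) ((2 : ℝ) • reConjProj i (x i)) x := by
  have h := (hasStrictFDerivAt_norm_sq (x i)).comp x
    (ContinuousLinearMap.proj (R := ℝ) (φ := fun _ : Fin 5 => ℂ) i).hasStrictFDerivAt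
  refine h.congr_fderiv (ContinuousLinearMap.ext fun t => ?_)
  simp [reConjProj]
  ring

theorem hasStrictFDerivAt_momentMap (x : Fin 5 → ℂ) :
    HasStrictFDerivAt momentMap (momentDeriv x) x := by
  have hp := fun i => hasStrictFDerivAt_normSq_apply i x
  rw [hasStrictFDerivAt_pi']
  intro i
  fin_cases i
  · refine (((hp 0).sub (hp 1)).const_mul (1 / 2)).congr_fderiv
      (ContinuousLinearMap.ext fun t => ?_)
    simp [momentDeriv]
    ring
  · refine (((hp 2).sub (hp 3)).const_mul (1 / 2)).congr_fderiv
      (ContinuousLinearMap.ext fun t => ?_)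
    simp [momentDeriv]
    ring
  · refine (hp 4).congr_fderiv (ContinuousLinearMap.ext fun t => ?_)
    simp [momentDeriv]

theorem contDiff_momentMap : ContDiff ℝ ∞ momentMap := by
  have hp : ∀ i : Fin 5, ContDiff ℝ ∞ fun x : Fin 5 → ℂ => ‖x i‖ ^ 2 := fun i =>
    (contDiff_apply ℝ ℂ i).norm_sq ℝ
  rw [contDiff_pi]
  intro i
  fin_cases i
  · exact contDiff_const.mul ((hp 0).sub (hp 1))
  · exact contDiff_const.mul ((hp 2).sub (hp 3))
  · exact hp 4

/-- This replaces extended-real values by a polynomial map that is smooth everywhere; |z|² carries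
the same information as |z|. -/
theorem fibration_eq_iff {x x' : Fin 5 → ℂ} :
    fibration x = fibration x' ↔ momentMap x = momentMap x' := by
  have h : ∀ a b : ℂ, ‖a‖ₑ = ‖b‖ₑ ↔ ‖a‖ ^ 2 = ‖b‖ ^ 2 := by
    intro a b
    rw [sq_eq_sq₀ (norm_nonneg _) (norm_nonneg _), ← ofReal_norm, ← ofReal_norm,
      ENNReal.ofReal_eq_ofReal_iff (norm_nonneg _) (norm_nonneg _)]
  simp only [fibration, Prod.mk.injEq, EReal.coe_eq_coe_iff, h]
  rw [funext_iff, Fin.forall_fin_succ, Fin.forall_fin_two]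
  rfl

/-- The points of the conifold at which the differential of the fibration is surjective. -/
def IsNondegenerate (x : Fin 5 → ℂ) : Prop := (x 0 ≠ 0 ∨ x 1 ≠ 0) ∧ (x 2 ≠ 0 ∨ x 3 ≠ 0)

/-- With N = |u|² + |v|², the vector (v̄, ū)/N solves the complex equation without affecting the
real one, and (u, -v)/N does the converse. -/
theorem exists_solve_real {u v : ℂ} (h : u ≠ 0 ∨ v ≠ 0) (P : ℂ) (a : ℝ) :
    ∃ s t : ℂ, s * v + u * t = P ∧ (conj u * s).re - (conj v * t).re = a := by
  have hN : (conj u * u + conj v * v) ≠ 0 := by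
    rw [mul_comm, Complex.mul_conj, mul_comm, Complex.mul_conj]
    norm_cast
    rcases h with h | h
    · have := Complex.normSq_pos.2 h
      have := Complex.normSq_nonneg v
      positivity
    · have := Complex.normSq_pos.2 h
      have := Complex.normSq_nonneg u
      positivity
  set N := conj u * u + conj v * v with hNd
  refine ⟨conj v * P / N + a / N * u, conj u * P / N - a / N * v, ?_, ?_⟩
  · field_simp
    rw [hNd]; ring
  · have : conj u * (conj v * P / N + a / N * u) - conj v * (conj u * P / N - a / N * v) = a := by
      field_simp
      rw [hNd]; ring
    rw [← Complex.sub_re, this, Complex.ofReal_re]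

theorem exists_solve_fiber {x : Fin 5 → ℂ} (hx : IsNondegenerate x) (h4 : x 4 ≠ 0)
    (p : Fin 2 → ℂ) (η : Fin 3 → ℝ) :
    ∃ t, conifoldEqDeriv f g x t = p ∧ momentDeriv x t = η := by
  -- Chosen so that z̄ d = η₂/2; the half compensates the factor 2 in the derivative of |z|².
  set d : ℂ := (η 2 / 2 : ℝ) * (conj (x 4))⁻¹ with hd
  obtain ⟨s, t, h1, h2⟩ := exists_solve_real hx.1 (p 0 + f.derivative.eval (x 4) * d) (η 0)
  obtain ⟨s', t', h1', h2'⟩ := exists_solve_real hx.2 (p 1 + g.derivative.eval (x 4) * d) (η 1)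
  have h3 : 2 * (conj (x 4) * d).re = η 2 := by
    have : conj (x 4) * d = (η 2 / 2 : ℝ) := by
      rw [hd]
      have : conj (x 4) ≠ 0 := by simpa using h4
      field_simp
    rw [this, Complex.ofReal_re]; ring
  refine ⟨![s, t, s', t', d], ?_, ?_⟩
  · rw [conifoldEqDeriv_apply]
    ext i
    fin_cases i <;> simp [h1, h1']
  · rw [momentDeriv_apply]
    ext i
    fin_cases i
    · exact h2
    · exact h2'
    · exact h3

/-- The equations of the fibre through `x`. -/
theorem tangentConeAt_fiber {x : Fin 5 → ℂ} (hx : x ∈ conifold f g) (hn : IsNondegenerate x) :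
    tangentConeAt ℝ {w | w ∈ conifold f g ∧ momentMap w = momentMap x} x =
      {t | conifoldEqDeriv f g x t = 0 ∧ momentDeriv x t = 0} := by
  have h1 : HasStrictFDerivAt (fun w => (conifoldEq f g w, momentMap w - momentMap x))
      (((conifoldEqDeriv f g x).restrictScalars ℝ).prod (momentDeriv x)) x :=
    ((hasStrictFDerivAt_conifoldEq f g x).restrictScalars ℝ).prodMk
      ((hasStrictFDerivAt_momentMap x).sub_const _)
  -- The fibre is a regular level set of the combined complex and real equations: nondegeneracy
  -- makes the joint differential onto.
  rw [tangentConeAt_eq_ker h1 (by simp [(mem_conifold_iff.1 hx).1]) ?_ ?_]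
  · ext t
    simp [Prod.ext_iff]
  · rintro ⟨p, η⟩
    obtain ⟨t, ht⟩ := exists_solve_fiber (f := f) (g := g) hn (mem_conifold_iff.1 hx).2 p η
    exact ⟨t, Prod.ext ht.1 ht.2⟩
  · filter_upwards [eventually_mem_conifold hx] with w hw
    simp [hw, sub_eq_zero]

/-- The derivative of `affineCoord`. -/
def affineDeriv (y : HomCoord) : HomCoord →L[ℂ] (Fin 5 → ℂ) :=
  LinearMap.toContinuousLinearMap
    { toFun := fun t =>
        ![(t.1 0 * y.1 2 - y.1 0 * t.1 2) / y.1 2 ^ 2, (t.1 1 * y.1 2 - y.1 1 * t.1 2) / y.1 2 ^ 2,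
          (t.2.1 0 * y.2.1 2 - y.2.1 0 * t.2.1 2) / y.2.1 2 ^ 2,
          (t.2.1 1 * y.2.1 2 - y.2.1 1 * t.2.1 2) / y.2.1 2 ^ 2, zDeriv y t]
      map_add' := fun t t' => by
        rw [map_add]
        ext i
        fin_cases i <;> simp <;> ring
      map_smul' := fun c t => by
        rw [map_smul]
        ext i
        fin_cases i <;> simp <;> ring }

theorem affineDeriv_apply (y t : HomCoord) : affineDeriv y t =
    ![(t.1 0 * y.1 2 - y.1 0 * t.1 2) / y.1 2 ^ 2, (t.1 1 * y.1 2 - y.1 1 * t.1 2) / y.1 2 ^ 2,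
      (t.2.1 0 * y.2.1 2 - y.2.1 0 * t.2.1 2) / y.2.1 2 ^ 2,
      (t.2.1 1 * y.2.1 2 - y.2.1 1 * t.2.1 2) / y.2.1 2 ^ 2, zDeriv y t] := rfl

theorem hasStrictFDerivAt_affineCoord {y : HomCoord} (hy : y ∈ finiteCoord) :
    HasStrictFDerivAt affineCoord (affineDeriv y) y := by
  obtain ⟨h1, h2, h3⟩ := hy
  have a := fun i => hasStrictFDerivAt_fst i y
  have b := fun i => hasStrictFDerivAt_snd i y
  have ha := (hasStrictDerivAt_inv h1).comp_hasStrictFDerivAt y (a 2)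
  have hb := (hasStrictDerivAt_inv h2).comp_hasStrictFDerivAt y (b 2)
  rw [hasStrictFDerivAt_pi']
  intro i
  fin_cases i
  · refine ((a 0).mul ha).congr_fderiv (ContinuousLinearMap.ext fun t => ?_)
    simp [affineDeriv_apply]
    field_simp
    ring
  · refine ((a 1).mul ha).congr_fderiv (ContinuousLinearMap.ext fun t => ?_)
    simp [affineDeriv_apply]
    field_simp
    ring
  · refine ((b 0).mul hb).congr_fderiv (ContinuousLinearMap.ext fun t => ?_)
    simp [affineDeriv_apply]
    field_simp
    ring
  · refine ((b 1).mul hb).congr_fderiv (ContinuousLinearMap.ext fun t => ?_)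
    simp [affineDeriv_apply]
    field_simp
    ring
  · exact hasStrictFDerivAt_zCoord h3

theorem analyticAt_affineCoord {y : HomCoord} (hy : y ∈ finiteCoord) :
    AnalyticAt ℂ affineCoord y := by
  obtain ⟨h1, h2, h3⟩ := hy
  rw [analyticAt_pi_iff]
  intro i
  fin_cases i
  · exact (analyticAt_fst 0 y).div (analyticAt_fst 2 y) h1
  · exact (analyticAt_fst 1 y).div (analyticAt_fst 2 y) h1
  · exact (analyticAt_snd 0 y).div (analyticAt_snd 2 y) h2
  · exact (analyticAt_snd 1 y).div (analyticAt_snd 2 y) h2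
  · exact (analyticAt_thd 0 y).div (analyticAt_thd 1 y) h3

theorem affineDeriv_surjective {y : HomCoord} (hy : y ∈ finiteCoord) :
    Function.Surjective (affineDeriv y) := by
  obtain ⟨h1, h2, h3⟩ := hy
  intro s
  refine ⟨(![s 0 * y.1 2, s 1 * y.1 2, 0], ![s 2 * y.2.1 2, s 3 * y.2.1 2, 0],
    ![s 4 * y.2.2 1, 0]), ?_⟩
  rw [affineDeriv_apply]
  ext i
  fin_cases i <;> simp <;> field_simp

/-- The two descriptions of the tangent spaces agree. -/
theorem homEqDeriv_eq_zero_iff {y t : HomCoord} (hy : y ∈ finiteCoord) (h0 : homEq f g y = 0) :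
    homEqDeriv f g y t = 0 ↔ conifoldEqDeriv f g (affineCoord y) (affineDeriv y t) = 0 := by
  obtain ⟨h1, h2, h3⟩ := hy
  obtain ⟨e1, e2⟩ := homEq_eq_zero_iff.1 h0
  have key : ∀ (U V W tU tV tW F F' d : ℂ), W ≠ 0 → U * V = W ^ 2 * F →
      ((tU * V + U * tV - 2 * W * tW * F - W ^ 2 * F' * d = 0) ↔
        (tU * W - U * tW) / W ^ 2 * (V / W) + U / W * ((tV * W - V * tW) / W ^ 2) = F' * d) := by
    intro U V W tU tV tW F F' d hW h
    have : (tU * W - U * tW) / W ^ 2 * (V / W) + U / W * ((tV * W - V * tW) / W ^ 2) - F' * d =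
        (tU * V + U * tV - 2 * W * tW * F - W ^ 2 * F' * d) / W ^ 2 := by
      field_simp
      linear_combination (-2 * tW) * h
    rw [← sub_eq_zero (a := _ + _), this, div_eq_zero_iff, or_iff_left (pow_ne_zero 2 hW)]
  rw [conifoldEqDeriv_eq_zero_iff, homEqDeriv_apply, affineDeriv_apply, funext_iff,
    Fin.forall_fin_two]
  simp only [Matrix.cons_val, affineCoord, Pi.zero_apply]
  exact and_congr (key _ _ _ _ _ _ _ _ _ h1 e1) (key _ _ _ _ _ _ _ _ _ h2 e2)

end AffineGeometry

/-! ### Regular points of the compactified fibration. -/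

section RegularPoints

open Set Filter ComplexConjugate

variable {f g : ℂ[X]}

theorem baseChart_fibration (x : Fin 5 → ℂ) : baseChart (fibration x) =
    ![Real.arctan (momentMap x 0), Real.arctan (momentMap x 1), Real.arctan ‖x 4‖] := by
  have h : ((‖x 4‖ₑ : ℝ≥0∞) : EReal) = ((‖x 4‖ : ℝ) : EReal) := by
    rw [← ofReal_norm, EReal.coe_ennreal_ofReal, max_eq_left (norm_nonneg _)]
  ext i
  fin_cases i
  · simp [baseChart, fibration, compress, momentMap, -EReal.coe_mul, -EReal.coe_sub]
  · simp [baseChart, fibration, compress, momentMap, -EReal.coe_mul, -EReal.coe_sub]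
  · simp [baseChart, fibration, h, compress]

/-- A smooth extension of the fibration is prescribed only on the conifold. As tangent cones ignore
closures, its values there control its derivative on all tangent vectors of the compactification. -/
theorem tangentConeAt_compactification_eq {y : HomCoord} (hy : y ∈ nonzeroCoord) :
    tangentConeAt ℝ (cone (compactification f g)) y =
      tangentConeAt ℝ (cone (openPart f g)) y := by
  have : cone (compactification f g) = closure (cone (openPart f g)) ∩ nonzeroCoord := by
    ext w
    rw [compactification, mem_cone_closure, inter_comm]
    rfl
  rw [this, tangentConeAt_inter_nhds (isOpen_nonzeroCoord.mem_nhds hy), tangentConeAt_closure]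

section Regular

/-- The smooth function `(a, b, c) ↦ (arctan a, arctan b, arctan √c)`. -/
def momentChart (m : Fin 3 → ℝ) : Fin 3 → ℝ :=
  ![Real.arctan (m 0), Real.arctan (m 1), Real.arctan (√(m 2))]

theorem momentChart_momentMap (x : Fin 5 → ℂ) :
    momentChart (momentMap x) = baseChart (fibration x) := by
  rw [baseChart_fibration]
  simp [momentChart, momentMap, Real.sqrt_sq]

theorem contDiffAt_momentChart {m : Fin 3 → ℝ} (hm : 0 < m 2) : ContDiffAt ℝ ∞ momentChart m := by
  have hp : ∀ i : Fin 3, ContDiffAt ℝ ∞ (fun m : Fin 3 → ℝ => m i) m := fun i =>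
    (contDiff_apply ℝ ℝ i).contDiffAt
  rw [contDiffAt_pi]
  intro i
  fin_cases i
  · exact Real.contDiff_arctan.contDiffAt.comp m (hp 0)
  · exact Real.contDiff_arctan.contDiffAt.comp m (hp 1)
  · exact Real.contDiff_arctan.contDiffAt.comp m ((hp 2).sqrt hm.ne')

/-- The chart has a diagonal derivative with non-zero entries, so it does not influence
surjectivity. -/
theorem exists_fderiv_momentChart {m : Fin 3 → ℝ} (hm : 0 < m 2) :
    ∃ c : Fin 3 → ℝ, (∀ i, c i ≠ 0) ∧ ∀ η i, fderiv ℝ momentChart m η i = c i * η i := by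
  have hp : ∀ i : Fin 3, HasFDerivAt (fun m : Fin 3 → ℝ => m i)
      (ContinuousLinearMap.proj (R := ℝ) (φ := fun _ : Fin 3 => ℝ) i) m := fun i =>
    (ContinuousLinearMap.proj (R := ℝ) (φ := fun _ : Fin 3 => ℝ) i).hasFDerivAt
  have h0 := fun i => (Real.hasDerivAt_arctan (m i)).comp_hasFDerivAt m (hp i)
  have h2 := (Real.hasDerivAt_arctan (√(m 2))).comp_hasFDerivAt m
    ((Real.hasDerivAt_sqrt hm.ne').comp_hasFDerivAt m (hp 2))
  have hd := (contDiffAt_momentChart hm).differentiableAt (by simp)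
  have hd' := hasFDerivAt_pi'.1 hd.hasFDerivAt
  have hs : 0 < √(m 2) := Real.sqrt_pos.2 hm
  refine ⟨![1 / (1 + m 0 ^ 2), 1 / (1 + m 1 ^ 2), 1 / (1 + √(m 2) ^ 2) * (1 / (2 * √(m 2)))],
    ?_, ?_⟩
  · intro i
    fin_cases i
    · exact (by positivity : 0 < 1 / (1 + m 0 ^ 2)).ne'
    · exact (by positivity : 0 < 1 / (1 + m 1 ^ 2)).ne'
    · exact (by positivity : 0 < 1 / (1 + √(m 2) ^ 2) * (1 / (2 * √(m 2)))).ne'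
  · intro η i
    fin_cases i
    · have := congrArg (fun L => L η) ((hd' 0).unique (h0 0))
      simpa using this
    · have := congrArg (fun L => L η) ((hd' 1).unique (h0 1))
      simpa using this
    · have := congrArg (fun L => L η) ((hd' 2).unique h2)
      simpa [mul_assoc] using this

theorem momentMap_two_pos {x : Fin 5 → ℂ} (hx : x ∈ conifold f g) : 0 < momentMap x 2 := by
  have : x 4 ≠ 0 := hx.2.2
  have := norm_pos_iff.2 this
  simp only [momentMap, Matrix.cons_val]
  positivity

theorem hasFDerivAt_affine_real {y : HomCoord} (hy : y ∈ finiteCoord) :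
    HasFDerivAt affineCoord ((affineDeriv y).restrictScalars ℝ) y :=
  (hasStrictFDerivAt_affineCoord hy).hasFDerivAt.restrictScalars ℝ

/-- Any extension has the derivative of the explicit one along tangent vectors. Where uᵢ = vᵢ = 0,
the i-th moment component of that derivative vanishes; elsewhere `exists_solve_fiber` reaches every
value by a tangent vector. -/
theorem isRegularPoint_iff (hfg : IsAdmissible f g) {y : HomCoord}
    (hy : y ∈ cone (openPart f g)) :
    IsRegularPoint f g y ↔ IsNondegenerate (affineCoord y) := by
  obtain ⟨h1, h2⟩ := mem_cone_openPart.1 hy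
  have hyc := cone_openPart_subset f g hy
  obtain ⟨h3, h4⟩ := (homEq_eq_zero_iff_conifold h1).1 h2
  have hm := momentMap_two_pos h2
  have hG : HasFDerivAt (fun w => momentChart (momentMap (affineCoord w)))
      (((fderiv ℝ momentChart (momentMap (affineCoord y))).comp
        (momentDeriv (affineCoord y))).comp ((affineDeriv y).restrictScalars ℝ)) y := by
    have hd := ((contDiffAt_momentChart hm).differentiableAt (by simp)).hasFDerivAt
    exact (hd.comp _ (hasStrictFDerivAt_momentMap _).hasFDerivAt).comp y
      (hasFDerivAt_affine_real h1)
  obtain ⟨c, hc, hcη⟩ := exists_fderiv_momentChart hm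
  have htan : ∀ t, t ∈ tangentConeAt ℝ (cone (compactification f g)) y ↔
      conifoldEqDeriv f g (affineCoord y) (affineDeriv y t) = 0 := by
    intro t
    rw [tangentConeAt_real_compactification hfg hyc h1.2.2, ← homEqDeriv_eq_zero_iff h1 h3]
    rfl
  constructor
  · rintro ⟨-, G, hGd, hGe, hsurj⟩
    have hderiv : ∀ t ∈ tangentConeAt ℝ (cone (compactification f g)) y, ∀ i, fderiv ℝ G y t i =
        c i * momentDeriv (affineCoord y) (affineDeriv y t) i := by
      intro t ht i
      rw [tangentConeAt_compactification_eq (finiteCoord_subset h1)] at ht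
      have e1 := (hGd.differentiableAt (by simp)).hasFDerivAt.hasFDerivWithinAt
        (s := cone (openPart f g))
      have e2 := hG.hasFDerivWithinAt (s := cone (openPart f g))
      have e3 := e1.congr_of_eventuallyEq (f₁ := fun w => momentChart (momentMap (affineCoord w)))
        (by
          filter_upwards [hGe.filter_mono nhdsWithin_le_nhds, self_mem_nhdsWithin] with w hw hw'
          rw [hw hw', momentChart_momentMap])
        (by rw [hGe.self_of_nhds hy, momentChart_momentMap])
      have e4 := e3.unique_on e2 ht
      rw [e4]
      exact hcη _ i
    constructor
    · by_contra! h0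
      obtain ⟨t, ht, hη⟩ := hsurj ![1, 0, 0]
      have := hderiv t ht 0
      rw [hη, momentDeriv_apply] at this
      simp [h0] at this
    · by_contra! h0
      obtain ⟨t, ht, hη⟩ := hsurj ![0, 1, 0]
      have := hderiv t ht 1
      rw [hη, momentDeriv_apply] at this
      simp [h0] at this
  · intro hn
    refine ⟨isSmoothPoint_of_finite hfg hyc h1.2.2, _, ?_, Eventually.of_forall fun w hw =>
      momentChart_momentMap _, fun η => ?_⟩
    · exact ((contDiffAt_momentChart hm).comp _ contDiff_momentMap.contDiffAt).comp y
        ((analyticAt_affineCoord h1).contDiffAt.restrict_scalars ℝ)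
    · obtain ⟨s, hs1, hs2⟩ := exists_solve_fiber (f := f) (g := g) hn h2.2.2 0
        (fun i => η i / c i)
      obtain ⟨t, rfl⟩ := affineDeriv_surjective h1 s
      refine ⟨t, (htan t).2 hs1, ?_⟩
      rw [hG.fderiv]
      ext i
      refine (hcη _ i).trans ?_
      have := congrFun hs2 i
      change c i * momentDeriv (affineCoord y) (affineDeriv y t) i = η i
      rw [this]
      field_simp [hc i]

theorem eq_of_eventually_eq_on {E X : Type*} [TopologicalSpace E] [TopologicalSpace X] [T2Space X]
    {S : Set E} {y : E} (hy : y ∈ closure S) {a b : E → X} (ha : ContinuousAt a y)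
    (hb : ContinuousAt b y) (h : ∀ᶠ w in 𝓝 y, w ∈ S → a w = b w) : a y = b y := by
  have : (𝓝[S] y).NeBot := mem_closure_iff_nhdsWithin_neBot.1 hy
  refine tendsto_nhds_unique (ha.tendsto.mono_left (nhdsWithin_le_nhds (s := S)))
    ((hb.tendsto.mono_left nhdsWithin_le_nhds).congr' ?_)
  filter_upwards [h.filter_mono nhdsWithin_le_nhds, self_mem_nhdsWithin] with w h1 h2
  exact (h1 h2).symm

/-- If `cos ∘ G` agrees on `S` near `y` with a function bounded by a multiple of `‖c w‖²`, where
`c` is linear with `c y = 0`, then `G` has zero derivative on the tangent cone of `S` at `y`. -/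
theorem fderiv_eq_zero_of_cos {E : Type*} [NormedAddCommGroup E] [NormedSpace ℝ E] {S : Set E}
    {y t : E} (hy : y ∈ closure S) {G : E → ℝ} {G' : E →L[ℝ] ℝ} (hG : HasFDerivAt G G' y)
    {U V W : E → ℂ} (hU : ContinuousAt U y) (hV : ContinuousAt V y) (hW : ∀ w, ‖W w‖ ≤ ‖w - y‖)
    (hUV : ‖U y‖ ^ 2 ≠ ‖V y‖ ^ 2) (hWS : ∀ w ∈ S, W w ≠ 0)
    (h : ∀ᶠ w in 𝓝 y, w ∈ S →
      G w = Real.arctan (1 / 2 * (‖U w / W w‖ ^ 2 - ‖V w / W w‖ ^ 2)))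
    (ht : t ∈ tangentConeAt ℝ S y) : G' t = 0 := by
  -- Here cos(arctan b) = 1/√(1 + b²) ≤ 1/|b| and |b| = D/(2|W|²), with D bounded below near y; this
  -- gives the quadratic bound.
  set D : E → ℝ := fun w => |‖U w‖ ^ 2 - ‖V w‖ ^ 2| with hD
  have hDy : 0 < D y := abs_pos.2 (sub_ne_zero.2 hUV)
  have hDc : ContinuousAt D y := ((hU.norm.pow 2).sub (hV.norm.pow 2)).abs
  have hbd : ∀ᶠ w in 𝓝 y, w ∈ S → |Real.cos (G w)| ≤ 4 / D y * ‖w - y‖ ^ 2 := by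
    filter_upwards [h, hDc.eventually (lt_mem_nhds (half_lt_self hDy))] with w hw hDw hwS
    have hW0 := norm_pos_iff.2 (hWS w hwS)
    rw [hw hwS, Real.cos_arctan]
    set b := 1 / 2 * (‖U w / W w‖ ^ 2 - ‖V w / W w‖ ^ 2) with hb
    have hb' : |b| = D w / (2 * ‖W w‖ ^ 2) := by
      have : b = (‖U w‖ ^ 2 - ‖V w‖ ^ 2) / (2 * ‖W w‖ ^ 2) := by
        rw [hb, norm_div, norm_div]; field_simp
      rw [this, abs_div, abs_of_pos (by positivity : 0 < 2 * ‖W w‖ ^ 2)]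
    have hbpos : 0 < |b| := by rw [hb']; have : 0 < D w := by linarith
                               positivity
    have h1 : |b| ≤ √(1 + b ^ 2) := Real.abs_le_sqrt (by linarith)
    rw [abs_of_nonneg (by positivity)]
    calc 1 / √(1 + b ^ 2) ≤ 1 / |b| := one_div_le_one_div_of_le hbpos h1
      _ = 2 * ‖W w‖ ^ 2 / D w := by rw [hb']; field_simp
      _ ≤ 2 * ‖W w‖ ^ 2 / (D y / 2) := by gcongr
      _ = 4 / D y * ‖W w‖ ^ 2 := by field_simp; ring
      _ ≤ 4 / D y * ‖w - y‖ ^ 2 := by gcongr; exact hW w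
  have hcy : Real.cos (G y) = 0 := by
    have : (𝓝[S] y).NeBot := mem_closure_iff_nhdsWithin_neBot.1 hy
    have h1 : Tendsto (fun w => Real.cos (G w)) (𝓝[S] y) (𝓝 (Real.cos (G y))) :=
      (Real.continuous_cos.continuousAt.comp hG.continuousAt).tendsto.mono_left nhdsWithin_le_nhds
    have h2 : Tendsto (fun w => 4 / D y * ‖w - y‖ ^ 2) (𝓝[S] y) (𝓝 0) := by
      have : ContinuousAt (fun w => 4 / D y * ‖w - y‖ ^ 2) y := by fun_prop
      have := this.tendsto.mono_left (nhdsWithin_le_nhds (s := S))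
      simpa using this
    refine tendsto_nhds_unique h1 (squeeze_zero_norm' ?_ h2)
    filter_upwards [hbd.filter_mono nhdsWithin_le_nhds, self_mem_nhdsWithin] with w h3 h4
    exact h3 h4
  have hcos := (Real.hasDerivAt_cos (G y)).comp_hasFDerivAt y hG
  have h0 := fderiv_eq_zero_of_quadratic hcos (C := 4 / D y) (S := S) (by
    filter_upwards [hbd] with w hw hwS
    simpa [hcy] using hw hwS) ht
  -- The derivative of cos ∘ G is -sin(G y) G', and cos(G y) = 0 makes the factor non-zero.
  have hsin : Real.sin (G y) ≠ 0 := by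
    intro hs
    have := Real.sin_sq_add_cos_sq (G y)
    simp [hs, hcy] at this
  simpa [hsin] using h0

/-- Smoothness already excludes z = ∞. If Wᵢ = 0, then UᵢVᵢ = 0 gives |Uᵢ| ≠ |Vᵢ|, so the i-th
coordinate tends to ±∞ and its compression is stationary. If z = 0, the derivative of the last
component would be a real functional with the same absolute value as the complex functional dz on a
complex tangent space. -/
theorem not_isRegularPoint (hfg : IsAdmissible f g) {y : HomCoord}
    (hy : y ∈ cone (compactification f g)) (hyo : y ∉ cone (openPart f g)) :
    ¬ IsRegularPoint f g y := by
  rintro ⟨hsm, G, hGd, hGe, hsurj⟩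
  have hy1 := ((isSmoothPoint_iff hfg).1 hsm).2
  obtain ⟨hy0, hyc⟩ := mem_cone_closure.1 hy
  obtain ⟨-, h0⟩ := (mem_cone_compactification hfg hy1).1 hy
  obtain ⟨e1, e2⟩ := homEq_eq_zero_iff.1 h0
  have hG := (hGd.differentiableAt (by simp)).hasFDerivAt
  have hGi := hasFDerivAt_pi'.1 hG
  have hTC := tangentConeAt_compactification_eq (f := f) (g := g) hy0
  have hne : ∀ a b : ℂ, a * b = 0 → (a ≠ 0 ∨ b ≠ 0) → ‖a‖ ^ 2 ≠ ‖b‖ ^ 2 := by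
    intro a b hab h
    rcases mul_eq_zero.1 hab with rfl | rfl <;> simpa [eq_comm] using h
  by_cases hW1 : y.1 2 = 0
  · obtain ⟨t, ht, hη⟩ := hsurj ![1, 0, 0]
    rw [hTC] at ht
    have h1 : y.1 0 * y.1 1 = 0 := by rw [e1, hW1]; ring
    have hnz : y.1 0 ≠ 0 ∨ y.1 1 ≠ 0 := by
      by_contra! h
      exact hy0.1 (by ext i; fin_cases i <;> simp [h, hW1])
    have h2 := fderiv_eq_zero_of_cos hyc (hGi 0) (U := fun w => w.1 0) (V := fun w => w.1 1)
      (W := fun w => w.1 2) (by fun_prop) (by fun_prop)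
      (fun w => by
        have : w.1 2 = (w - y).1 2 := by simp [hW1]
        rw [this]
        exact (norm_le_pi_norm _ 2).trans (norm_fst_le _))
      (hne _ _ h1 hnz) (fun w hw => (mem_cone_openPart.1 hw).1.1)
      (by
        filter_upwards [hGe] with w hw hwo
        rw [hw hwo, baseChart_fibration]
        rfl) ht
    simp [hη] at h2
  by_cases hW2 : y.2.1 2 = 0
  · obtain ⟨t, ht, hη⟩ := hsurj ![0, 1, 0]
    rw [hTC] at ht
    have h1 : y.2.1 0 * y.2.1 1 = 0 := by rw [e2, hW2]; ring
    have hnz : y.2.1 0 ≠ 0 ∨ y.2.1 1 ≠ 0 := by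
      by_contra! h
      exact hy0.2.1 (by ext i; fin_cases i <;> simp [h, hW2])
    have h2 := fderiv_eq_zero_of_cos hyc (hGi 1) (U := fun w => w.2.1 0) (V := fun w => w.2.1 1)
      (W := fun w => w.2.1 2) (by fun_prop) (by fun_prop)
      (fun w => by
        have : w.2.1 2 = (w - y).2.1 2 := by simp [hW2]
        rw [this]
        exact ((norm_le_pi_norm _ 2).trans (norm_fst_le _)).trans (norm_snd_le _))
      (hne _ _ h1 hnz) (fun w hw => (mem_cone_openPart.1 hw).1.2.1)
      (by
        filter_upwards [hGe] with w hw hwo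
        rw [hw hwo, baseChart_fibration]
        rfl) ht
    simp [hη] at h2
  have hfin : y ∈ finiteCoord := ⟨hW1, hW2, hy1⟩
  have hz0 : y.2.2 0 = 0 := by
    by_contra hz
    exact hyo (mem_cone_openPart.2 ⟨hfin, (homEq_eq_zero_iff_conifold hfin).2 ⟨h0, hz⟩⟩)
  have hzy : zCoord y = 0 := by simp [zCoord, hz0]
  have hzd := (hasStrictFDerivAt_zCoord hy1).hasFDerivAt.restrictScalars ℝ
  have hG2 : ∀ᶠ w in 𝓝 y, w ∈ cone (openPart f g) → G w 2 = Real.arctan ‖zCoord w‖ := by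
    filter_upwards [hGe] with w hw hwo
    rw [hw hwo, baseChart_fibration]
    rfl
  have hGy : G y 2 = 0 := by
    have := eq_of_eventually_eq_on hyc (hGi 2).continuousAt
      (Real.continuous_arctan.continuousAt.comp hzd.continuousAt.norm) hG2
    simpa [hzy] using this
  have hnorm : ∀ t ∈ tangentConeAt ℝ (cone (compactification f g)) y,
      ‖fderiv ℝ G y t 2‖ = ‖zDeriv y t‖ := by
    intro t ht
    rw [hTC] at ht
    refine norm_fderiv_eq_of_norm_sub_eq (hGi 2) hzd (C := Real.arctan) ?_ Real.arctan_zero ?_ ht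
    · simpa using Real.hasDerivAt_arctan 0
    · filter_upwards [hG2] with w hw hwo
      rw [hw hwo, hGy, hzy, sub_zero, sub_zero, Real.norm_of_nonneg]
      exact Real.arctan_nonneg.2 (norm_nonneg _)
  obtain ⟨t, ht, hη⟩ := hsurj ![0, 0, 1]
  have ht1 : zDeriv y t ≠ 0 := by
    have := hnorm t ht
    rw [hη] at this
    intro h
    simp [h] at this
  -- The tangent space is a complex kernel, hence closed under multiplication by complex scalars.
  have hsm : ∀ c : ℂ, c • t ∈ tangentConeAt ℝ (cone (compactification f g)) y := by
    intro c
    rw [tangentConeAt_real_compactification hfg hy hy1] at ht ⊢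
    have ht' : homEqDeriv f g y t = 0 := ht
    change homEqDeriv f g y (c • t) = 0
    rw [map_smul, ht', smul_zero]
  -- The real functional is 1 on t and c on it, so it kills (i - c)t, on which dz does not vanish.
  set c : ℝ := fderiv ℝ G y (Complex.I • t) 2 with hc
  have hkey := hnorm ((Complex.I - c) • t) (hsm _)
  have h5 : fderiv ℝ G y ((Complex.I - c) • t) 2 = 0 := by
    have h6 : (Complex.I - c : ℂ) • t = Complex.I • t - c • t := by
      rw [sub_smul, Complex.coe_smul]
    rw [h6, map_sub, Pi.sub_apply, ← hc, map_smul, hη]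
    simp
  rw [h5, norm_zero, map_smul, smul_eq_mul, eq_comm, norm_eq_zero, mul_eq_zero] at hkey
  rcases hkey with h | h
  · have := congrArg Complex.im h
    simp at this
  · exact ht1 h

end Regular

end RegularPoints

/-! ### Fibres of the compactified fibration and the discriminant locus. -/

section Discriminant

open Set Filter ComplexConjugate

variable {f g : ℂ[X]}

theorem continuous_fibration : Continuous fibration := by
  refine Continuous.prodMk ?_ (Continuous.prodMk ?_ ?_)
  · exact continuous_coe_real_ereal.comp (by fun_prop)
  · exact continuous_coe_real_ereal.comp (by fun_prop)
  · exact (continuous_apply 4).enorm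

theorem mem_cone_fiber_of_mem {y : HomCoord} (hy : y ∈ cone (openPart f g)) :
    y ∈ cone (fiber f g (fibration (affineCoord y))) :=
  mem_cone_fiber.2 ⟨finiteCoord_subset (mem_cone_openPart.1 hy).1,
    subset_closure (mem_image_of_mem _ hy)⟩

theorem fibration_eq_of_mem_cone_fiber {b : Base} {y : HomCoord} (hy : y ∈ cone (openPart f g))
    (hb : y ∈ cone (fiber f g b)) : fibration (affineCoord y) = b := by
  obtain ⟨h1, h2⟩ := mem_cone_fiber.1 hb
  have hc : ContinuousAt (fun p : HomCoord × Base => fibration (affineCoord p.1)) (y, b) :=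
    continuous_fibration.continuousAt.comp
      (ContinuousAt.comp (g := affineCoord) (f := Prod.fst) (x := (y, b))
        (hasStrictFDerivAt_affineCoord (mem_cone_openPart.1 hy).1).continuousAt continuousAt_fst)
  refine eq_of_eventually_eq_on h2 hc (continuousAt_snd (p := (y, b)))
    (Eventually.of_forall ?_)
  rintro _ ⟨w, hw, rfl⟩
  rfl

/-- The interior of the base. -/
theorem notMem_baseBoundary_iff {b : Base} : b ∉ baseBoundary ↔
    (b.1 ≠ ⊥ ∧ b.1 ≠ ⊤) ∧ (b.2.1 ≠ ⊥ ∧ b.2.1 ≠ ⊤) ∧ b.2.2 ≠ 0 ∧ b.2.2 ≠ ⊤ := by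
  simp only [baseBoundary, mem_ofPred_eq]
  tauto

theorem fibration_notMem_baseBoundary {x : Fin 5 → ℂ} (hx : x ∈ conifold f g) :
    fibration x ∉ baseBoundary := by
  rw [notMem_baseBoundary_iff]
  refine ⟨⟨EReal.coe_ne_bot _, EReal.coe_ne_top _⟩, ⟨EReal.coe_ne_bot _, EReal.coe_ne_top _⟩,
    ?_, enorm_ne_top⟩
  have := hx.2.2
  simpa [fibration] using this

/-- For b in the interior, the relations |U|² - |V|² = 2b|W|² and |z₀| = b₃|z₁| survive in the
limit. They force z₀, z₁ ≠ 0; and W = 0 would give |U| = |V| with UV = 0, so that all three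
coordinates vanish. -/
theorem mem_openPart_of_mem_cone_fiber (hfg : IsAdmissible f g) {b : Base} {y : HomCoord}
    (hb : b ∉ baseBoundary) (hy : y ∈ cone (fiber f g b)) : y ∈ cone (openPart f g) := by
  obtain ⟨⟨h1, h2⟩, ⟨h3, h4⟩, h5, h6⟩ := notMem_baseBoundary_iff.1 hb
  obtain ⟨hy0, hyb⟩ := mem_cone_fiber.1 hy
  have hf1 : ContinuousAt (fun p : HomCoord × Base => p.2.1.toReal) (y, b) :=
    (EReal.tendsto_toReal h2 h1).comp (by fun_prop : ContinuousAt _ (y, b))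
  have hf2 : ContinuousAt (fun p : HomCoord × Base => p.2.2.1.toReal) (y, b) :=
    (EReal.tendsto_toReal h4 h3).comp (by fun_prop : ContinuousAt _ (y, b))
  have hf3 : ContinuousAt (fun p : HomCoord × Base => p.2.2.2.toReal) (y, b) :=
    (ENNReal.tendsto_toReal h6).comp (by fun_prop : ContinuousAt _ (y, b))
  have hdiv : ∀ a b c : ℂ, c ≠ 0 →
      1 / 2 * (‖a‖ ^ 2 - ‖b‖ ^ 2) = 1 / 2 * (‖a / c‖ ^ 2 - ‖b / c‖ ^ 2) * ‖c‖ ^ 2 := by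
    intro a b c hc
    have := norm_pos_iff.2 hc
    rw [norm_div, norm_div]
    field_simp
  have e1 : 1 / 2 * (‖y.1 0‖ ^ 2 - ‖y.1 1‖ ^ 2) = b.1.toReal * ‖y.1 2‖ ^ 2 := by
    refine eq_of_eventually_eq_on hyb
      (a := fun p : HomCoord × Base => 1 / 2 * (‖p.1.1 0‖ ^ 2 - ‖p.1.1 1‖ ^ 2))
      (b := fun p => p.2.1.toReal * ‖p.1.1 2‖ ^ 2) (by fun_prop)
      (hf1.mul (by fun_prop)) (Eventually.of_forall ?_)
    rintro _ ⟨w, hw, rfl⟩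
    exact hdiv _ _ _ (mem_cone_openPart.1 hw).1.1
  have e2 : 1 / 2 * (‖y.2.1 0‖ ^ 2 - ‖y.2.1 1‖ ^ 2) = b.2.1.toReal * ‖y.2.1 2‖ ^ 2 := by
    refine eq_of_eventually_eq_on hyb
      (a := fun p : HomCoord × Base => 1 / 2 * (‖p.1.2.1 0‖ ^ 2 - ‖p.1.2.1 1‖ ^ 2))
      (b := fun p => p.2.2.1.toReal * ‖p.1.2.1 2‖ ^ 2) (by fun_prop)
      (hf2.mul (by fun_prop)) (Eventually.of_forall ?_)
    rintro _ ⟨w, hw, rfl⟩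
    exact hdiv _ _ _ (mem_cone_openPart.1 hw).1.2.1
  have e3 : ‖y.2.2 0‖ = b.2.2.toReal * ‖y.2.2 1‖ := by
    refine eq_of_eventually_eq_on hyb
      (a := fun p : HomCoord × Base => ‖p.1.2.2 0‖)
      (b := fun p => p.2.2.2.toReal * ‖p.1.2.2 1‖) (by fun_prop)
      (hf3.mul (by fun_prop)) (Eventually.of_forall ?_)
    rintro _ ⟨w, hw, rfl⟩
    have hw1 := (mem_cone_openPart.1 hw).1.2.2
    simp [fibration, affineCoord, hw1]
  have hz1 : y.2.2 1 ≠ 0 := by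
    intro h
    rw [h, norm_zero, mul_zero, norm_eq_zero] at e3
    exact hy0.2.2 (by ext i; fin_cases i <;> simp [h, e3])
  have hz0 : y.2.2 0 ≠ 0 := by
    intro h
    rw [h, norm_zero, eq_comm, mul_eq_zero, ENNReal.toReal_eq_zero_iff] at e3
    simp [h5, h6, hz1] at e3
  obtain ⟨-, h0⟩ := (mem_cone_compactification hfg hz1).1 (cone_fiber_subset f g b hy)
  obtain ⟨q1, q2⟩ := homEq_eq_zero_iff.1 h0
  have hW : ∀ (p : Fin 3 → ℂ) (c : ℝ) (F : ℂ), p ≠ 0 → p 0 * p 1 = p 2 ^ 2 * F →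
      1 / 2 * (‖p 0‖ ^ 2 - ‖p 1‖ ^ 2) = c * ‖p 2‖ ^ 2 → p 2 ≠ 0 := by
    intro p c F hp hpe hpn h
    have h7 : ‖p 0‖ = ‖p 1‖ := by
      rw [h, norm_zero] at hpn
      rw [← sq_eq_sq₀ (norm_nonneg _) (norm_nonneg _)]
      linarith
    have h8 : p 0 = 0 ∧ p 1 = 0 := by
      rw [h] at hpe
      have : p 0 * p 1 = 0 := by rw [hpe]; ring
      rcases mul_eq_zero.1 this with h9 | h9
      · exact ⟨h9, by rw [h9, norm_zero] at h7; exact norm_eq_zero.1 h7.symm⟩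
      · exact ⟨by rw [h9, norm_zero] at h7; exact norm_eq_zero.1 h7, h9⟩
    exact hp (by ext i; fin_cases i <;> simp [h8, h])
  have hfin : y ∈ finiteCoord := ⟨hW _ _ _ hy0.1 q1 e1, hW _ _ _ hy0.2.1 q2 e2, hz1⟩
  exact mem_cone_openPart.2 ⟨hfin, (homEq_eq_zero_iff_conifold hfin).2 ⟨h0, hz0⟩⟩

theorem exists_mul_eq_normSq_sub_eq (c : ℂ) (b : ℝ) :
    ∃ u v : ℂ, u * v = c ∧ 1 / 2 * (‖u‖ ^ 2 - ‖v‖ ^ 2) = b := by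
  by_cases hc : c = 0
  · subst hc
    rcases le_total 0 b with hb | hb
    · refine ⟨(√(2 * b) : ℝ), 0, by simp, ?_⟩
      rw [Complex.norm_real, Real.norm_of_nonneg (Real.sqrt_nonneg _), Real.sq_sqrt (by linarith)]
      simp
    · refine ⟨0, (√(-(2 * b)) : ℝ), by simp, ?_⟩
      rw [Complex.norm_real, Real.norm_of_nonneg (Real.sqrt_nonneg _), Real.sq_sqrt (by linarith)]
      simp
  · have hc' := norm_pos_iff.2 hc
    -- Substituting |v| = |c|/|u| shows that ρ = |u|² must be the positive root of ρ² - 2bρ - |c|² =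
    -- 0.
    set ρ := b + √(b ^ 2 + ‖c‖ ^ 2) with hρ
    have hlt : |b| < √(b ^ 2 + ‖c‖ ^ 2) := by
      rw [← Real.sqrt_sq_eq_abs]
      exact Real.sqrt_lt_sqrt (sq_nonneg _) (by nlinarith)
    have hρ0 : 0 < ρ := by linarith [neg_abs_le b]
    have hρ2 : ρ ^ 2 - 2 * b * ρ - ‖c‖ ^ 2 = 0 := by
      have := Real.sq_sqrt (show 0 ≤ b ^ 2 + ‖c‖ ^ 2 by positivity)
      have h2 : (ρ - b) ^ 2 = b ^ 2 + ‖c‖ ^ 2 := by rw [← this, hρ]; ring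
      linarith [h2]
    have hs : (√ρ : ℂ) ≠ 0 := by
      have := Real.sqrt_pos.2 hρ0
      exact_mod_cast this.ne'
    refine ⟨(√ρ : ℝ), c / (√ρ : ℝ), by field_simp, ?_⟩
    rw [norm_div, Complex.norm_real, Real.norm_of_nonneg (Real.sqrt_nonneg _), div_pow,
      Real.sq_sqrt hρ0.le]
    field_simp
    linarith

theorem exists_mem_conifold_fibration_eq (f g : ℂ[X]) {b : Base} (hb : b ∉ baseBoundary) {z : ℂ}
    (hz : ‖z‖ₑ = b.2.2) : ∃ x ∈ conifold f g, fibration x = b ∧ x 4 = z := by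
  obtain ⟨⟨h1, h2⟩, ⟨h3, h4⟩, h5, h6⟩ := notMem_baseBoundary_iff.1 hb
  have hz0 : z ≠ 0 := by
    rintro rfl
    simp only [enorm_zero] at hz
    exact h5 hz.symm
  obtain ⟨u, v, huv, hb1⟩ := exists_mul_eq_normSq_sub_eq (f.eval z) b.1.toReal
  obtain ⟨u', v', huv', hb2⟩ := exists_mul_eq_normSq_sub_eq (g.eval z) b.2.1.toReal
  refine ⟨![u, v, u', v', z], ⟨huv, huv', hz0⟩, ?_, rfl⟩
  refine Prod.ext ?_ (Prod.ext ?_ hz)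
  · simp only [fibration, Matrix.cons_val]
    rw [hb1, EReal.coe_toReal h2 h1]
  · simp only [fibration, Matrix.cons_val]
    rw [hb2, EReal.coe_toReal h4 h3]

theorem dense_image_fibration (f g : ℂ[X]) : Dense (fibration '' conifold f g) := by
  have h1 : Dense (Ioo (⊥ : EReal) ⊤) := by
    rw [dense_iff_closure_eq, closure_Ioo bot_ne_top, Icc_bot_top]
  have h2 : Dense (Ioo (0 : ℝ≥0∞) ⊤) := by
    rw [dense_iff_closure_eq, closure_Ioo ENNReal.zero_ne_top]
    exact Icc_bot_top
  refine (h1.prod (h1.prod h2)).mono ?_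
  rintro ⟨a, b, c⟩ ⟨ha, hb, hc⟩
  have hbd : ((a, b, c) : Base) ∉ baseBoundary :=
    notMem_baseBoundary_iff.2 ⟨⟨ha.1.ne', ha.2.ne⟩, ⟨hb.1.ne', hb.2.ne⟩, hc.1.ne', hc.2.ne⟩
  obtain ⟨x, hx, hxb, -⟩ := exists_mem_conifold_fibration_eq f g hbd (z := (c.toReal : ℂ)) (by
    rw [← ofReal_norm, Complex.norm_real, Real.norm_of_nonneg ENNReal.toReal_nonneg]
    exact ENNReal.ofReal_toReal hc.2.ne)
  exact ⟨x, hx, hxb⟩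

/-- Projection along a compact factor is closed, so the values with non-empty fibre form a closed
set; it contains the dense image of the conifold. -/
theorem fiber_nonempty (f g : ℂ[X]) (b : Base) : (fiber f g b).Nonempty := by
  have hcl := isClosedMap_snd_of_compactSpace (X := Ambient) (Y := Base) _
    (isClosed_closure (s := (fun x => (embed x, fibration x)) '' conifold f g))
  have hsub : fibration '' conifold f g ⊆
      Prod.snd '' closure ((fun x => (embed x, fibration x)) '' conifold f g) := by
    rintro _ ⟨x, hx, rfl⟩
    exact ⟨_, subset_closure (mem_image_of_mem _ hx), rfl⟩
  have huniv := (dense_image_fibration f g).mono hsub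
  rw [dense_iff_closure_eq, hcl.closure_eq] at huniv
  obtain ⟨⟨p, b'⟩, hp, rfl⟩ : b ∈ Prod.snd '' closure
    ((fun x => (embed x, fibration x)) '' conifold f g) := huniv ▸ mem_univ b
  exact ⟨p, hp⟩

theorem cone_nonempty {S : Set Ambient} (hS : S.Nonempty) : (cone S).Nonempty := by
  obtain ⟨p, hp⟩ := hS
  obtain ⟨y, rfl⟩ := toAmbient_surjective p
  exact ⟨y.1, mem_cone_iff.2 ⟨y.2, hp⟩⟩

/-- Homogeneous coordinates of a point of the conifold. -/
def homLift (x : Fin 5 → ℂ) : HomCoord := (![x 0, x 1, 1], ![x 2, x 3, 1], ![x 4, 1])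

theorem homLift_mem_finiteCoord (x : Fin 5 → ℂ) : homLift x ∈ finiteCoord := by
  simp [homLift, finiteCoord]

@[simp] theorem affineCoord_homLift (x : Fin 5 → ℂ) : affineCoord (homLift x) = x := by
  ext i
  fin_cases i <;> simp [affineCoord, homLift]

theorem homLift_mem_cone {x : Fin 5 → ℂ} (hx : x ∈ conifold f g) :
    homLift x ∈ cone (openPart f g) :=
  mem_cone_openPart.2 ⟨homLift_mem_finiteCoord x, by simpa using hx⟩

/-- The discriminant consists of the boundary and the values at degenerate points. -/
theorem mem_discriminant_iff (hfg : IsAdmissible f g) {b : Base} :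
    b ∈ discriminant f g ↔
      b ∈ baseBoundary ∨ ∃ x ∈ conifold f g, fibration x = b ∧ ¬ IsNondegenerate x := by
  by_cases hb : b ∈ baseBoundary
  · simp only [hb, true_or, iff_true]
    -- Any point of a boundary fibre works: it lies outside the conifold, where π takes only
    -- interior values, and so it is not regular.
    obtain ⟨y, hy⟩ := cone_nonempty (fiber_nonempty f g b)
    refine ⟨y, hy, not_isRegularPoint hfg (cone_fiber_subset f g b hy) fun ho => ?_⟩
    rw [← fibration_eq_of_mem_cone_fiber ho hy] at hb
    exact fibration_notMem_baseBoundary (mem_cone_openPart.1 ho).2 hb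
  · simp only [hb, false_or]
    constructor
    · rintro ⟨y, hy, hyr⟩
      have ho := mem_openPart_of_mem_cone_fiber hfg hb hy
      rw [isRegularPoint_iff hfg ho] at hyr
      exact ⟨_, (mem_cone_openPart.1 ho).2, fibration_eq_of_mem_cone_fiber ho hy, hyr⟩
    · rintro ⟨x, hx, rfl, hxn⟩
      have ho := homLift_mem_cone hx
      refine ⟨homLift x, ?_, ?_⟩
      · simpa using mem_cone_fiber_of_mem ho
      · rw [isRegularPoint_iff hfg ho]
        simpa using hxn

/-- A pair (u, v) vanishes exactly when uv = 0 and |u| = |v|, that is, at a root of the polynomial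
with vanishing moment coordinate. Conversely, such values are attained because the moment coordinate
and z can be prescribed freely. -/
theorem mem_discriminant_iff_roots (hfg : IsAdmissible f g) {b : Base} :
    b ∈ discriminant f g ↔ b ∈ baseBoundary ∨ (∃ z, f.eval z = 0 ∧ b.1 = 0 ∧ b.2.2 = ‖z‖ₑ) ∨
      (∃ z, g.eval z = 0 ∧ b.2.1 = 0 ∧ b.2.2 = ‖z‖ₑ) := by
  rw [mem_discriminant_iff hfg]
  by_cases hb : b ∈ baseBoundary
  · simp [hb]
  simp only [hb, false_or]
  have hzero : ∀ u v : ℂ, u * v = 0 → 1 / 2 * (‖u‖ ^ 2 - ‖v‖ ^ 2) = 0 → u = 0 ∧ v = 0 := by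
    intro u v huv h
    rcases mul_eq_zero.1 huv with rfl | rfl
    · simpa using h
    · simpa using h
  constructor
  · rintro ⟨x, hx, rfl, hxn⟩
    obtain ⟨h1, h2, h3⟩ := conifold_relations hx
    rw [IsNondegenerate, not_and_or] at hxn
    push Not at hxn
    rcases hxn with ⟨h4, h5⟩ | ⟨h4, h5⟩
    · refine Or.inl ⟨x 4, ?_, ?_, rfl⟩
      · rw [← h1, h4, zero_mul]
      · simp [fibration, h4, h5]
    · refine Or.inr ⟨x 4, ?_, ?_, rfl⟩
      · rw [← h2, h4, zero_mul]
      · simp [fibration, h4, h5]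
  · rintro (⟨z, hz, hb1, hb3⟩ | ⟨z, hz, hb1, hb3⟩)
    · obtain ⟨x, hx, rfl, rfl⟩ := exists_mem_conifold_fibration_eq f g hb hb3.symm
      obtain ⟨h1, h2, h3⟩ := conifold_relations hx
      refine ⟨x, hx, rfl, fun hn => ?_⟩
      obtain ⟨h4, h5⟩ := hzero _ _ (h1.trans hz) (EReal.coe_eq_zero.1 hb1)
      exact hn.1.elim (· h4) (· h5)
    · obtain ⟨x, hx, rfl, rfl⟩ := exists_mem_conifold_fibration_eq f g hb hb3.symm
      obtain ⟨h1, h2, h3⟩ := conifold_relations hx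
      refine ⟨x, hx, rfl, fun hn => ?_⟩
      obtain ⟨h4, h5⟩ := hzero _ _ (h2.trans hz) (EReal.coe_eq_zero.1 hb1)
      exact hn.2.elim (· h4) (· h5)

theorem notMem_baseBoundary_of_regular (hfg : IsAdmissible f g) {b : Base}
    (hb : b ∈ regularValues f g) : b ∉ baseBoundary := fun h =>
  hb ((mem_discriminant_iff hfg).2 (Or.inl h))

theorem mem_cone_fiber_iff_of_regular (hfg : IsAdmissible f g) {b : Base}
    (hb : b ∈ regularValues f g) {y : HomCoord} : y ∈ cone (fiber f g b) ↔
      y ∈ cone (openPart f g) ∧ fibration (affineCoord y) = b := by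
  constructor
  · intro hy
    have ho := mem_openPart_of_mem_cone_fiber hfg (notMem_baseBoundary_of_regular hfg hb) hy
    exact ⟨ho, fibration_eq_of_mem_cone_fiber ho hy⟩
  · rintro ⟨ho, rfl⟩
    exact mem_cone_fiber_of_mem ho

theorem isNondegenerate_of_regular (hfg : IsAdmissible f g) {x : Fin 5 → ℂ}
    (hx : x ∈ conifold f g) (hb : fibration x ∈ regularValues f g) : IsNondegenerate x := by
  by_contra h
  exact hb ((mem_discriminant_iff hfg).2 (Or.inr ⟨x, hx, rfl, h⟩))

theorem affineFiber_eq_of_regular (hfg : IsAdmissible f g) {b : Base}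
    (hb : b ∈ regularValues f g) :
    affineFiber f g b = {x | x ∈ conifold f g ∧ fibration x = b} := by
  ext x
  refine and_congr_right fun hx => ?_
  have h1 : embed x ∈ fiber f g b ↔ homLift x ∈ cone (fiber f g b) := by
    rw [mem_cone_iff]
    exact ⟨fun h => ⟨finiteCoord_subset (homLift_mem_finiteCoord x), h⟩, fun ⟨_, h⟩ => h⟩
  rw [h1, mem_cone_fiber_iff_of_regular hfg hb, affineCoord_homLift]
  exact and_iff_right (homLift_mem_cone hx)

theorem fiber_subset_openPart_of_regular (hfg : IsAdmissible f g) {b : Base}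
    (hb : b ∈ regularValues f g) : fiber f g b ⊆ openPart f g := by
  intro p hp
  obtain ⟨y, rfl⟩ := toAmbient_surjective p
  have h1 : y.1 ∈ cone (fiber f g b) := mem_cone_iff.2 ⟨y.2, hp⟩
  obtain ⟨_, h2⟩ := mem_cone_iff.1 ((mem_cone_fiber_iff_of_regular hfg hb).1 h1).1
  exact h2

end Discriminant

/-! ### The holomorphic volume form on the conifold. -/

section VolumeForm

open Set Filter ComplexConjugate

variable {f g : ℂ[X]}

/-- The determinant as a continuous alternating form. -/
def detForm : (Fin 3 → ℂ) [⋀^Fin 3]→L[ℂ] ℂ :=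
  { (Matrix.detRowAlternating : (Fin 3 → ℂ) [⋀^Fin 3]→ₗ[ℂ] ℂ) with
    cont := by
      change Continuous fun M : Matrix (Fin 3) (Fin 3) ℂ => M.det
      exact Continuous.matrix_det continuous_id }

/-- The three functionals `du₁`, `du₂` and `A v₁v₂ dz + B (v₁dv₂ + v₂dv₁)`. -/
def volumeCoord (A B : ℂ[X]) (x : Fin 5 → ℂ) : (Fin 5 → ℂ) →L[ℂ] (Fin 3 → ℂ) :=
  LinearMap.toContinuousLinearMap
    { toFun := fun t => ![t 0, t 2, A.eval (x 4) * x 1 * x 3 * t 4 +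
        B.eval (x 4) * (x 1 * t 3 + x 3 * t 1)]
      map_add' := fun t t' => by
        ext i
        fin_cases i <;> simp
        ring
      map_smul' := fun c t => by
        ext i
        fin_cases i <;> simp
        ring }

theorem volumeCoord_apply (A B : ℂ[X]) (x t : Fin 5 → ℂ) : volumeCoord A B x t =
    ![t 0, t 2, A.eval (x 4) * x 1 * x 3 * t 4 + B.eval (x 4) * (x 1 * t 3 + x 3 * t 1)] := rfl

/-- The holomorphic volume form on the conifold; `A` and `B` are Bezout coefficients of `fg` and
its derivative. -/
def volumeForm (A B : ℂ[X]) (x : Fin 5 → ℂ) : (Fin 5 → ℂ) [⋀^Fin 3]→L[ℂ] ℂ :=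
  (x 4)⁻¹ • detForm.compContinuousLinearMap (volumeCoord A B x)

theorem volumeForm_apply (A B : ℂ[X]) (x : Fin 5 → ℂ) (t : Fin 3 → Fin 5 → ℂ) :
    volumeForm A B x t = (x 4)⁻¹ * (Matrix.of fun j => volumeCoord A B x (t j)).det := rfl

/-- The Bezout identity for `fg` and its derivative. -/
def IsBezoutPair (f g A B : ℂ[X]) : Prop := ∀ z : ℂ, A.eval z * (f.eval z * g.eval z) +
    B.eval z * (f.eval z * g.derivative.eval z + f.derivative.eval z * g.eval z) = 1

/-- A tangent vector is split into the two torus directions (u₁, -v₁), (u₂, -v₂) and a lift (c, c',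
d, d', 1) of ∂/∂z. The determinant then acquires the factor A fg + B (fg)' = 1. The lift is left
free so that the formula also applies where u₁ or u₂ vanishes. -/
theorem volumeForm_eq_det {A B : ℂ[X]} (hAB : IsBezoutPair f g A B) {x : Fin 5 → ℂ}
    (hx : x ∈ conifold f g) {c c' d d' : ℂ} (hc : c * x 1 + x 0 * c' = f.derivative.eval (x 4))
    (hd : d * x 3 + x 2 * d' = g.derivative.eval (x 4)) {α β : Fin 3 → ℂ}
    {t : Fin 3 → Fin 5 → ℂ} (h0 : ∀ j, t j 0 = x 0 * α j + c * t j 4)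
    (h1 : ∀ j, t j 1 = -(x 1 * α j) + c' * t j 4) (h2 : ∀ j, t j 2 = x 2 * β j + d * t j 4)
    (h3 : ∀ j, t j 3 = -(x 3 * β j) + d' * t j 4) :
    volumeForm A B x t = (Matrix.of fun j => ![α j, β j, t j 4 / x 4]).det := by
  obtain ⟨e1, e2, e3⟩ := conifold_relations hx
  have hE := hAB (x 4)
  rw [← hc, ← hd, ← e1, ← e2] at hE
  have key : (Matrix.of fun j => volumeCoord A B x (t j)).det =
      (Matrix.of fun j => ![α j, β j, t j 4]).det *
        (A.eval (x 4) * (x 0 * x 1 * (x 2 * x 3)) + B.eval (x 4) *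
          (x 0 * x 1 * (d * x 3 + x 2 * d') + (c * x 1 + x 0 * c') * (x 2 * x 3))) := by
    simp only [volumeCoord_apply, Matrix.det_fin_three, Matrix.of_apply, Matrix.cons_val, h0, h1,
      h2, h3]
    ring
  rw [volumeForm_apply, key, hE]
  simp only [Matrix.det_fin_three, Matrix.of_apply, Matrix.cons_val]
  field_simp

theorem analyticAt_apply (i : Fin 5) (x : Fin 5 → ℂ) : AnalyticAt ℂ (fun x : Fin 5 → ℂ => x i) x :=
  (ContinuousLinearMap.proj (R := ℂ) (φ := fun _ : Fin 5 => ℂ) i).analyticAt x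

theorem analyticAt_eval_apply (p : ℂ[X]) (x : Fin 5 → ℂ) :
    AnalyticAt ℂ (fun x : Fin 5 → ℂ => p.eval (x 4)) x :=
  AnalyticAt.comp (f := fun x : Fin 5 → ℂ => x 4) (p.differentiable.analyticAt (x 4))
    (analyticAt_apply 4 x)

theorem isLogVolumeForm_volumeForm (hfg : IsAdmissible f g) {A B : ℂ[X]}
    (hAB : IsBezoutPair f g A B) : IsLogVolumeForm f g (volumeForm A B) := by
  refine ⟨fun t x hx => ?_, fun x hx h0 h2 t ht => ?_⟩
  · simp only [volumeForm_apply, volumeCoord_apply, Matrix.det_fin_three, Matrix.of_apply,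
      Matrix.cons_val]
    have hp := fun i => analyticAt_apply i x
    have hA := analyticAt_eval_apply A x
    have hB := analyticAt_eval_apply B x
    have hβ : ∀ j, AnalyticAt ℂ (fun x : Fin 5 → ℂ => A.eval (x 4) * x 1 * x 3 * t j 4 +
        B.eval (x 4) * (x 1 * t j 3 + x 3 * t j 1)) x := fun j =>
      (((hA.mul (hp 1)).mul (hp 3)).mul analyticAt_const).add
        (hB.mul (((hp 1).mul analyticAt_const).add ((hp 3).mul analyticAt_const)))
    have hβ0 := hβ 0
    have hβ1 := hβ 1
    have hβ2 := hβ 2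
    have h4 : AnalyticAt ℂ (fun x : Fin 5 → ℂ => (x 4)⁻¹) x := (hp 4).inv hx.2.2
    refine h4.mul ?_
    fun_prop
  · have ht' : ∀ j, t j 0 * x 1 + x 0 * t j 1 = f.derivative.eval (x 4) * t j 4 ∧
        t j 2 * x 3 + x 2 * t j 3 = g.derivative.eval (x 4) * t j 4 := by
      intro j
      have := ht j
      rw [tangentConeAt_conifold hfg hx] at this
      exact conifoldEqDeriv_eq_zero_iff.1 this
    -- With c = d = 0 the coefficients α and β are du₁/u₁ and du₂/u₂.
    refine volumeForm_eq_det hAB hx (c := 0) (c' := f.derivative.eval (x 4) / x 0) (d := 0)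
      (d' := g.derivative.eval (x 4) / x 2) (by field_simp; ring) (by field_simp; ring) ?_ ?_ ?_ ?_
    · intro j; field_simp; ring
    · intro j
      field_simp
      linear_combination (ht' j).1
    · intro j; field_simp; ring
    · intro j
      field_simp
      linear_combination (ht' j).2

theorem exists_isBezoutPair (hfg : IsAdmissible f g) : ∃ A B, IsBezoutPair f g A B :=
  hfg.exists_bezout

/-- The volume form does not vanish on the conifold. -/
theorem exists_volumeForm_ne_zero {A B : ℂ[X]}
    (hAB : IsBezoutPair f g A B) {x : Fin 5 → ℂ} (hx : x ∈ conifold f g) :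
    ∃ t : Fin 3 → Fin 5 → ℂ, (∀ j, conifoldEqDeriv f g x (t j) = 0) ∧
      volumeForm A B x t ≠ 0 := by
  obtain ⟨e1, e2, e3⟩ := conifold_relations hx
  simp_rw [conifoldEqDeriv_eq_zero_iff]
  by_cases hf : x 0 ≠ 0 ∨ x 1 ≠ 0
  · by_cases hg : x 2 ≠ 0 ∨ x 3 ≠ 0
    · obtain ⟨c, c', hc⟩ := exists_solve hf (f.derivative.eval (x 4))
      obtain ⟨d, d', hd⟩ := exists_solve hg (g.derivative.eval (x 4))
      refine ⟨![![x 0, -x 1, 0, 0, 0], ![0, 0, x 2, -x 3, 0], ![c, c', d, d', 1]], ?_, ?_⟩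
      · intro j
        fin_cases j <;> simp [hc, hd]
      · rw [volumeForm_eq_det hAB hx hc hd (α := ![1, 0, 0]) (β := ![0, 1, 0])]
        · simp [Matrix.det_fin_three, e3]
        all_goals
          intro j
          fin_cases j <;> simp
    · push Not at hg
      have hg0 : g.eval (x 4) = 0 := by rw [← e2, hg.1, zero_mul]
      have h1 := hAB (x 4)
      rw [hg0, mul_zero, mul_zero, mul_zero, zero_add, add_zero] at h1
      -- At u₂ = v₂ = 0 the tangent space has dz = 0 while du₂ and dv₂ are free, and the Bezout
      -- identity reduces to B f g' = 1, which makes B, u₁ and v₁ non-zero.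
      refine ⟨![![0, 0, 1, 0, 0], ![0, 0, 0, 1, 0], ![x 0, -x 1, 0, 0, 0]], ?_, ?_⟩
      · intro j
        fin_cases j <;> simp [hg, mul_comm]
      · rw [volumeForm_apply]
        simp [Matrix.det_fin_three, volumeCoord_apply, hg, e3]
        refine ⟨⟨?_, ?_⟩, ?_⟩
        all_goals
          intro h
          rw [← e1] at h1
          simp [h] at h1
  · push Not at hf
    have hf0 : f.eval (x 4) = 0 := by rw [← e1, hf.1, zero_mul]
    have h1 := hAB (x 4)
    rw [hf0, zero_mul, mul_zero, zero_mul, zero_add, zero_add] at h1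
    refine ⟨![![1, 0, 0, 0, 0], ![0, 1, 0, 0, 0], ![0, 0, x 2, -x 3, 0]], ?_, ?_⟩
    · intro j
      fin_cases j <;> simp [hf, mul_comm]
    · rw [volumeForm_apply]
      simp [Matrix.det_fin_three, volumeCoord_apply, hf, e3]
      refine ⟨⟨?_, ?_⟩, ?_⟩
      all_goals
        intro h
        rw [← e2] at h1
        simp [h] at h1

/-! ### Uniqueness of the volume form on tangent vectors. -/

section Uniqueness

/-- Holomorphy of the form is given only on fixed vectors; expanding the moving vectors in the
standard basis reduces to that case. -/
theorem continuousAt_alternating_apply {X : Type*} [TopologicalSpace X] {x : X}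
    {Ω : X → (Fin 5 → ℂ) [⋀^Fin 3]→L[ℂ] ℂ} (hΩ : ∀ t, ContinuousAt (fun x => Ω x t) x)
    {τ : Fin 3 → X → Fin 5 → ℂ} (hτ : ∀ j, ContinuousAt (τ j) x) :
    ContinuousAt (fun x => Ω x (fun j => τ j x)) x := by
  have hexp : ∀ x, Ω x (fun j => τ j x) = ∑ r : Fin 3 → Fin 5,
      (∏ j, τ j x (r j)) * Ω x (fun j => Pi.single (r j) 1) := by
    intro x
    have h1 : ∀ j, τ j x = ∑ i : Fin 5, τ j x i • (Pi.single i (1 : ℂ) : Fin 5 → ℂ) := by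
      intro j
      exact pi_eq_sum_univ' (τ j x)
    have h2 : Ω x (fun j => τ j x) =
        (Ω x).toMultilinearMap (fun j => ∑ i : Fin 5, τ j x i • (Pi.single i (1 : ℂ))) := by
      conv_lhs => rw [show (fun j => τ j x) = fun j => ∑ i : Fin 5,
        τ j x i • (Pi.single i (1 : ℂ) : Fin 5 → ℂ) from funext h1]
      rfl
    rw [h2, MultilinearMap.map_sum]
    refine Finset.sum_congr rfl fun r _ => ?_
    rw [MultilinearMap.map_smul_univ]
    rfl
  simp_rw [hexp]
  refine tendsto_finsetSum _ fun r _ => ?_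
  refine Tendsto.mul (tendsto_finsetProd _ fun j _ => ?_) (hΩ _)
  exact ((continuous_apply (r j)).continuousAt.comp (hτ j)).tendsto

/-- If u = v = 0, then u alone moves and z must stay; if u = 0 ≠ v, then u = p(z)/v becomes non-zero
once z leaves the root; if u ≠ 0, it stays fixed. -/
theorem exists_path_generic_factor {p : ℂ[X]} {u v z : ℂ} (h : u * v = p.eval z) {ζ : ℂ → ℂ}
    (hζ : ContinuousAt ζ 0) (hζ0 : ζ 0 = z) (h1 : u = 0 → v = 0 → ∀ ε, ζ ε = z)
    (h2 : u = 0 → v ≠ 0 → ∀ᶠ ε in 𝓝[≠] 0, p.eval (ζ ε) ≠ 0) :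
    ∃ U V : ℂ → ℂ, ContinuousAt U 0 ∧ ContinuousAt V 0 ∧ U 0 = u ∧ V 0 = v ∧
      (∀ ε, U ε * V ε = p.eval (ζ ε)) ∧ ∀ᶠ ε in 𝓝[≠] 0, U ε ≠ 0 := by
  have hp : ContinuousAt (fun ε => p.eval (ζ ε)) 0 :=
    ContinuousAt.comp (g := fun z => p.eval z) p.continuous.continuousAt hζ
  by_cases hu : u = 0
  · by_cases hv : v = 0
    · refine ⟨id, 0, continuousAt_id, continuousAt_const, hu.symm, hv.symm, fun ε => ?_, ?_⟩
      · rw [h1 hu hv, ← h, hv]; simp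
      · filter_upwards [self_mem_nhdsWithin] with ε hε using hε
    · refine ⟨fun ε => p.eval (ζ ε) / v, fun _ => v, hp.div_const _, continuousAt_const, ?_, rfl,
        fun ε => by field_simp, ?_⟩
      · simp only [hζ0, ← h]; field_simp
      · filter_upwards [h2 hu hv] with ε hε
        exact div_ne_zero hε hv
  · refine ⟨fun _ => u, fun ε => p.eval (ζ ε) / u, continuousAt_const, hp.div_const _, rfl, ?_,
      fun ε => by field_simp, Eventually.of_forall fun _ => hu⟩
    simp only [hζ0, ← h]; field_simp

theorem mem_closure_generic (hfg : IsAdmissible f g) {x : Fin 5 → ℂ} (hx : x ∈ conifold f g) :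
    x ∈ closure {w | w ∈ conifold f g ∧ w 0 ≠ 0 ∧ w 2 ≠ 0} := by
  classical
  obtain ⟨e1, e2, e3⟩ := conifold_relations hx
  -- The coordinate z moves only if some pair has u = 0 ≠ v. That cannot coincide with a pair u = v
  -- = 0, which needs z fixed, since f and g have no common root.
  let ζ : ℂ → ℂ := fun ε =>
    if (x 0 = 0 ∧ x 1 ≠ 0) ∨ (x 2 = 0 ∧ x 3 ≠ 0) then x 4 + ε else x 4
  have hζ : ContinuousAt ζ 0 := by
    simp only [ζ]
    split_ifs <;> fun_prop
  have hζ0 : ζ 0 = x 4 := by simp [ζ]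
  have hmove : ∀ p : ℂ[X], p.eval (x 4) = 0 → p.derivative.eval (x 4) ≠ 0 →
      ∀ᶠ ε in 𝓝[≠] (0 : ℂ), p.eval (x 4 + ε) ≠ 0 := by
    intro p hp hp'
    have h1 : HasDerivAt (fun ε => p.eval (x 4 + ε)) (p.derivative.eval (x 4)) 0 := by
      have := (p.hasDerivAt (x 4 + 0)).comp_const_add (x 4) 0
      simpa using this
    exact h1.eventually_ne hp'
  obtain ⟨U, V, hU, hV, hU0, hV0, hUV, hUne⟩ := exists_path_generic_factor e1 hζ hζ0
    (fun h0 h1 ε => by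
      have hf0 : f.eval (x 4) = 0 := by rw [← e1, h0, zero_mul]
      have hg0 := hfg.right_ne_zero hf0
      have h2 : x 2 ≠ 0 := fun h => hg0 (by rw [← e2, h, zero_mul])
      simp [ζ, h1, h2])
    (fun h0 h1 => by
      have hf0 : f.eval (x 4) = 0 := by rw [← e1, h0, zero_mul]
      simpa [ζ, h0, h1] using hmove f hf0 (hfg.left_derivative_ne_zero hf0))
  obtain ⟨U', V', hU', hV', hU0', hV0', hUV', hUne'⟩ := exists_path_generic_factor e2 hζ hζ0
    (fun h0 h1 ε => by
      have hg0 : g.eval (x 4) = 0 := by rw [← e2, h0, zero_mul]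
      have hf0 := hfg.symm.right_ne_zero hg0
      have h2 : x 0 ≠ 0 := fun h => hf0 (by rw [← e1, h, zero_mul])
      simp [ζ, h1, h2])
    (fun h0 h1 => by
      have hg0 : g.eval (x 4) = 0 := by rw [← e2, h0, zero_mul]
      simpa [ζ, h0, h1] using hmove g hg0 (hfg.symm.left_derivative_ne_zero hg0))
  let γ : ℂ → Fin 5 → ℂ := fun ε => ![U ε, V ε, U' ε, V' ε, ζ ε]
  have hγ : ContinuousAt γ 0 := by
    rw [continuousAt_pi]
    intro i
    fin_cases i
    exacts [hU, hV, hU', hV', hζ]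
  have hγ0 : γ 0 = x := by
    ext i
    fin_cases i
    exacts [hU0, hV0, hU0', hV0', hζ0]
  have ht : Tendsto γ (𝓝[≠] 0) (𝓝 x) := by
    have := hγ.tendsto.mono_left (nhdsWithin_le_nhds (s := {0}ᶜ))
    rwa [hγ0] at this
  refine mem_closure_of_tendsto ht ?_
  have hζne : ∀ᶠ ε in 𝓝 0, ζ ε ≠ 0 := hζ.eventually_ne (by rwa [hζ0])
  filter_upwards [hUne, hUne', hζne.filter_mono nhdsWithin_le_nhds] with ε h1 h2 h3
  exact ⟨⟨hUV ε, hUV' ε, h3⟩, h1, h2⟩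

/-- The volume form is determined on tangent vectors by the logarithmic formula. -/
theorem IsLogVolumeForm.apply_eq (hfg : IsAdmissible f g)
    {Ω Ω' : (Fin 5 → ℂ) → (Fin 5 → ℂ) [⋀^Fin 3]→L[ℂ] ℂ} (hΩ : IsLogVolumeForm f g Ω)
    (hΩ' : IsLogVolumeForm f g Ω') {x : Fin 5 → ℂ} (hx : x ∈ conifold f g)
    {t : Fin 3 → Fin 5 → ℂ} (ht : ∀ j, conifoldEqDeriv f g x (t j) = 0) : Ω x t = Ω' x t := by
  -- The tangent vectors are extended continuously to tangent vectors at nearby generic points,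
  -- where the logarithmic formula determines both forms.
  choose τ hτ hτx hτe using fun j => exists_continuousAt_ker
    (continuous_conifoldEqDeriv f g).continuousAt (conifoldEqDeriv_surjective hfg hx) (ht j)
  have h1 := continuousAt_alternating_apply (fun t => (hΩ.holomorphic t x hx).continuousAt) hτ
  have h2 := continuousAt_alternating_apply (fun t => (hΩ'.holomorphic t x hx).continuousAt) hτ
  have h3 := eq_of_eventually_eq_on (mem_closure_generic hfg hx) h1 h2 (by
    filter_upwards [eventually_all.2 hτe] with w hw hwS
    have htan : ∀ j, τ j w ∈ tangentConeAt ℂ (conifold f g) w := fun j => by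
      rw [tangentConeAt_conifold hfg hwS.1]
      exact hw j
    rw [hΩ.eq_log w hwS.1 hwS.2.1 hwS.2.2 _ htan, hΩ'.eq_log w hwS.1 hwS.2.1 hwS.2.2 _ htan])
  simpa [hτx] using h3

end Uniqueness

theorem IsLogVolumeForm.isNowhereVanishing (hfg : IsAdmissible f g)
    {Ω : (Fin 5 → ℂ) → (Fin 5 → ℂ) [⋀^Fin 3]→L[ℂ] ℂ} (hΩ : IsLogVolumeForm f g Ω) :
    IsNowhereVanishing f g Ω := by
  obtain ⟨A, B, hAB⟩ := exists_isBezoutPair hfg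
  intro x hx
  obtain ⟨t, ht, hne⟩ := exists_volumeForm_ne_zero hAB hx
  refine ⟨t, fun j => ?_, ?_⟩
  · rw [tangentConeAt_conifold hfg hx]
    exact ht j
  · rwa [hΩ.apply_eq hfg (isLogVolumeForm_volumeForm hfg hAB) hx ht]

end VolumeForm

/-! ### Special Lagrangian fibres. -/

section SpecialLagrangian

open Set Filter ComplexConjugate

variable {f g : ℂ[X]}

theorem conj_mul_add_ne_zero {u v : ℂ} (h : u ≠ 0 ∨ v ≠ 0) : conj u * u + conj v * v ≠ 0 := by
  rw [mul_comm, Complex.mul_conj, mul_comm, Complex.mul_conj]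
  norm_cast
  rcases h with h | h
  · have := Complex.normSq_pos.2 h
    have := Complex.normSq_nonneg v
    positivity
  · have := Complex.normSq_pos.2 h
    have := Complex.normSq_nonneg u
    positivity

/-- The volume form at a nondegenerate point, in a coframe adapted to the torus action. -/
theorem volumeForm_eq_det_conj {A B : ℂ[X]} (hAB : IsBezoutPair f g A B) {x : Fin 5 → ℂ}
    (hx : x ∈ conifold f g) (hn : IsNondegenerate x) {t : Fin 3 → Fin 5 → ℂ}
    (ht : ∀ j, conifoldEqDeriv f g x (t j) = 0) :
    volumeForm A B x t = (Matrix.of fun j =>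
      ![(conj (x 0) * t j 0 - conj (x 1) * t j 1) / (conj (x 0) * x 0 + conj (x 1) * x 1),
        (conj (x 2) * t j 2 - conj (x 3) * t j 3) / (conj (x 2) * x 2 + conj (x 3) * x 3),
        t j 4 / x 4]).det := by
  have hN := conj_mul_add_ne_zero hn.1
  have hM := conj_mul_add_ne_zero hn.2
  simp_rw [conifoldEqDeriv_eq_zero_iff] at ht
  set N := conj (x 0) * x 0 + conj (x 1) * x 1 with hNd
  set M := conj (x 2) * x 2 + conj (x 3) * x 3 with hMd
  -- This lift of ∂/∂z is Hermitian-orthogonal to the torus directions, so α and β become the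
  -- functionals (ū du - v̄ dv)/(|u|² + |v|²).
  refine volumeForm_eq_det hAB hx (c := conj (x 1) * f.derivative.eval (x 4) / N)
    (c' := conj (x 0) * f.derivative.eval (x 4) / N)
    (d := conj (x 3) * g.derivative.eval (x 4) / M)
    (d' := conj (x 2) * g.derivative.eval (x 4) / M) ?_ ?_ ?_ ?_ ?_ ?_
  · field_simp
    rw [hNd]; ring
  · field_simp
    rw [hMd]; ring
  · intro j
    field_simp
    rw [hNd]
    linear_combination conj (x 1) * (ht j).1
  · intro j
    field_simp
    rw [hNd]
    linear_combination conj (x 0) * (ht j).1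
  · intro j
    field_simp
    rw [hMd]
    linear_combination conj (x 3) * (ht j).2
  · intro j
    field_simp
    rw [hMd]
    linear_combination conj (x 2) * (ht j).2

theorem eq_I_mul_of_re_eq_zero {z : ℂ} (h : z.re = 0) : z = Complex.I * (z.im : ℂ) := by
  apply Complex.ext <;> simp [h]

/-- The volume form is imaginary on the tangent spaces of the fibres. -/
theorem exists_volumeForm_eq {A B : ℂ[X]} (hAB : IsBezoutPair f g A B) {x : Fin 5 → ℂ}
    (hx : x ∈ conifold f g) (hn : IsNondegenerate x) {t : Fin 3 → Fin 5 → ℂ}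
    (ht : ∀ j, conifoldEqDeriv f g x (t j) = 0) (ht' : ∀ j, momentDeriv x (t j) = 0) :
    ∃ ρ : ℝ, volumeForm A B x t = ρ * Complex.I := by
  have hreal : ∀ a b : ℂ, conj a * a + conj b * b = ((Complex.normSq a + Complex.normSq b : ℝ) : ℂ)
      := by
    intro a b
    rw [mul_comm, Complex.mul_conj, mul_comm, Complex.mul_conj]
    push_cast
    rfl
  have him : ∀ j, ∃ a b c : ℝ,
      (conj (x 0) * t j 0 - conj (x 1) * t j 1) / (conj (x 0) * x 0 + conj (x 1) * x 1) =
        Complex.I * a ∧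
      (conj (x 2) * t j 2 - conj (x 3) * t j 3) / (conj (x 2) * x 2 + conj (x 3) * x 3) =
        Complex.I * b ∧
      t j 4 / x 4 = Complex.I * c := by
    intro j
    have h := ht' j
    rw [momentDeriv_apply] at h
    have h0 := congrFun h 0
    have h1 := congrFun h 1
    have h2 := congrFun h 2
    simp only [Matrix.cons_val, Pi.zero_apply] at h0 h1 h2
    refine ⟨_, _, _, eq_I_mul_of_re_eq_zero ?_, eq_I_mul_of_re_eq_zero ?_,
      eq_I_mul_of_re_eq_zero ?_⟩
    · rw [hreal, Complex.div_ofReal_re, Complex.sub_re, h0, zero_div]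
    · rw [hreal, Complex.div_ofReal_re, Complex.sub_re, h1, zero_div]
    · have h4 : t j 4 / x 4 = conj (x 4) * t j 4 / (Complex.normSq (x 4) : ℝ) := by
        rw [← Complex.mul_conj]
        have : x 4 ≠ 0 := hx.2.2
        have : conj (x 4) ≠ 0 := by simpa using this
        field_simp
      rw [h4, Complex.div_ofReal_re]
      have : (conj (x 4) * t j 4).re = 0 := by linarith
      rw [this, zero_div]
  choose a b c ha hb hc using him
  rw [volumeForm_eq_det_conj hAB hx hn ht]
  simp_rw [ha, hb, hc]
  -- Three imaginary columns contribute i³ = -i in front of a real determinant.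
  refine ⟨-(Matrix.of fun j => ![a j, b j, c j]).det, ?_⟩
  simp only [Matrix.det_fin_three, Matrix.of_apply, Matrix.cons_val]
  push_cast
  have hI : Complex.I ^ 3 = -Complex.I := Complex.I_pow_three
  linear_combination (a 0 * b 1 * c 2 - a 0 * c 1 * b 2 - b 0 * a 1 * c 2 + b 0 * c 1 * a 2
    + c 0 * a 1 * b 2 - c 0 * b 1 * a 2 : ℂ) * hI

/-- The tangent spaces of the fibres contain frames of constant volume. -/
theorem exists_fiber_frame {A B : ℂ[X]} (hAB : IsBezoutPair f g A B) {x : Fin 5 → ℂ}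
    (hx : x ∈ conifold f g) (hn : IsNondegenerate x) :
    ∃ t : Fin 3 → Fin 5 → ℂ, (∀ j, conifoldEqDeriv f g x (t j) = 0) ∧
      (∀ j, momentDeriv x (t j) = 0) ∧ volumeForm A B x t = -Complex.I := by
  obtain ⟨e1, e2, e3⟩ := conifold_relations hx
  obtain ⟨s, t, h1, h2⟩ := exists_solve_real hn.1
    (f.derivative.eval (x 4) * (Complex.I * x 4)) 0
  obtain ⟨s', t', h1', h2'⟩ := exists_solve_real hn.2
    (g.derivative.eval (x 4) * (Complex.I * x 4)) 0
  have hN := conj_mul_add_ne_zero hn.1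
  have hM := conj_mul_add_ne_zero hn.2
  -- The frame consists of the two torus rotations and a lift of the rotation iz of z that preserves
  -- both moment maps.
  have hker : ∀ j, conifoldEqDeriv f g x
      ((![![Complex.I * x 0, -(Complex.I * x 1), 0, 0, 0],
        ![0, 0, Complex.I * x 2, -(Complex.I * x 3), 0],
        ![s, t, s', t', Complex.I * x 4]] : Fin 3 → Fin 5 → ℂ) j) = 0 := by
    intro j
    rw [conifoldEqDeriv_eq_zero_iff]
    fin_cases j
    · simp; ring
    · simp; ring
    · exact ⟨h1, h1'⟩
  have hre : ∀ a b : ℂ, (conj a * (Complex.I * a)).re - (conj b * -(Complex.I * b)).re = 0 := by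
    intro a b
    simp
    ring
  refine ⟨_, hker, ?_, ?_⟩
  · intro j
    rw [momentDeriv_apply]
    ext i
    fin_cases j
    · fin_cases i
      · exact hre _ _
      · simp
      · simp
    · fin_cases i
      · simp
      · exact hre _ _
      · simp
    · fin_cases i
      · exact h2
      · exact h2'
      · simp
        ring
  · rw [volumeForm_eq_det_conj hAB hx hn hker]
    simp only [Matrix.det_fin_three, Matrix.of_apply, Matrix.cons_val]
    have q1 : (conj (x 0) * (Complex.I * x 0) - conj (x 1) * -(Complex.I * x 1)) /
        (conj (x 0) * x 0 + conj (x 1) * x 1) = Complex.I := by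
      rw [div_eq_iff hN]; ring
    have q2 : (conj (x 2) * (Complex.I * x 2) - conj (x 3) * -(Complex.I * x 3)) /
        (conj (x 2) * x 2 + conj (x 3) * x 3) = Complex.I := by
      rw [div_eq_iff hM]; ring
    rw [q1, q2, mul_div_cancel_right₀ _ e3]
    simp only [mul_zero, sub_zero, zero_div, zero_mul, add_zero]
    linear_combination Complex.I_pow_three

/-- The tangent space of the fibre through `x`. -/
def fiberTangent (f g : ℂ[X]) (x : Fin 5 → ℂ) : Submodule ℝ (Fin 5 → ℂ) :=
  LinearMap.ker ((((conifoldEqDeriv f g x).restrictScalars ℝ).prod (momentDeriv x) :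
    (Fin 5 → ℂ) →L[ℝ] (Fin 2 → ℂ) × (Fin 3 → ℝ)) : (Fin 5 → ℂ) →ₗ[ℝ] (Fin 2 → ℂ) × (Fin 3 → ℝ))

theorem mem_fiberTangent {x t : Fin 5 → ℂ} : t ∈ fiberTangent f g x ↔
    conifoldEqDeriv f g x t = 0 ∧ momentDeriv x t = 0 := by
  simp [fiberTangent]

theorem finrank_fiberTangent {x : Fin 5 → ℂ} (hx : x ∈ conifold f g) (hn : IsNondegenerate x) :
    Module.finrank ℝ (fiberTangent f g x) = 3 := by
  have h := LinearMap.finrank_range_add_finrank_ker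
    ((((conifoldEqDeriv f g x).restrictScalars ℝ).prod (momentDeriv x) :
      (Fin 5 → ℂ) →L[ℝ] (Fin 2 → ℂ) × (Fin 3 → ℝ)) : (Fin 5 → ℂ) →ₗ[ℝ] (Fin 2 → ℂ) × (Fin 3 → ℝ))
  rw [LinearMap.range_eq_top.2, finrank_top] at h
  · simp only [Module.finrank_prod, Module.finrank_pi_fintype, Complex.finrank_real_complex,
      Finset.sum_const, Finset.card_univ, Fintype.card_fin, Module.finrank_self] at h
    change _ + Module.finrank ℝ (fiberTangent f g x) = _ at h
    simp at h
    omega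
  · rintro ⟨p, η⟩
    obtain ⟨t, ht⟩ := exists_solve_fiber (f := f) (g := g) hn hx.2.2 p η
    exact ⟨t, Prod.ext ht.1 ht.2⟩

/-- The complex equation leaves the line spanned by (u, -v), and the moment equation makes the
coefficient imaginary. -/
theorem exists_smul_eq_of_ker {u v s t : ℂ} (h : u ≠ 0 ∨ v ≠ 0) (h1 : s * v + u * t = 0)
    (h2 : (conj u * s).re = (conj v * t).re) :
    ∃ a : ℝ, s = a * (Complex.I * u) ∧ t = -(a * (Complex.I * v)) := by
  have hN := conj_mul_add_ne_zero h
  set N := conj u * u + conj v * v with hNd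
  have hNr : N = ((Complex.normSq u + Complex.normSq v : ℝ) : ℂ) := by
    rw [hNd, mul_comm, Complex.mul_conj, mul_comm, Complex.mul_conj]
    push_cast
    rfl
  have hre : ((conj u * s - conj v * t) / N).re = 0 := by
    rw [hNr, Complex.div_ofReal_re, Complex.sub_re, h2, sub_self, zero_div]
  have him := eq_I_mul_of_re_eq_zero hre
  refine ⟨((conj u * s - conj v * t) / N).im, ?_, ?_⟩
  · have : s = (conj u * s - conj v * t) / N * u := by
      field_simp
      rw [hNd]
      linear_combination conj v * h1
    rw [him] at this
    linear_combination this
  · have : t = -((conj u * s - conj v * t) / N * v) := by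
      field_simp
      rw [hNd]
      linear_combination conj u * h1
    rw [him] at this
    linear_combination this

/-- The fibres are Lagrangian. -/
theorem stdSymplectic_eq_zero {x : Fin 5 → ℂ} (hx : x ∈ conifold f g) (hn : IsNondegenerate x)
    {v w : Fin 5 → ℂ} (hv : v ∈ fiberTangent f g x) (hw : w ∈ fiberTangent f g x) :
    stdSymplectic v w = 0 := by
  have h4 : x 4 ≠ 0 := hx.2.2
  -- A fibre tangent vector with dz = 0 is a real combination of the torus generators, whose
  -- pairings with ω are, up to sign, the moment differentials; these vanish on the fibre.
  have hvert : ∀ u ∈ fiberTangent f g x, u 4 = 0 → ∀ w ∈ fiberTangent f g x,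
      stdSymplectic u w = 0 := by
    intro u hu hu4 w hw
    obtain ⟨a1, a2⟩ := mem_fiberTangent.1 hu
    obtain ⟨b1, b2⟩ := mem_fiberTangent.1 hw
    rw [conifoldEqDeriv_eq_zero_iff, hu4, mul_zero, mul_zero] at a1
    rw [momentDeriv_apply] at a2 b2
    have a20 := congrFun a2 0
    have a21 := congrFun a2 1
    have b20 := congrFun b2 0
    have b21 := congrFun b2 1
    simp only [Matrix.cons_val, Pi.zero_apply] at a20 a21 b20 b21
    obtain ⟨a, ha, ha'⟩ := exists_smul_eq_of_ker hn.1 a1.1 (sub_eq_zero.1 a20)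
    obtain ⟨b, hb, hb'⟩ := exists_smul_eq_of_ker hn.2 a1.2 (sub_eq_zero.1 a21)
    simp only [stdSymplectic, Fin.sum_univ_five, hu4, ha, ha', hb, hb']
    simp at b20 b21 ⊢
    linear_combination (-a) * b20 - b * b21
  have hz : ∀ u ∈ fiberTangent f g x, ∃ c : ℝ, u 4 = c * (Complex.I * x 4) := by
    intro u hu
    have h2 := (mem_fiberTangent.1 hu).2
    rw [momentDeriv_apply] at h2
    have h3 := congrFun h2 2
    simp only [Matrix.cons_val, Pi.zero_apply] at h3
    have h5 : (conj (x 4) * u 4).re = 0 := by linarith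
    refine ⟨(conj (x 4) * u 4).im / Complex.normSq (x 4), ?_⟩
    have h6 := eq_I_mul_of_re_eq_zero h5
    have h7 : x 4 * conj (x 4) = Complex.normSq (x 4) := Complex.mul_conj _
    have h8 : (Complex.normSq (x 4) : ℂ) ≠ 0 := by simpa using h4
    generalize (conj (x 4) * u 4).im = m at h6 ⊢
    push_cast
    field_simp
    rw [← h7]
    linear_combination x 4 * h6
  obtain ⟨c, hc⟩ := hz v hv
  obtain ⟨d, hd⟩ := hz w hw
  have hadd : ∀ (a b : ℝ) (u u' w : Fin 5 → ℂ), stdSymplectic (a • u - b • u') w =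
      a * stdSymplectic u w - b * stdSymplectic u' w := by
    intro a b u u' w
    simp only [stdSymplectic, Fin.sum_univ_five]
    simp
    ring
  have hself : ∀ u : Fin 5 → ℂ, stdSymplectic u u = 0 := by
    intro u
    simp only [stdSymplectic, Fin.sum_univ_five]
    simp
    ring
  have hskew : stdSymplectic w v = -stdSymplectic v w := by
    simp only [stdSymplectic, Fin.sum_univ_five]
    simp
    ring
  -- Both z-components are real multiples of iz, so this combination is vertical; pairing it with v
  -- gives c ω(v, w) = 0.
  have hcomb : d • v - c • w ∈ fiberTangent f g x :=
    Submodule.sub_mem _ (Submodule.smul_mem _ _ hv) (Submodule.smul_mem _ _ hw)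
  have hcomb4 : (d • v - c • w) 4 = 0 := by
    simp [hc, hd]
    ring
  by_cases h0 : c = 0
  · exact hvert v hv (by rw [hc, h0]; simp) w hw
  · have := hvert _ hcomb hcomb4 v hv
    rw [hadd, hself, hskew] at this
    have h9 : c * stdSymplectic v w = 0 := by linarith
    exact (mul_eq_zero.1 h9).resolve_left h0

theorem tangentConeAt_affineFiber (hfg : IsAdmissible f g) {x : Fin 5 → ℂ}
    (hx : x ∈ conifold f g) (hb : fibration x ∈ regularValues f g) :
    tangentConeAt ℝ (affineFiber f g (fibration x)) x = fiberTangent f g x := by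
  rw [affineFiber_eq_of_regular hfg hb]
  simp_rw [fibration_eq_iff]
  rw [tangentConeAt_fiber hx (isNondegenerate_of_regular hfg hx hb)]
  ext t
  exact mem_fiberTangent.symm

theorem IsLogVolumeForm.isSpecialLagrangianFibration (hfg : IsAdmissible f g)
    {Ω : (Fin 5 → ℂ) → (Fin 5 → ℂ) [⋀^Fin 3]→L[ℂ] ℂ} (hΩ : IsLogVolumeForm f g Ω) :
    IsSpecialLagrangianFibration f g Ω := by
  obtain ⟨A, B, hAB⟩ := exists_isBezoutPair hfg
  -- On fibre tangents Ω is imaginary, so the rotation by i makes it real.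
  refine ⟨Real.pi / 2, fun b hb => ⟨fiber_subset_openPart_of_regular hfg hb, fun x hx => ?_⟩⟩
  rw [affineFiber_eq_of_regular hfg hb] at hx
  obtain ⟨hx, rfl⟩ := hx
  have hn := isNondegenerate_of_regular hfg hx hb
  refine ⟨fiberTangent f g x, (tangentConeAt_affineFiber hfg hx hb).symm,
    finrank_fiberTangent hx hn, fun v hv w hw => stdSymplectic_eq_zero hx hn hv hw,
    fun t ht => ?_⟩
  have h1 := fun j => (mem_fiberTangent.1 (ht j)).1
  rw [hΩ.apply_eq hfg (isLogVolumeForm_volumeForm hfg hAB) hx h1]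
  obtain ⟨ρ, hρ⟩ := exists_volumeForm_eq hAB hx hn h1 fun j => (mem_fiberTangent.1 (ht j)).2
  rw [hρ]
  push_cast
  rw [Complex.exp_pi_div_two_mul_I]
  simp

end SpecialLagrangian

/-! ### The determinant of ℂ⁸ and the residual volume form. -/

section Determinant

open Set Filter ComplexConjugate

variable {f g : ℂ[X]}

/-- An index set for the eight homogeneous coordinates, split into blocks. -/
abbrev CoordIndex : Type := (Fin 2 ⊕ Fin 3) ⊕ Fin 3

/-- The homogeneous coordinates of a vector, in the order
`(V₁, V₂ | U₁, U₂, z₀ | W₁, W₂, z₁)`. -/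
def coordVec : HomCoord →L[ℂ] (CoordIndex → ℂ) :=
  LinearMap.toContinuousLinearMap
    { toFun := fun t => Sum.elim (Sum.elim ![t.1 1, t.2.1 1] ![t.1 0, t.2.1 0, t.2.2 0])
        ![t.1 2, t.2.1 2, t.2.2 1]
      map_add' := fun t t' => by
        ext ((i | i) | i) <;> fin_cases i <;> simp
      map_smul' := fun c t => by
        ext ((i | i) | i) <;> fin_cases i <;> simp }

theorem coordVec_apply (t : HomCoord) : coordVec t =
    Sum.elim (Sum.elim ![t.1 1, t.2.1 1] ![t.1 0, t.2.1 0, t.2.2 0])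
      ![t.1 2, t.2.1 2, t.2.2 1] := rfl

theorem coordVec_injective : Function.Injective coordVec := by
  intro t t' h
  have h1 := congrFun h (.inl (.inl 0))
  have h2 := congrFun h (.inl (.inl 1))
  have h3 := congrFun h (.inl (.inr 0))
  have h4 := congrFun h (.inl (.inr 1))
  have h5 := congrFun h (.inl (.inr 2))
  have h6 := congrFun h (.inr 0)
  have h7 := congrFun h (.inr 1)
  have h8 := congrFun h (.inr 2)
  simp [coordVec_apply] at h1 h2 h3 h4 h5 h6 h7 h8
  refine Prod.ext (funext fun i => ?_) (Prod.ext (funext fun i => ?_) (funext fun i => ?_)) <;>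
    fin_cases i <;> assumption

/-- The determinant of eight vectors of homogeneous coordinates. -/
@[irreducible] def homDet (v : CoordIndex → HomCoord) : ℂ := (Matrix.of fun j => coordVec (v j)).det

theorem homDet_ne_zero_iff {v : CoordIndex → HomCoord} :
    homDet v ≠ 0 ↔ LinearIndependent ℂ v := by
  rw [homDet, ← isUnit_iff_ne_zero, ← Matrix.isUnit_iff_isUnit_det,
    ← Matrix.linearIndependent_rows_iff_isUnit]
  exact LinearMap.linearIndependent_iff_of_injOn (coordVec : HomCoord →ₗ[ℂ] CoordIndex → ℂ)
    coordVec_injective.injOn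

theorem homEqDeriv_euler {w : HomCoord} (h0 : homEq f g w = 0) (i : Fin 3) :
    homEqDeriv f g w (euler w i) = 0 := by
  obtain ⟨e1, e2⟩ := homEq_eq_zero_iff.1 h0
  rw [homEqDeriv_apply]
  ext j
  fin_cases i <;> fin_cases j <;> simp [euler]
  · linear_combination 2 * e1
  · linear_combination 2 * e2

theorem affineDeriv_euler {w : HomCoord} (i : Fin 3) : affineDeriv w (euler w i) = 0 := by
  rw [affineDeriv_apply]
  ext j
  fin_cases i <;> fin_cases j <;> simp [euler, mul_comm]

/-- The functionals `homEqDeriv`, `volumeCoord ∘ affineDeriv` and `dW₁, dW₂, dz₁`. -/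
def functionalVec (f g A B : ℂ[X]) (w t : HomCoord) : CoordIndex → ℂ :=
  Sum.elim (Sum.elim (homEqDeriv f g w t) (volumeCoord A B (affineCoord w) (affineDeriv w t)))
    ![t.1 2, t.2.1 2, t.2.2 1]

/-- The matrix expresses the two differentials, the three volume functionals and dW₁, dW₂, dz₁ in
the coordinate functionals. Its determinant is the Bezout combination multiplied by 1/z₁. -/
theorem exists_functionalMatrix {A B : ℂ[X]} (hAB : IsBezoutPair f g A B) {w : HomCoord}
    (hw : w ∈ finiteCoord) (hx : affineCoord w ∈ conifold f g) :
    ∃ Φ : Matrix CoordIndex CoordIndex ℂ, Φ.det = (w.2.2 1)⁻¹ ∧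
      ∀ t, Matrix.vecMul (coordVec t) Φ = functionalVec f g A B w t := by
  have hE := hAB (zCoord w)
  obtain ⟨e1, e2⟩ := homEq_eq_zero_iff.1 ((homEq_eq_zero_iff_conifold hw).1 hx).1
  obtain ⟨h1, h2, h3⟩ := hw
  obtain ⟨P, Q, z⟩ := w
  simp only [zCoord] at h1 h2 h3 hE e1 e2
  have hz : affineCoord (P, Q, z) 4 = z 0 / z 1 := rfl
  have hx1 : affineCoord (P, Q, z) 1 = P 1 / P 2 := rfl
  have hx3 : affineCoord (P, Q, z) 3 = Q 1 / Q 2 := rfl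
  set F := f.eval (z 0 / z 1) with hF
  set F' := f.derivative.eval (z 0 / z 1) with hF'
  set G := g.eval (z 0 / z 1) with hG
  set G' := g.derivative.eval (z 0 / z 1) with hG'
  set a := A.eval (z 0 / z 1) with ha
  set b := B.eval (z 0 / z 1) with hb
  set D : ℂ := 1 / z 1 with hD
  set D' : ℂ := -(z 0 / z 1 ^ 2) with hD'
  let X : Matrix (Fin 2 ⊕ Fin 3) (Fin 2 ⊕ Fin 3) ℂ := Matrix.fromBlocks
    !![P 0, 0; 0, Q 0]
    !![0, 0, b * (Q 1 / Q 2) / P 2; 0, 0, b * (P 1 / P 2) / Q 2]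
    !![P 1, 0; 0, Q 1; -(P 2 ^ 2 * F' * D), -(Q 2 ^ 2 * G' * D)]
    !![1 / P 2, 0, 0; 0, 1 / Q 2, 0; 0, 0, a * (P 1 / P 2) * (Q 1 / Q 2) * D]
  let Y : Matrix (Fin 3) (Fin 2 ⊕ Fin 3) ℂ := Matrix.fromCols
    !![-(2 * P 2 * F), 0; 0, -(2 * Q 2 * G); -(P 2 ^ 2 * F' * D'), -(Q 2 ^ 2 * G' * D')]
    !![-(P 0 / P 2 ^ 2), 0, -(b * (Q 1 / Q 2) * P 1 / P 2 ^ 2);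
      0, -(Q 0 / Q 2 ^ 2), -(b * (P 1 / P 2) * Q 1 / Q 2 ^ 2);
      0, 0, a * (P 1 / P 2) * (Q 1 / Q 2) * D']
  refine ⟨Matrix.fromBlocks X 0 Y 1, ?_, fun t => ?_⟩
  · rw [Matrix.det_fromBlocks_zero₁₂, Matrix.det_one, mul_one,
      ← Matrix.det_submatrix_equiv_self finSumFinEquiv.symm]
    have hX : X.submatrix finSumFinEquiv.symm finSumFinEquiv.symm =
        !![P 0, 0, 0, 0, b * (Q 1 / Q 2) / P 2;
          0, Q 0, 0, 0, b * (P 1 / P 2) / Q 2;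
          P 1, 0, 1 / P 2, 0, 0;
          0, Q 1, 0, 1 / Q 2, 0;
          -(P 2 ^ 2 * F' * D), -(Q 2 ^ 2 * G' * D), 0, 0, a * (P 1 / P 2) * (Q 1 / Q 2) * D] := by
      ext i j
      fin_cases i <;> fin_cases j <;> rfl
    rw [hX]
    simp [Matrix.det_succ_row_zero, Fin.sum_univ_succ, Fin.succAbove]
    rw [hD]
    field_simp
    linear_combination (a * Q 0 * Q 1 + Q 2 ^ 2 * b * G') * e1 +
      (a * P 2 ^ 2 * F + b * P 2 ^ 2 * F') * e2 + P 2 ^ 2 * Q 2 ^ 2 * hE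
  · ext ((i | i) | i) <;> fin_cases i <;>
      simp [Matrix.vecMul, dotProduct, Fin.sum_univ_succ, coordVec_apply, functionalVec, X, Y,
        homEqDeriv_apply, volumeCoord_apply, affineDeriv_apply, hz, zCoord, Matrix.one_apply]
    all_goals
      try simp only [← hF, ← hF', ← hG, ← hG', ← ha, ← hb, hx1, hx3, hD, hD']
      field_simp
      ring

/-- Contraction of the determinant with the Euler vectors yields the volume form. -/
theorem homDet_eq {A B : ℂ[X]} (hAB : IsBezoutPair f g A B) {w : HomCoord}
    (hw : w ∈ finiteCoord) (hx : affineCoord w ∈ conifold f g) (N : Fin 2 → HomCoord)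
    {t : Fin 3 → HomCoord} (ht : ∀ j, homEqDeriv f g w (t j) = 0) :
    homDet (Sum.elim (Sum.elim N t) (euler w)) =
      w.1 2 * w.2.1 2 * w.2.2 0 * w.2.2 1 * (Matrix.of fun i => homEqDeriv f g w (N i)).det *
        volumeForm A B (affineCoord w) (fun j => affineDeriv w (t j)) := by
  obtain ⟨Φ, hΦ, h⟩ := exists_functionalMatrix hAB hw hx
  obtain ⟨h0, hz0⟩ := (homEq_eq_zero_iff_conifold hw).1 hx
  -- The product is block triangular: tangent vectors are killed by the equations, Euler vectors
  -- also by the volume functionals, and on the latter dW₁, dW₂, dz₁ are diagonal.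
  have hmul : (Matrix.of fun j => coordVec (Sum.elim (Sum.elim N t) (euler w) j)) * Φ =
      Matrix.fromBlocks (Matrix.fromBlocks (Matrix.of fun i => homEqDeriv f g w (N i))
        (Matrix.of fun i => volumeCoord A B (affineCoord w) (affineDeriv w (N i))) 0
        (Matrix.of fun j => volumeCoord A B (affineCoord w) (affineDeriv w (t j))))
        (Matrix.of fun i => ![(Sum.elim N t i).1 2, (Sum.elim N t i).2.1 2, (Sum.elim N t i).2.2 1])
        0 (Matrix.diagonal ![w.1 2, w.2.1 2, w.2.2 1]) := by
    ext i j
    have hij := congrFun (h (Sum.elim (Sum.elim N t) (euler w) i)) j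
    change Matrix.vecMul (coordVec (Sum.elim (Sum.elim N t) (euler w) i)) Φ j = _
    rw [hij]
    rcases i with (i | i) | i <;> rcases j with (j | j) | j <;>
      simp [functionalVec, ht, homEqDeriv_euler h0, affineDeriv_euler]
    fin_cases i <;> fin_cases j <;> simp [euler]
  have hdet := congrArg Matrix.det hmul
  rw [Matrix.det_mul, hΦ, Matrix.det_fromBlocks_zero₂₁, Matrix.det_fromBlocks_zero₂₁,
    Matrix.det_diagonal, Fin.prod_univ_three] at hdet
  have hz : affineCoord w 4 = w.2.2 0 / w.2.2 1 := rfl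
  rw [volumeForm_apply, hz, homDet]
  have h3 := hw.2.2
  simp only [Matrix.cons_val] at hdet
  rw [← div_eq_mul_inv, div_eq_iff h3] at hdet
  rw [hdet]
  field_simp

end Determinant

/-! ### Poles along the complement of the conifold. -/

section Poles

open Set Filter ComplexConjugate

variable {f g : ℂ[X]}

theorem linearIndependent_euler {w : HomCoord} (hw : w ∈ nonzeroCoord) :
    LinearIndependent ℂ (euler w) := by
  rw [Fintype.linearIndependent_iff]
  intro c hc
  obtain ⟨h1, h2, h3⟩ := hw
  simp only [euler, Fin.sum_univ_three, Matrix.cons_val, Prod.smul_mk, Prod.mk_add_mk, smul_zero,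
    add_zero, zero_add, Prod.mk_eq_zero] at hc
  intro i
  fin_cases i
  · exact (smul_eq_zero.1 hc.1).resolve_right h1
  · exact (smul_eq_zero.1 hc.2.1).resolve_right h2
  · exact (smul_eq_zero.1 hc.2.2).resolve_right h3

/-- The vectors N are independent modulo the kernel of the equations, which contains the frame and
the Euler vectors. -/
theorem homDet_ne_zero {w : HomCoord} (h0 : homEq f g w = 0) {N : Fin 2 → HomCoord}
    (hN : (Matrix.of fun i => homEqDeriv f g w (N i)).det ≠ 0) {t : Fin 3 → HomCoord}
    (ht : ∀ j, homEqDeriv f g w (t j) = 0) (hlin : LinearIndependent ℂ (Sum.elim (euler w) t)) :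
    homDet (Sum.elim (Sum.elim N t) (euler w)) ≠ 0 := by
  rw [homDet_ne_zero_iff]
  have h1 : LinearIndependent ℂ fun i => homEqDeriv f g w (N i) := by
    rw [← isUnit_iff_ne_zero, ← Matrix.isUnit_iff_isUnit_det,
      ← Matrix.linearIndependent_rows_iff_isUnit] at hN
    exact hN
  have h2 : LinearIndependent ℂ N :=
    LinearIndependent.of_comp (homEqDeriv f g w : HomCoord →ₗ[ℂ] Fin 2 → ℂ) h1
  have h3 : LinearIndependent ℂ (Sum.elim N (Sum.elim (euler w) t)) := by
    refine h2.sum_type hlin (Submodule.disjoint_def.2 fun x hx hx' => ?_)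
    obtain ⟨c, rfl⟩ := (Submodule.mem_span_range_iff_exists_fun ℂ).1 hx
    have hker : Submodule.span ℂ (range (Sum.elim (euler w) t)) ≤
        LinearMap.ker (homEqDeriv f g w : HomCoord →ₗ[ℂ] Fin 2 → ℂ) := by
      rw [Submodule.span_le]
      rintro _ ⟨i | i, rfl⟩
      · exact homEqDeriv_euler h0 i
      · exact ht i
    have h4 := hker hx'
    rw [LinearMap.mem_ker, map_sum] at h4
    simp only [map_smul] at h4
    have h5 := Fintype.linearIndependent_iff.1 h1 c h4
    simp [h5]
  rw [← linearIndependent_equiv ((Equiv.sumCongr (.refl _) (Equiv.sumComm _ _)).trans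
    (Equiv.sumAssoc _ _ _).symm)]
  convert h3 using 1
  ext1 (i | i | i) <;> rfl

theorem finrank_ker_homEqDeriv {w : HomCoord} (hs : Function.Surjective (homEqDeriv f g w)) :
    Module.finrank ℂ (LinearMap.ker (homEqDeriv f g w : HomCoord →ₗ[ℂ] Fin 2 → ℂ)) = 6 := by
  have h := LinearMap.finrank_range_add_finrank_ker
    (homEqDeriv f g w : HomCoord →ₗ[ℂ] Fin 2 → ℂ)
  rw [LinearMap.range_eq_top.2 hs, finrank_top] at h
  have h8 : Module.finrank ℂ HomCoord = 8 := by simp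
  rw [h8, Module.finrank_fin_fun] at h
  omega

/-- The kernel has dimension 6 and the Euler vectors span 3 of them; a basis of the quotient lifts
to the required vectors. -/
theorem exists_homDet_ne_zero {w : HomCoord} (hw : w ∈ nonzeroCoord)
    (h0 : homEq f g w = 0) (hs : Function.Surjective (homEqDeriv f g w)) {N : Fin 2 → HomCoord}
    (hN : (Matrix.of fun i => homEqDeriv f g w (N i)).det ≠ 0) :
    ∃ t : Fin 3 → HomCoord, (∀ j, homEqDeriv f g w (t j) = 0) ∧
      homDet (Sum.elim (Sum.elim N t) (euler w)) ≠ 0 := by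
  set K := LinearMap.ker (homEqDeriv f g w : HomCoord →ₗ[ℂ] Fin 2 → ℂ) with hK
  let e : Fin 3 → K := fun i => ⟨euler w i, homEqDeriv_euler h0 i⟩
  have he : LinearIndependent ℂ e :=
    LinearIndependent.of_comp K.subtype (linearIndependent_euler hw)
  have hrank : Module.finrank ℂ K = 6 := finrank_ker_homEqDeriv hs
  set S := Submodule.span ℂ (range e)
  have hS : Module.finrank ℂ (K ⧸ S) = 3 := by
    have h1 := Submodule.finrank_quotient_add_finrank S
    rw [finrank_span_eq_card he, hrank, Fintype.card_fin] at h1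
    omega
  let β := Module.finBasisOfFinrankEq ℂ (K ⧸ S) hS
  choose t ht using fun i => Submodule.Quotient.mk_surjective S (β i)
  have h2 : LinearIndependent ℂ fun i => (⟨e i, Submodule.subset_span ⟨i, rfl⟩⟩ : S) :=
    LinearIndependent.of_comp S.subtype he
  have h3 : LinearIndependent ℂ (Submodule.Quotient.mk (p := S) ∘ t) := by
    have : Submodule.Quotient.mk (p := S) ∘ t = β := funext ht
    rw [this]
    exact β.linearIndependent
  have h4 := (h2.sumElim_of_quotient t h3).map' K.subtype (Submodule.ker_subtype K)
  refine ⟨fun j => t j, fun j => (t j).2, homDet_ne_zero h0 hN (fun j => (t j).2) ?_⟩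
  have h5 : K.subtype ∘ Sum.elim (fun i => e i) t = Sum.elim (euler w) fun j => (t j : HomCoord) := by
    ext1 (i | i) <;> rfl
  rwa [h5] at h4

theorem continuous_homDet : Continuous homDet := by
  have h : homDet = fun v => (Matrix.of fun j => coordVec (v j)).det := by
    ext v
    rw [homDet]
  rw [h]
  refine Continuous.matrix_det (continuous_matrix fun i j => ?_)
  exact (continuous_apply j).comp (coordVec.continuous.comp (continuous_apply i))

/-- The determinant of eight vectors as an alternating map. -/
def homDetForm : HomCoord [⋀^CoordIndex]→ₗ[ℂ] ℂ :=
  Matrix.detRowAlternating.compLinearMap (coordVec : HomCoord →ₗ[ℂ] CoordIndex → ℂ)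

theorem compLinearMap_coordVec_apply (D : (CoordIndex → ℂ) [⋀^CoordIndex]→ₗ[ℂ] ℂ)
    (v : CoordIndex → HomCoord) :
    D.compLinearMap (coordVec : HomCoord →ₗ[ℂ] CoordIndex → ℂ) v = D fun j => coordVec (v j) := rfl

theorem homDetForm_apply (v : CoordIndex → HomCoord) : homDetForm v = homDet v := by
  rw [homDetForm, compLinearMap_coordVec_apply, homDet]
  exact Eq.trans (b := Matrix.det fun j => coordVec (v j)) rfl rfl

/-- The contraction of an alternating form with two fixed vectors and three fixed vectors. -/
def contractForm (D : HomCoord [⋀^CoordIndex]→ₗ[ℂ] ℂ) (hD : Continuous D) (N : Fin 2 → HomCoord)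
    (E : Fin 3 → HomCoord) : HomCoord [⋀^Fin 3]→L[ℂ] ℂ where
  toFun t := D (Sum.elim (Sum.elim N t) E)
  map_update_add' t i x x' := by
    simp only [← Sum.update_elim_inr, ← Sum.update_elim_inl]
    exact D.map_update_add _ _ _ _
  map_update_smul' t i c x := by
    simp only [← Sum.update_elim_inr, ← Sum.update_elim_inl]
    exact D.map_update_smul _ _ _ _
  map_eq_zero_of_eq' t i j hij hne :=
    D.map_eq_zero_of_eq (i := .inl (.inr i)) (j := .inl (.inr j)) _ (by simpa) (by simpa)
  cont := by
    refine hD.comp (continuous_pi fun i => ?_)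
    rcases i with (i | i) | i
    · exact continuous_const
    · exact continuous_apply i
    · exact continuous_const

/-- The contraction of the determinant with two fixed vectors and the Euler vectors at `w`. -/
def homForm (N : Fin 2 → HomCoord) (w : HomCoord) : HomCoord [⋀^Fin 3]→L[ℂ] ℂ :=
  contractForm homDetForm (continuous_homDet.congr fun v => (homDetForm_apply v).symm) N (euler w)

theorem homForm_apply (N : Fin 2 → HomCoord) (w : HomCoord) (t : Fin 3 → HomCoord) :
    homForm N w t = homDet (Sum.elim (Sum.elim N t) (euler w)) :=
  homDetForm_apply _

theorem analyticAt_euler (i : Fin 3) (y : HomCoord) : AnalyticAt ℂ (fun w => euler w i) y := by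
  fin_cases i
  · exact _root_.analyticAt_fst.prod analyticAt_const
  · exact analyticAt_const.prod
      ((_root_.analyticAt_fst.comp _root_.analyticAt_snd).prod analyticAt_const)
  · exact analyticAt_const.prod
      (analyticAt_const.prod (_root_.analyticAt_snd.comp _root_.analyticAt_snd))

theorem analyticAt_homForm (N : Fin 2 → HomCoord) (t : Fin 3 → HomCoord) (y : HomCoord) :
    AnalyticAt ℂ (fun w => homForm N w t) y := by
  simp only [homForm_apply, homDet, Matrix.det_apply']
  refine Finset.analyticAt_fun_sum _ fun σ _ => analyticAt_const.mul ?_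
  refine Finset.analyticAt_fun_prod _ fun i _ => ?_
  have h : AnalyticAt ℂ (fun w => Sum.elim (Sum.elim N t) (euler w) (σ i)) y := by
    rcases σ i with j | j
    · exact analyticAt_const
    · exact analyticAt_euler j y
  exact ((ContinuousLinearMap.proj (R := ℂ) (φ := fun _ : CoordIndex => ℂ) i).comp
    coordVec).analyticAt _ |>.comp h

theorem analyticAt_homEqDeriv {y : HomCoord} (hy : y.2.2 1 ≠ 0) (t : HomCoord) (j : Fin 2) :
    AnalyticAt ℂ (fun w => homEqDeriv f g w t j) y := by
  have a := fun i => analyticAt_fst i y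
  have b := fun i => analyticAt_snd i y
  have c := fun i => analyticAt_thd i y
  have h := fun p : ℂ[X] => analyticAt_eval_zCoord p hy
  have hd : AnalyticAt ℂ (fun w => zDeriv w t) y := by
    simp only [zDeriv_apply]
    exact ((analyticAt_const.mul (c 1)).sub ((c 0).mul analyticAt_const)).div ((c 1).pow 2)
      (pow_ne_zero 2 hy)
  have h1 : ∀ p q : HomCoord → ℂ, ∀ s s', AnalyticAt ℂ p y → AnalyticAt ℂ q y →
      AnalyticAt ℂ (fun w => s * q w + p w * s') y := fun p q s s' hp hq =>
    (analyticAt_const.mul hq).add (hp.mul analyticAt_const)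
  simp only [homEqDeriv_apply]
  fin_cases j <;> simp only [Fin.zero_eta, Fin.mk_one, Matrix.cons_val]
  · exact ((h1 _ _ _ _ (a 0) (a 1)).sub (((analyticAt_const.mul (a 2)).mul
      analyticAt_const).mul (h f))).sub ((((a 2).pow 2).mul (h f.derivative)).mul hd)
  · exact ((h1 _ _ _ _ (b 0) (b 1)).sub (((analyticAt_const.mul (b 2)).mul
      analyticAt_const).mul (h g))).sub ((((b 2).pow 2).mul (h g.derivative)).mul hd)

theorem mem_cone_openPart_iff (hfg : IsAdmissible f g) {w : HomCoord} (h1 : w.2.2 1 ≠ 0)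
    (hw : w ∈ cone (compactification f g)) :
    w ∈ cone (openPart f g) ↔ w.1 2 * w.2.1 2 * w.2.2 0 * w.2.2 1 ≠ 0 := by
  have h0 := ((mem_cone_compactification hfg h1).1 hw).2
  rw [mem_cone_openPart]
  constructor
  · rintro ⟨h, hx⟩
    exact mul_ne_zero (mul_ne_zero (mul_ne_zero h.1 h.2.1)
      ((homEq_eq_zero_iff_conifold h).1 hx).2) h1
  · intro h
    simp only [mul_ne_zero_iff] at h
    have hf : w ∈ finiteCoord := ⟨h.1.1.1, h.1.1.2, h.2⟩
    exact ⟨hf, (homEq_eq_zero_iff_conifold hf).2 ⟨h0, h.1.2⟩⟩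

/-- The function W₁W₂z₀z₁ vanishes on the compactification exactly off the conifold, and its product
with Ω is the contracted determinant, divided by the determinant of the equations on the normal
vectors. The latter form extends across the boundary and does not vanish there. -/
theorem IsLogVolumeForm.hasPolesAlongBoundary (hfg : IsAdmissible f g)
    {Ω : (Fin 5 → ℂ) → (Fin 5 → ℂ) [⋀^Fin 3]→L[ℂ] ℂ} (hΩ : IsLogVolumeForm f g Ω) :
    HasPolesAlongBoundary f g Ω := by
  obtain ⟨A, B, hAB⟩ := exists_isBezoutPair hfg
  intro y hy _
  obtain ⟨hy, hy1⟩ := (isSmoothPoint_iff hfg).1 hy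
  obtain ⟨hnz, h0⟩ := (mem_cone_compactification hfg hy1).1 hy
  have hs := homEqDeriv_surjective hfg hnz hy1 h0
  -- The normal vectors are dual to the equations at y and are kept constant near y, so that the
  -- form is holomorphic.
  choose N hN using fun i : Fin 2 => hs (Pi.single i 1)
  have hev : ∀ᶠ w in 𝓝 y, w.2.2 1 ≠ 0 :=
    (analyticAt_thd 1 y).continuousAt.eventually_ne hy1
  let c : HomCoord → ℂ := fun w => (Matrix.of fun i => homEqDeriv f g w (N i)).det
  have hcy : c y ≠ 0 := by
    simp only [c, hN]
    simp [Matrix.det_fin_two]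
  have hc : AnalyticAt ℂ c y := by
    simp only [c, Matrix.det_fin_two, Matrix.of_apply]
    have h := fun i j => analyticAt_homEqDeriv (f := f) (g := g) hy1 (N i) j
    exact ((h 0 0).mul (h 1 1)).sub ((h 0 1).mul (h 1 0))
  refine ⟨fun w => w.1 2 * w.2.1 2 * w.2.2 0 * w.2.2 1, fun w => (c w)⁻¹ • homForm N w,
    (((analyticAt_fst 2 y).mul (analyticAt_snd 2 y)).mul (analyticAt_thd 0 y)).mul
      (analyticAt_thd 1 y), fun t => (hc.inv hcy).mul (analyticAt_homForm N t y), ?_, ?_, ?_⟩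
  · filter_upwards [hev] with w hw1 hw
    rw [mem_cone_openPart_iff hfg hw1 hw, not_not]
  · filter_upwards [hev, hc.continuousAt.eventually_ne hcy] with w hw1 hcw hw t ht
    have hwc := cone_openPart_subset f g hw
    rw [tangentConeAt_compactification hfg hwc hw1] at ht
    obtain ⟨hwf, hx⟩ := mem_cone_openPart.1 hw
    have hw0 := ((homEq_eq_zero_iff_conifold hwf).1 hx).1
    rw [(hasStrictFDerivAt_affineCoord hwf).hasFDerivAt.fderiv,
      hΩ.apply_eq hfg (isLogVolumeForm_volumeForm hfg hAB) hx fun j =>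
        (homEqDeriv_eq_zero_iff hwf hw0).1 (ht j)]
    change _ = (c w)⁻¹ * homForm N w t
    rw [homForm_apply, homDet_eq hAB hwf hx N ht, eq_inv_mul_iff_mul_eq₀ hcw]
    ring
  · obtain ⟨t, ht, hne⟩ := exists_homDet_ne_zero hnz h0 hs hcy
    rw [tangentConeAt_compactification hfg hy hy1]
    refine ⟨t, ht, ?_⟩
    change (c y)⁻¹ * homForm N y t ≠ 0
    rw [homForm_apply]
    exact mul_ne_zero (inv_ne_zero hcy) hne

end Poles

/-! ### Tangent frames of the cones and continuous normal vectors. -/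

section Frames

open Set Filter ComplexConjugate

variable {f g : ℂ[X]}

/-- Affine coordinates are a submersion, so the cone of a regular fibre is again a regular level
set. -/
theorem tangentConeAt_cone_fiber (hfg : IsAdmissible f g) {b : Base} (hb : b ∈ regularValues f g)
    {w : HomCoord} (hw : w ∈ cone (fiber f g b)) :
    tangentConeAt ℝ (cone (fiber f g b)) w =
      {t | affineDeriv w t ∈ fiberTangent f g (affineCoord w)} := by
  obtain ⟨hwo, rfl⟩ := (mem_cone_fiber_iff_of_regular hfg hb).1 hw
  obtain ⟨hwf, hx⟩ := mem_cone_openPart.1 hwo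
  have hn := isNondegenerate_of_regular hfg hx hb
  set x := affineCoord w with hxw
  have ha := hasStrictFDerivAt_affineCoord hwf
  have h1 : HasStrictFDerivAt (fun x' => (conifoldEq f g x', momentMap x' - momentMap x))
      (((conifoldEqDeriv f g x).restrictScalars ℝ).prod (momentDeriv x)) (affineCoord w) :=
    ((hasStrictFDerivAt_conifoldEq f g x).restrictScalars ℝ).prodMk
      ((hasStrictFDerivAt_momentMap x).sub_const _)
  have h2 := h1.comp w (ha.restrictScalars ℝ)
  rw [tangentConeAt_eq_ker h2 (by simp [← hxw, (mem_conifold_iff.1 hx).1]) ?_ ?_]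
  · ext t
    simp [mem_fiberTangent, Prod.ext_iff]
  · rintro ⟨p, η⟩
    obtain ⟨t, ht⟩ := exists_solve_fiber (f := f) (g := g) hn (mem_conifold_iff.1 hx).2 p η
    obtain ⟨τ, rfl⟩ := affineDeriv_surjective hwf t
    exact ⟨τ, Prod.ext ht.1 ht.2⟩
  · filter_upwards [isOpen_finiteCoord.mem_nhds hwf,
      ha.continuousAt.eventually (eventually_mem_conifold hx)] with w' hw' hw''
    rw [mem_cone_fiber_iff_of_regular hfg hb, mem_cone_openPart, fibration_eq_iff]
    simp [hw', hw'', sub_eq_zero]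

theorem volumeForm_sum (A B : ℂ[X]) (x : Fin 5 → ℂ) (a : Matrix (Fin 3) (Fin 3) ℂ)
    (t : Fin 3 → Fin 5 → ℂ) :
    volumeForm A B x (fun j => ∑ i, a i j • t i) = a.det * volumeForm A B x t := by
  have h : (Matrix.of fun j => volumeCoord A B x (∑ i, a i j • t i)) =
      a.transpose * Matrix.of fun j => volumeCoord A B x (t j) := by
    ext j k
    rw [Matrix.of_apply, map_sum, Finset.sum_apply, Matrix.mul_apply]
    simp
  rw [volumeForm_apply, volumeForm_apply, h, Matrix.det_mul, Matrix.det_transpose]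
  ring

/-- A frame together with the Euler vectors spans the tangent space of the cone. -/
theorem exists_eq_sum {w : HomCoord} (h0 : homEq f g w = 0)
    (hs : Function.Surjective (homEqDeriv f g w)) {e : Fin 3 → HomCoord}
    (he : ∀ i, homEqDeriv f g w (e i) = 0) (hlin : LinearIndependent ℂ (Sum.elim (euler w) e))
    {t : HomCoord} (ht : homEqDeriv f g w t = 0) :
    ∃ c a : Fin 3 → ℂ, t = ∑ i, c i • euler w i + ∑ i, a i • e i := by
  set K := LinearMap.ker (homEqDeriv f g w : HomCoord →ₗ[ℂ] Fin 2 → ℂ) with hK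
  have hrank : Module.finrank ℂ K = 6 := finrank_ker_homEqDeriv hs
  let v : Fin 3 ⊕ Fin 3 → K := Sum.elim (fun i => ⟨euler w i, homEqDeriv_euler h0 i⟩)
    fun i => ⟨e i, he i⟩
  have hv : K.subtype ∘ v = Sum.elim (euler w) e := by
    ext1 (i | i) <;> rfl
  have hv' : LinearIndependent ℂ v := LinearIndependent.of_comp K.subtype (by rwa [hv])
  have hspan := hv'.span_eq_top_of_card_eq_finrank' (by simp [hrank])
  have hmem : (⟨t, ht⟩ : K) ∈ Submodule.span ℂ (range v) := hspan ▸ Submodule.mem_top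
  obtain ⟨c, hc⟩ := (Submodule.mem_span_range_iff_exists_fun ℂ).1 hmem
  refine ⟨fun i => c (.inl i), fun i => c (.inr i), ?_⟩
  have := congrArg K.subtype hc
  simpa [v] using this.symm

/-- The vector with given homogeneous coordinates. -/
def vecCoord (a : CoordIndex → ℂ) : HomCoord :=
  (![a (.inl (.inr 0)), a (.inl (.inl 0)), a (.inr 0)],
    ![a (.inl (.inr 1)), a (.inl (.inl 1)), a (.inr 1)], ![a (.inl (.inr 2)), a (.inr 2)])

theorem coordVec_vecCoord (a : CoordIndex → ℂ) : coordVec (vecCoord a) = a := by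
  ext ((i | i) | i) <;> fin_cases i <;> rfl

theorem continuous_vecCoord : Continuous vecCoord := by
  have h : ∀ i : CoordIndex, Continuous fun a : CoordIndex → ℂ => a i := continuous_apply
  refine Continuous.prodMk (continuous_pi fun i => ?_) (Continuous.prodMk
    (continuous_pi fun i => ?_) (continuous_pi fun i => ?_)) <;> fin_cases i <;> exact h _

theorem eq_sum_vecCoord (t : HomCoord) :
    t = ∑ c, coordVec t c • vecCoord (Pi.single c 1) := by
  apply coordVec_injective
  rw [map_sum]
  simp only [map_smul, coordVec_vecCoord]
  ext d
  simp [Finset.sum_apply, Pi.single_apply]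

/-- The matrix of `homEqDeriv`. -/
def gradientMatrix (f g : ℂ[X]) (w : HomCoord) : Matrix (Fin 2) CoordIndex ℂ :=
  Matrix.of fun i c => homEqDeriv f g w (vecCoord (Pi.single c 1)) i

theorem homEqDeriv_eq_sum (w t : HomCoord) (i : Fin 2) :
    homEqDeriv f g w t i = ∑ c, coordVec t c * gradientMatrix f g w i c := by
  conv_lhs => rw [eq_sum_vecCoord t]
  rw [map_sum, Finset.sum_apply]
  simp [gradientMatrix]

/-- The complex conjugate gradients of the two equations. -/
def conjGradient (f g : ℂ[X]) (w : HomCoord) (i : Fin 2) : HomCoord :=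
  vecCoord fun c => conj (gradientMatrix f g w i c)

-- Up to transposition this is the Gram matrix of the two independent gradients, hence positive
-- definite. Conjugate gradients give normal vectors that are defined continuously along an entire
-- disc, where locally constant choices would not suffice.
open scoped ComplexOrder in
theorem det_conjGradient_ne_zero {w : HomCoord} (hs : Function.Surjective (homEqDeriv f g w)) :
    (Matrix.of fun i => homEqDeriv f g w (conjGradient f g w i)).det ≠ 0 := by
  have h1 : (Matrix.of fun i => homEqDeriv f g w (conjGradient f g w i)) =
      (gradientMatrix f g w * (gradientMatrix f g w).conjTranspose).transpose := by
    ext i j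
    rw [Matrix.of_apply, homEqDeriv_eq_sum, Matrix.transpose_apply, Matrix.mul_apply]
    refine Finset.sum_congr rfl fun c _ => ?_
    rw [conjGradient, coordVec_vecCoord, mul_comm]
    rfl
  have h2 : Function.Injective (gradientMatrix f g w).vecMul := by
    change Function.Injective (Matrix.vecMulLinear (gradientMatrix f g w))
    rw [injective_iff_map_eq_zero (Matrix.vecMulLinear (gradientMatrix f g w))]
    intro v hv
    have h3 : ∀ t, ∑ i, v i * homEqDeriv f g w t i = 0 := by
      intro t
      simp only [homEqDeriv_eq_sum, Finset.mul_sum]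
      rw [Finset.sum_comm]
      refine Finset.sum_eq_zero fun c _ => ?_
      have h4 : ∑ i, v i * gradientMatrix f g w i c = 0 := congrFun hv c
      rw [← mul_zero (coordVec t c), ← h4, Finset.mul_sum]
      exact Finset.sum_congr rfl fun i _ => by ring
    ext i
    obtain ⟨t, ht⟩ := hs (Pi.single i 1)
    have := h3 t
    rw [ht] at this
    simpa [Pi.single_apply] using this
  rw [h1, Matrix.det_transpose]
  exact (Matrix.PosDef.mul_conjTranspose_self _ h2).isUnit.map Matrix.detMonoidHom |>.ne_zero

theorem continuousAt_conjGradient {y : HomCoord} (hy : y.2.2 1 ≠ 0) (i : Fin 2) :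
    ContinuousAt (fun w => conjGradient f g w i) y := by
  refine continuous_vecCoord.continuousAt.comp (continuousAt_pi.2 fun c => ?_)
  exact Complex.continuous_conj.continuousAt.comp (analyticAt_homEqDeriv hy _ i).continuousAt

end Frames

/-! ### Maslov index zero and avoidance of the boundary divisor. -/

section MaslovIndex

open Set Filter ComplexConjugate Metric

variable {f g : ℂ[X]}

/-- The defining function of the complement of the conifold in homogeneous coordinates. -/
def boundaryFun (w : HomCoord) : ℂ := w.1 2 * w.2.1 2 * w.2.2 0 * w.2.2 1

theorem differentiable_boundaryFun : Differentiable ℂ boundaryFun := fun y =>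
  ((((analyticAt_fst 2 y).mul (analyticAt_snd 2 y)).mul (analyticAt_thd 0 y)).mul
    (analyticAt_thd 1 y)).differentiableAt

/-- The value of the contracted determinant on a frame; it is continuous and does not vanish on
the smooth part of the compactification. -/
def frameDet (f g : ℂ[X]) (w : HomCoord) (e : Fin 3 → HomCoord) : ℂ :=
  homDet (Sum.elim (Sum.elim (conjGradient f g w) e) (euler w)) /
    (Matrix.of fun i => homEqDeriv f g w (conjGradient f g w i)).det

theorem frameDet_ne_zero {w : HomCoord} (h0 : homEq f g w = 0)
    (hs : Function.Surjective (homEqDeriv f g w)) {e : Fin 3 → HomCoord}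
    (he : ∀ i, homEqDeriv f g w (e i) = 0) (hlin : LinearIndependent ℂ (Sum.elim (euler w) e)) :
    frameDet f g w e ≠ 0 :=
  div_ne_zero (homDet_ne_zero h0 (det_conjGradient_ne_zero hs) he hlin)
    (det_conjGradient_ne_zero hs)

theorem frameDet_eq {A B : ℂ[X]} (hAB : IsBezoutPair f g A B) {w : HomCoord}
    (hw : w ∈ cone (openPart f g)) (hs : Function.Surjective (homEqDeriv f g w))
    {e : Fin 3 → HomCoord} (he : ∀ i, homEqDeriv f g w (e i) = 0) :
    frameDet f g w e =
      boundaryFun w * volumeForm A B (affineCoord w) (fun j => affineDeriv w (e j)) := by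
  obtain ⟨hwf, hx⟩ := mem_cone_openPart.1 hw
  rw [frameDet, homDet_eq hAB hwf hx _ he, div_eq_iff (det_conjGradient_ne_zero hs), boundaryFun]
  ring

theorem continuousOn_frameDet {u : ℂ → HomCoord} {e : Fin 3 → ℂ → HomCoord} {S : Set ℂ}
    (hu : ContinuousOn u S) (he : ∀ i, ContinuousOn (e i) S) (h1 : ∀ ζ ∈ S, (u ζ).2.2 1 ≠ 0)
    (hs : ∀ ζ ∈ S, Function.Surjective (homEqDeriv f g (u ζ))) :
    ContinuousOn (fun ζ => frameDet f g (u ζ) fun i => e i ζ) S := by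
  intro ζ hζ
  have hN := fun i => (continuousAt_conjGradient (f := f) (g := g) (h1 ζ hζ) i).comp_continuousWithinAt
    (hu ζ hζ)
  have hE := fun i => (analyticAt_euler i (u ζ)).continuousAt.comp_continuousWithinAt (hu ζ hζ)
  simp only [frameDet]
  refine ContinuousWithinAt.div ?_ ?_ (det_conjGradient_ne_zero (hs ζ hζ))
  · have h : ContinuousWithinAt (fun ζ => (Sum.elim (Sum.elim (conjGradient f g (u ζ)) fun i => e i ζ)
        (euler (u ζ)) : CoordIndex → HomCoord)) S ζ := by
      refine continuousWithinAt_pi.2 fun i => ?_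
      rcases i with (i | i) | i
      · exact hN i
      · exact he i ζ hζ
      · exact hE i
    exact continuous_homDet.continuousAt.tendsto.comp h
  · have hD : ∀ i j, ContinuousWithinAt
        (fun ζ => homEqDeriv f g (u ζ) (conjGradient f g (u ζ) i) j) S ζ := by
      intro i j
      simp only [homEqDeriv_eq_sum]
      refine tendsto_finsetSum _ fun c _ => ContinuousWithinAt.mul ?_ ?_
      · exact ((continuous_apply c).comp coordVec.continuous).continuousAt.comp_continuousWithinAt
          (hN i)
      · exact (analyticAt_homEqDeriv (h1 ζ hζ) _ j).continuousAt.comp_continuousWithinAt (hu ζ hζ)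
    simp only [Matrix.det_fin_two, Matrix.of_apply]
    exact ((hD 0 0).mul (hD 1 1)).sub ((hD 0 1).mul (hD 1 0))

/-- Along a regular fibre there is a real frame whose coordinates in a complex frame have a
determinant that is controlled by the volume form. -/
theorem exists_frame_coordinates (hfg : IsAdmissible f g) {b : Base} (hb : b ∈ regularValues f g)
    {w : HomCoord} (hw : w ∈ cone (fiber f g b)) {e : Fin 3 → HomCoord}
    (he : ∀ i, homEqDeriv f g w (e i) = 0) (hlin : LinearIndependent ℂ (Sum.elim (euler w) e)) :
    ∃ a : Matrix (Fin 3) (Fin 3) ℂ,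
      (∀ j, ∑ i, a i j • e i ∈ tangentConeAt ℝ (cone (fiber f g b)) w) ∧
      a.det * frameDet f g w e = -Complex.I * boundaryFun w := by
  obtain ⟨A, B, hAB⟩ := exists_isBezoutPair hfg
  rw [tangentConeAt_cone_fiber hfg hb hw]
  obtain ⟨hwo, rfl⟩ := (mem_cone_fiber_iff_of_regular hfg hb).1 hw
  obtain ⟨hwf, hx⟩ := mem_cone_openPart.1 hwo
  have hn := isNondegenerate_of_regular hfg hx hb
  have h0 := ((homEq_eq_zero_iff_conifold hwf).1 hx).1
  have hs := homEqDeriv_surjective hfg (finiteCoord_subset hwf) hwf.2.2 h0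
  -- A fibre frame of volume -i is expanded in the given complex frame modulo Euler vectors, which
  -- affine coordinates do not see.
  obtain ⟨t, ht1, ht2, ht3⟩ := exists_fiber_frame hAB hx hn
  choose τ hτ using fun j => affineDeriv_surjective hwf (t j)
  have hτ0 : ∀ j, homEqDeriv f g w (τ j) = 0 := fun j => by
    rw [homEqDeriv_eq_zero_iff hwf h0, hτ, ht1]
  choose c a ha using fun j => exists_eq_sum h0 hs he hlin (hτ0 j)
  have hsum : ∀ j, ∑ i, a j i • affineDeriv w (e i) = t j := by
    intro j
    rw [← hτ j, ha j, map_add, map_sum, map_sum]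
    simp only [map_smul, affineDeriv_euler, smul_zero, Finset.sum_const_zero, zero_add]
  refine ⟨Matrix.of fun i j => a j i, fun j => ?_, ?_⟩
  · rw [mem_ofPred_eq, map_sum]
    simp only [map_smul, Matrix.of_apply]
    rw [hsum]
    exact mem_fiberTangent.2 ⟨ht1 j, ht2 j⟩
  · have h := volumeForm_sum A B (affineCoord w) (Matrix.of fun i j => a j i)
      fun i => affineDeriv w (e i)
    simp only [Matrix.of_apply, hsum] at h
    rw [ht3] at h
    rw [frameDet_eq hAB hwo hs he, h]
    ring

/-- Squaring gives D²q² = -s², so s² has argument φ + 2L + π; half of it is an argument of s up to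
sign. -/
theorem sq_eq_of_mul_eq {D q s : ℂ} {φ L : ℝ} (h : D * q = -Complex.I * s)
    (hD : D ^ 2 = (‖D‖ : ℂ) ^ 2 * Complex.exp (φ * Complex.I))
    (hq : q = ‖q‖ * Complex.exp (L * Complex.I)) :
    s ^ 2 = (‖s‖ * Complex.exp (((φ + 2 * L + Real.pi) / 2 : ℝ) * Complex.I)) ^ 2 := by
  have h1 : ‖D‖ * ‖q‖ = ‖s‖ := by
    have := congrArg norm h
    simpa using this
  have h2 : Complex.exp (((φ + 2 * L + Real.pi) / 2 : ℝ) * Complex.I) ^ 2 =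
      -(Complex.exp (φ * Complex.I) * Complex.exp (L * Complex.I) ^ 2) := by
    rw [← Complex.exp_nat_mul, ← Complex.exp_nat_mul, ← Complex.exp_add, ← mul_neg_one,
      ← Complex.exp_pi_mul_I, ← Complex.exp_add]
    congr 1
    push_cast
    ring
  have h3 : D ^ 2 * q ^ 2 = - s ^ 2 := by
    rw [← mul_pow, h, mul_pow, neg_sq, Complex.I_sq]; ring
  rw [mul_pow, h2, ← h1]
  push_cast
  rw [hD] at h3
  have h4 : q ^ 2 = (‖q‖ : ℂ) ^ 2 * Complex.exp (L * Complex.I) ^ 2 := by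
    conv_lhs => rw [hq, mul_pow]
  rw [h4] at h3
  linear_combination h3

/-- On a connected line a continuous square root has constant sign, and the sign is absorbed by
adding π to the argument. -/
theorem exists_arg_of_sq_eq {s : ℝ → ℂ} (hs : Continuous s) (hs0 : ∀ θ, s θ ≠ 0) {ψ : ℝ → ℝ}
    (hψ : Continuous ψ) (h : ∀ θ, s θ ^ 2 = (‖s θ‖ * Complex.exp (ψ θ * Complex.I)) ^ 2) :
    ∃ c : ℝ, ∀ θ, s θ = ‖s θ‖ * Complex.exp ((ψ θ + c : ℝ) * Complex.I) := by
  have hG : Continuous fun θ => (‖s θ‖ : ℂ) * Complex.exp (ψ θ * Complex.I) := by fun_prop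
  rcases isPreconnected_univ.eq_or_eq_neg_of_sq_eq hs.continuousOn hG.continuousOn
    (fun θ _ => h θ) (fun {θ} _ => mul_ne_zero (by simpa using hs0 θ) (Complex.exp_ne_zero _))
    with h1 | h1
  · exact ⟨0, fun θ => by simpa using h1 (mem_univ θ)⟩
  · refine ⟨Real.pi, fun θ => ?_⟩
    rw [Complex.ofReal_add, add_mul, Complex.exp_add, Complex.exp_pi_mul_I, mul_neg_one, mul_neg]
    exact h1 (mem_univ θ)

theorem IsHolomorphicDisc.homEq_eq_zero (hfg : IsAdmissible f g) {b : Base} {u : ℂ → HomCoord}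
    (hu : IsHolomorphicDisc f g b u) {ζ : ℂ} (hζ : ζ ∈ closedBall (0 : ℂ) 1) :
    (u ζ).2.2 1 ≠ 0 ∧ u ζ ∈ cone (compactification f g) ∧ homEq f g (u ζ) = 0 ∧
      Function.Surjective (homEqDeriv f g (u ζ)) := by
  obtain ⟨h1, h2⟩ := (isSmoothPoint_iff hfg).1 (hu.smooth ζ hζ)
  obtain ⟨h3, h4⟩ := (mem_cone_compactification hfg h2).1 h1
  exact ⟨h2, h1, h4, homEqDeriv_surjective hfg h3 h2 h4⟩

/-- A disc of Maslov index zero with boundary on a regular fibre stays in the conifold. -/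
theorem mem_openPart_of_maslovIndex_zero (hfg : IsAdmissible f g) {b : Base}
    (hb : b ∈ regularValues f g) {u : ℂ → HomCoord} (hu : IsHolomorphicDisc f g b u)
    (hm : HasMaslovIndex f g b u 0) : ∀ ζ ∈ closedBall (0 : ℂ) 1, u ζ ∈ cone (openPart f g) := by
  obtain ⟨e, hec, he, φ, hφ, hφ0, hφa⟩ := hm
  have hcl : closure (ball (0 : ℂ) 1) = closedBall 0 1 := closure_ball _ one_ne_zero
  have huc : ContinuousOn u (closedBall 0 1) := hcl ▸ hu.diffContOnCl.continuousOn
  have hu' := fun ζ hζ => hu.homEq_eq_zero hfg (ζ := ζ) hζ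
  have he0 : ∀ ζ ∈ closedBall (0 : ℂ) 1, ∀ i, homEqDeriv f g (u ζ) (e i ζ) = 0 := by
    intro ζ hζ i
    have := (he ζ hζ).1 i
    rwa [tangentConeAt_compactification hfg (hu' ζ hζ).2.1 (hu' ζ hζ).1] at this
  have hq := continuousOn_frameDet (f := f) (g := g) huc hec (fun ζ hζ => (hu' ζ hζ).1)
    fun ζ hζ => (hu' ζ hζ).2.2.2
  -- The frame determinant is non-zero on the whole disc, so its argument is single-valued and
  -- restricts to a periodic function on the circle.
  obtain ⟨L, hL, hqL⟩ := exists_continuousOn_arg hq fun ζ hζ =>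
    frameDet_ne_zero (hu' ζ hζ).2.2.1 (hu' ζ hζ).2.2.2 (he0 ζ hζ) (he ζ hζ).2
  have hS := differentiable_boundaryFun.comp_diffContOnCl hu.diffContOnCl
  have hsph : ∀ θ : ℝ, Complex.exp (θ * Complex.I) ∈ sphere (0 : ℂ) 1 := fun θ => by
    simp [Complex.norm_exp_ofReal_mul_I]
  have hcb : ∀ θ : ℝ, Complex.exp (θ * Complex.I) ∈ closedBall (0 : ℂ) 1 := fun θ =>
    sphere_subset_closedBall (hsph θ)
  have hexp : Continuous fun θ : ℝ => Complex.exp (θ * Complex.I) := by fun_prop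
  have hS0 : ∀ ζ ∈ sphere (0 : ℂ) 1, boundaryFun (u ζ) ≠ 0 := by
    intro ζ hζ
    have h := hu' ζ (sphere_subset_closedBall hζ)
    exact (mem_cone_openPart_iff hfg h.1 h.2.1).1
      ((mem_cone_fiber_iff_of_regular hfg hb).1 (hu.boundary ζ hζ)).1
  have hLc : Continuous fun θ : ℝ => L (Complex.exp (θ * Complex.I)) :=
    hL.comp_continuous hexp hcb
  have hSc : Continuous fun θ : ℝ => boundaryFun (u (Complex.exp (θ * Complex.I))) :=
    (hcl ▸ hS.continuousOn : ContinuousOn (boundaryFun ∘ u) (closedBall 0 1)).comp_continuous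
      hexp hcb
  let ψ : ℝ → ℝ := fun θ => (φ θ + 2 * L (Complex.exp (θ * Complex.I)) + Real.pi) / 2
  have hψ : Continuous ψ := ((hφ.add (hLc.const_mul 2)).add continuous_const).div_const 2
  obtain ⟨c, hc⟩ := exists_arg_of_sq_eq hSc (fun θ => hS0 _ (hsph θ)) hψ fun θ => by
    obtain ⟨a, ha, hdet⟩ := exists_frame_coordinates hfg hb (hu.boundary _ (hsph θ))
      (he0 _ (hcb θ)) (he _ (hcb θ)).2
    exact sq_eq_of_mul_eq hdet (hφa θ a ha) (hqL _ (hcb θ))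
  -- Index zero makes φ agree at 0 and 2π; with L single-valued, the argument of the boundary
  -- function agrees there as well.
  have hne := ne_zero_of_periodic_arg hS (ψ := fun θ => ψ θ + c) (hψ.add continuous_const) (by
    have : Complex.exp ((2 * Real.pi : ℝ) * Complex.I) = Complex.exp ((0 : ℝ) * Complex.I) := by
      push_cast
      rw [Complex.exp_two_pi_mul_I]; simp
    simp only [ψ, this, hφ0]
    simp) hS0 fun θ _ => hc θ
  intro ζ hζ
  exact (mem_cone_openPart_iff hfg (hu' ζ hζ).1 (hu' ζ hζ).2.1).2 (hne ζ hζ)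

end MaslovIndex

/-! ### Discs that stay in the conifold and away from the roots. -/

section ConstantDiscs

open Set Filter ComplexConjugate Metric

variable {f g : ℂ[X]}

/-- Equal products and equal moments give (|u|² - |u'|²)(|u'|² + |v|²) = 0, and the second factor is
positive. -/
theorem norm_eq_of_moment_eq {u v u' v' : ℂ} (h : u * v = u' * v') (hne : u * v ≠ 0)
    (hm : ‖u‖ ^ 2 - ‖v‖ ^ 2 = ‖u'‖ ^ 2 - ‖v'‖ ^ 2) : ‖u‖ = ‖u'‖ := by
  have hu : 0 < ‖u‖ := norm_pos_iff.2 (left_ne_zero_of_mul hne)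
  have hu' : 0 < ‖u'‖ := norm_pos_iff.2 (left_ne_zero_of_mul (h ▸ hne))
  have h1 : ‖u‖ * ‖v‖ = ‖u'‖ * ‖v'‖ := by rw [← norm_mul, h, norm_mul]
  have h2 : ‖u‖ ^ 2 * ‖v‖ ^ 2 = ‖u'‖ ^ 2 * ‖v'‖ ^ 2 := by rw [← mul_pow, h1, mul_pow]
  have h3 : (‖u‖ ^ 2 - ‖u'‖ ^ 2) * (‖u'‖ ^ 2 + ‖v‖ ^ 2) = 0 := by
    linear_combination h2 + ‖u'‖ ^ 2 * hm
  have h4 : ‖u'‖ ^ 2 + ‖v‖ ^ 2 ≠ 0 := by positivity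
  have h5 := (mul_eq_zero.1 h3).resolve_right h4
  exact (sq_eq_sq₀ hu.le hu'.le).1 (sub_eq_zero.1 h5)

theorem diffContOnCl_div {p q : ℂ → ℂ} (hp : DiffContOnCl ℂ p (ball 0 1))
    (hq : DiffContOnCl ℂ q (ball 0 1)) (h0 : ∀ ζ ∈ closedBall (0 : ℂ) 1, q ζ ≠ 0) :
    DiffContOnCl ℂ (fun ζ => p ζ / q ζ) (ball 0 1) := by
  have hcl : closure (ball (0 : ℂ) 1) = closedBall 0 1 := closure_ball _ one_ne_zero
  simp_rw [div_eq_mul_inv]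
  exact hp.smul (hq.inv (hcl ▸ h0))

theorem diffContOnCl_affineCoord {u : ℂ → HomCoord} (hu : DiffContOnCl ℂ u (ball 0 1))
    (hf : ∀ ζ ∈ closedBall (0 : ℂ) 1, u ζ ∈ finiteCoord) (i : Fin 5) :
    DiffContOnCl ℂ (fun ζ => affineCoord (u ζ) i) (ball 0 1) := by
  have h1 : ∀ i, DiffContOnCl ℂ (fun ζ => (u ζ).1 i) (ball 0 1) := fun i =>
    Differentiable.comp_diffContOnCl (f := fun y : HomCoord => y.1 i)
      (fun y => (analyticAt_fst i y).differentiableAt) hu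
  have h2 : ∀ i, DiffContOnCl ℂ (fun ζ => (u ζ).2.1 i) (ball 0 1) := fun i =>
    Differentiable.comp_diffContOnCl (f := fun y : HomCoord => y.2.1 i)
      (fun y => (analyticAt_snd i y).differentiableAt) hu
  have h3 : ∀ i, DiffContOnCl ℂ (fun ζ => (u ζ).2.2 i) (ball 0 1) := fun i =>
    Differentiable.comp_diffContOnCl (f := fun y : HomCoord => y.2.2 i)
      (fun y => (analyticAt_thd i y).differentiableAt) hu
  fin_cases i
  · exact diffContOnCl_div (h1 0) (h1 2) fun ζ hζ => (hf ζ hζ).1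
  · exact diffContOnCl_div (h1 1) (h1 2) fun ζ hζ => (hf ζ hζ).1
  · exact diffContOnCl_div (h2 0) (h2 2) fun ζ hζ => (hf ζ hζ).2.1
  · exact diffContOnCl_div (h2 1) (h2 2) fun ζ hζ => (hf ζ hζ).2.1
  · exact diffContOnCl_div (h3 0) (h3 1) fun ζ hζ => (hf ζ hζ).2.2

/-- Two holomorphic functions whose product is a non-zero constant and whose moment map is
constant on the circle are constant. -/
theorem eq_const_of_mul_eq_const {p q : ℂ → ℂ} (hp : DiffContOnCl ℂ p (ball 0 1)) {c : ℂ}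
    (hc : c ≠ 0) (h : ∀ ζ ∈ closedBall (0 : ℂ) 1, p ζ * q ζ = c) {m : ℝ}
    (hm : ∀ ζ ∈ sphere (0 : ℂ) 1, ‖p ζ‖ ^ 2 - ‖q ζ‖ ^ 2 = m) :
    ∀ ζ ∈ closedBall (0 : ℂ) 1, p ζ = p 0 ∧ q ζ = q 0 := by
  have h0 : ∀ ζ ∈ closedBall (0 : ℂ) 1, p ζ ≠ 0 := fun ζ hζ =>
    left_ne_zero_of_mul (by rw [h ζ hζ]; exact hc)
  have h1 : (1 : ℂ) ∈ sphere (0 : ℂ) 1 := by simp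
  have h2 := eq_const_of_norm_eq_const hp h0 (c := ‖p 1‖) fun ζ hζ => by
    have e1 := h ζ (sphere_subset_closedBall hζ)
    have e2 := h 1 (sphere_subset_closedBall h1)
    exact norm_eq_of_moment_eq (e1.trans e2.symm) (by rwa [e1]) ((hm ζ hζ).trans (hm 1 h1).symm)
  intro ζ hζ
  refine ⟨h2 ζ hζ, ?_⟩
  have e1 := h ζ hζ
  have e2 := h 0 (by simp)
  rw [h2 ζ hζ, ← e2] at e1
  exact mul_left_cancel₀ (h0 0 (by simp)) e1

/-- A disc in the conifold on which neither `f` nor `g` vanishes is constant. -/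
theorem isConstantDisc_of_forall_mem_openPart (hfg : IsAdmissible f g) {b : Base}
    (hb : b ∈ regularValues f g) {u : ℂ → HomCoord} (hu : IsHolomorphicDisc f g b u)
    (ho : ∀ ζ ∈ closedBall (0 : ℂ) 1, u ζ ∈ cone (openPart f g))
    (hne : ∀ z, f.eval z = 0 ∨ g.eval z = 0 → b.2.2 ≠ ‖z‖ₑ) : IsConstantDisc u := by
  have ho' := fun ζ hζ => mem_cone_openPart.1 (ho ζ hζ)
  have hd := diffContOnCl_affineCoord hu.diffContOnCl fun ζ hζ => (ho' ζ hζ).1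
  have h1 : (1 : ℂ) ∈ sphere (0 : ℂ) 1 := by simp
  have hfib : ∀ ζ ∈ sphere (0 : ℂ) 1, fibration (affineCoord (u ζ)) = b := fun ζ hζ =>
    ((mem_cone_fiber_iff_of_regular hfg hb).1 (hu.boundary ζ hζ)).2
  have hmom : ∀ ζ ∈ sphere (0 : ℂ) 1,
      momentMap (affineCoord (u ζ)) = momentMap (affineCoord (u 1)) := fun ζ hζ =>
    fibration_eq_iff.1 ((hfib ζ hζ).trans (hfib 1 h1).symm)
  -- In the conifold z has no zero, and the fibre fixes its modulus on the circle.
  have hz := eq_const_of_norm_eq_const (hd 4) (fun ζ hζ => (ho' ζ hζ).2.2.2)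
    (c := ‖affineCoord (u 1) 4‖) fun ζ hζ => by
      have := congrFun (hmom ζ hζ) 2
      exact (sq_eq_sq₀ (norm_nonneg _) (norm_nonneg _)).1 this
  set z := affineCoord (u 0) 4 with hz0
  have hbz : b.2.2 = ‖z‖ₑ := by
    rw [← hz 1 (sphere_subset_closedBall h1), ← hfib 1 h1]
    rfl
  have hfz : f.eval z ≠ 0 := fun h => hne z (Or.inl h) hbz
  have hgz : g.eval z ≠ 0 := fun h => hne z (Or.inr h) hbz
  have c1 := eq_const_of_mul_eq_const (hd 0) hfz (q := fun ζ => affineCoord (u ζ) 1)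
    (fun ζ hζ => by rw [← hz ζ hζ]; exact (ho' ζ hζ).2.1)
    (m := 2 * momentMap (affineCoord (u 1)) 0) fun ζ hζ => by
      rw [← hmom ζ hζ]
      simp [momentMap]
  have c2 := eq_const_of_mul_eq_const (hd 2) hgz (q := fun ζ => affineCoord (u ζ) 3)
    (fun ζ hζ => by rw [← hz ζ hζ]; exact (ho' ζ hζ).2.2.1)
    (m := 2 * momentMap (affineCoord (u 1)) 1) fun ζ hζ => by
      rw [← hmom ζ hζ]
      simp [momentMap]
  refine ⟨embed (affineCoord (u 0)), fun ζ hζ => ?_⟩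
  have hx : affineCoord (u ζ) = affineCoord (u 0) := by
    ext i
    fin_cases i
    · exact (c1 ζ hζ).1
    · exact (c1 ζ hζ).2
    · exact (c2 ζ hζ).1
    · exact (c2 ζ hζ).2
    · exact hz ζ hζ
  have := mem_cone_embed_image (S := {affineCoord (u 0)}) (y := u ζ)
  rw [image_singleton] at this
  exact this.2 ⟨(ho' ζ hζ).1, hx⟩

theorem exists_root_of_mem_wall (hfg : IsAdmissible f g) {b : Base} (hb : b ∈ wall f g) :
    ∃ z, (f.eval z = 0 ∨ g.eval z = 0) ∧ b.2.2 = ‖z‖ₑ := by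
  obtain ⟨hb, u, hu, hnc, hm⟩ := hb
  by_contra! hne
  exact hnc (isConstantDisc_of_forall_mem_openPart hfg hb hu
    (mem_openPart_of_maslovIndex_zero hfg hb hu hm) hne)

end ConstantDiscs

/-! ### Explicit discs over the wall. -/

section Wall

open Set Filter ComplexConjugate Metric

variable {f g : ℂ[X]}

/-- The lift of a tangent vector to homogeneous coordinates. -/
def tangentLift (t : Fin 5 → ℂ) : HomCoord := (![t 0, t 1, 0], ![t 2, t 3, 0], ![t 4, 0])

theorem affineDeriv_tangentLift (x t : Fin 5 → ℂ) :
    affineDeriv (homLift x) (tangentLift t) = t := by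
  rw [affineDeriv_apply]
  ext i
  fin_cases i <;> simp [homLift, tangentLift]

theorem continuous_tangentLift : Continuous tangentLift := by
  have h : ∀ i : Fin 5, Continuous fun t : Fin 5 → ℂ => t i := continuous_apply
  refine Continuous.prodMk (continuous_pi fun i => ?_) (Continuous.prodMk
    (continuous_pi fun i => ?_) (continuous_pi fun i => ?_)) <;> fin_cases i <;>
    first | exact h _ | exact continuous_const

theorem differentiable_homLift : Differentiable ℂ homLift := by
  have h : ∀ i : Fin 5, Differentiable ℂ fun t : Fin 5 → ℂ => t i := fun i =>
    (differentiable_apply (𝕜 := ℂ) i)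
  refine Differentiable.prodMk (differentiable_pi.2 fun i => ?_) (Differentiable.prodMk
    (differentiable_pi.2 fun i => ?_) (differentiable_pi.2 fun i => ?_)) <;> fin_cases i <;>
    first | exact h _ | exact differentiable_const _

theorem linearIndependent_euler_tangentLift {A B : ℂ[X]} {x : Fin 5 → ℂ} {t : Fin 3 → Fin 5 → ℂ}
    (h : volumeForm A B x t ≠ 0) :
    LinearIndependent ℂ (Sum.elim (euler (homLift x)) fun i => tangentLift (t i)) := by
  have ht : LinearIndependent ℂ t := by
    by_contra hc
    exact h ((volumeForm A B x).toAlternatingMap.map_linearDependent t hc)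
  have hL : (fun i => affineDeriv (homLift x) (tangentLift (t i))) = t :=
    funext fun i => affineDeriv_tangentLift x (t i)
  have h1 : LinearIndependent ℂ fun i => tangentLift (t i) :=
    LinearIndependent.of_comp (affineDeriv (homLift x) : HomCoord →ₗ[ℂ] Fin 5 → ℂ)
      (show LinearIndependent ℂ fun i => affineDeriv (homLift x) (tangentLift (t i)) by rwa [hL])
  refine (linearIndependent_euler (finiteCoord_subset (homLift_mem_finiteCoord x))).sum_type h1
    (Submodule.disjoint_def.2 fun v hv hv' => ?_)
  obtain ⟨c, rfl⟩ := (Submodule.mem_span_range_iff_exists_fun ℂ).1 hv'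
  have hker : Submodule.span ℂ (range (euler (homLift x))) ≤
      LinearMap.ker (affineDeriv (homLift x) : HomCoord →ₗ[ℂ] Fin 5 → ℂ) := by
    rw [Submodule.span_le]
    rintro _ ⟨i, rfl⟩
    exact affineDeriv_euler i
  have h4 : affineDeriv (homLift x) (∑ i, c i • tangentLift (t i)) = 0 := hker hv
  rw [map_sum] at h4
  simp only [map_smul, affineDeriv_tangentLift] at h4
  have h5 := Fintype.linearIndependent_iff.1 ht c h4
  simp [h5]

/-- A non-constant holomorphic disc with boundary on a regular fibre that has a complex frame of
constant volume shows that the fibre lies over the wall. -/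
theorem mem_wall_of_disc (hfg : IsAdmissible f g) {A B : ℂ[X]} (hAB : IsBezoutPair f g A B)
    {b : Base} (hb : b ∈ regularValues f g) {x : ℂ → Fin 5 → ℂ} (hx : Differentiable ℂ x)
    (hxc : ∀ ζ, x ζ ∈ conifold f g) (hxb : ∀ ζ ∈ sphere (0 : ℂ) 1, fibration (x ζ) = b)
    (hne : x 0 ≠ x 1) {t : Fin 3 → ℂ → Fin 5 → ℂ} (ht : ∀ i, Continuous (t i))
    (htc : ∀ ζ i, conifoldEqDeriv f g (x ζ) (t i ζ) = 0) {c : ℂ} (hc : c ≠ 0)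
    (hvol : ∀ ζ, volumeForm A B (x ζ) (fun i => t i ζ) = c) : b ∈ wall f g := by
  have ho := fun ζ => homLift_mem_cone (hxc ζ)
  have hcomp := fun ζ => cone_openPart_subset f g (ho ζ)
  have hz1 : ∀ ζ, (homLift (x ζ)).2.2 1 ≠ 0 := fun ζ => (homLift_mem_finiteCoord _).2.2
  have hfib : ∀ ζ ∈ sphere (0 : ℂ) 1, homLift (x ζ) ∈ cone (fiber f g b) := fun ζ hζ =>
    (mem_cone_fiber_iff_of_regular hfg hb).2 ⟨ho ζ, by rw [affineCoord_homLift, hxb ζ hζ]⟩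
  refine ⟨hb, fun ζ => homLift (x ζ), ⟨(differentiable_homLift.comp hx).diffContOnCl,
    fun ζ _ => (isSmoothPoint_iff hfg).2 ⟨hcomp ζ, hz1 ζ⟩, hfib⟩, ?_, ?_⟩
  · rintro ⟨p, hp⟩
    have h0 := hp 0 (by simp)
    have h1 := hp 1 (by simp)
    obtain ⟨k0, h0⟩ := mem_cone_iff.1 h0
    obtain ⟨k1, h1⟩ := mem_cone_iff.1 h1
    have h2 := embed_affineCoord (homLift_mem_finiteCoord (x 0))
    have h3 := embed_affineCoord (homLift_mem_finiteCoord (x 1))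
    rw [affineCoord_homLift] at h2 h3
    exact hne (embed_injective (h2.trans (h0.trans (h1.symm.trans h3.symm))))
  · have hnorm : ‖-(‖c‖ ^ 2 / c ^ 2 : ℂ)‖ = 1 := by
      have := norm_ne_zero_iff.2 hc
      rw [norm_neg, norm_div, norm_pow, norm_pow, Complex.norm_real, norm_norm,
        div_self (pow_ne_zero 2 this)]
    -- Real fibre frames have imaginary volume iρ, so det a = iρ/c and det²/|det|² is the constant
    -- -|c|²/c²; a constant argument has winding number 0.
    obtain ⟨φ, hφ⟩ : ∃ φ : ℝ, Complex.exp (φ * Complex.I) = -(‖c‖ ^ 2 / c ^ 2 : ℂ) :=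
      (Complex.norm_eq_one_iff _).1 hnorm
    refine ⟨fun i ζ => tangentLift (t i ζ),
      fun i => (continuous_tangentLift.comp (ht i)).continuousOn, fun ζ _ => ⟨fun i => ?_,
        linearIndependent_euler_tangentLift (by rw [hvol ζ]; exact hc)⟩,
      fun _ => φ, continuous_const, by simp, fun θ a ha => ?_⟩
    · obtain ⟨hwf, hx'⟩ := mem_cone_openPart.1 (ho ζ)
      rw [tangentConeAt_compactification hfg (hcomp ζ) (hz1 ζ), mem_ofPred_eq,
        homEqDeriv_eq_zero_iff hwf ((homEq_eq_zero_iff_conifold hwf).1 hx').1,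
        affineDeriv_tangentLift, affineCoord_homLift, htc]
    · set ζ := Complex.exp (θ * Complex.I) with hζ
      have hζs : ζ ∈ sphere (0 : ℂ) 1 := by simp [hζ, Complex.norm_exp_ofReal_mul_I]
      rw [tangentConeAt_cone_fiber hfg hb (hfib ζ hζs)] at ha
      simp only [mem_ofPred_eq, map_sum, map_smul, affineDeriv_tangentLift,
        affineCoord_homLift] at ha
      have hn := isNondegenerate_of_regular hfg (hxc ζ) (by rwa [hxb ζ hζs])
      obtain ⟨ρ, hρ⟩ := exists_volumeForm_eq hAB (hxc ζ) hn
        (fun j => (mem_fiberTangent.1 (ha j)).1) fun j => (mem_fiberTangent.1 (ha j)).2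
      rw [volumeForm_sum, hvol] at hρ
      have hdet : a.det = ρ * Complex.I / c := by rw [← hρ]; field_simp
      have hcn : (‖c‖ : ℂ) ≠ 0 := by simpa using hc
      have hsq : ((|ρ| : ℝ) : ℂ) ^ 2 = ρ ^ 2 := by
        rw [← Complex.ofReal_pow, sq_abs, Complex.ofReal_pow]
      rw [hφ, hdet]
      simp only [norm_div, norm_mul, Complex.norm_real, Complex.norm_I, Real.norm_eq_abs, mul_one,
        Complex.ofReal_div]
      rw [div_pow, mul_pow, Complex.I_sq, div_pow, hsq]
      field_simp

/-- At a root u₁v₁ = 0, so scaling both coordinates by ζ preserves the equation and, for |ζ| = 1,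
the moment map. Nondegeneracy makes the disc non-constant. -/
theorem mem_wall_of_left_root (hfg : IsAdmissible f g) {b : Base} (hb : b ∈ regularValues f g)
    {z : ℂ} (hz : f.eval z = 0) (hbz : b.2.2 = ‖z‖ₑ) : b ∈ wall f g := by
  obtain ⟨A, B, hAB⟩ := exists_isBezoutPair hfg
  obtain ⟨x, hx, hxb, rfl⟩ := exists_mem_conifold_fibration_eq f g
    (notMem_baseBoundary_of_regular hfg hb) hbz.symm
  have hn := isNondegenerate_of_regular hfg hx (by rwa [hxb])
  obtain ⟨e1, e2, e3⟩ := hx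
  rw [hz] at e1
  obtain ⟨s, s', hs⟩ := exists_solve hn.1 (f.derivative.eval (x 4))
  obtain ⟨d, d', hd⟩ := exists_solve hn.2 (g.derivative.eval (x 4))
  have hE := hAB (x 4)
  rw [hz] at hE
  -- The first frame vector is the torus direction (ζu₁, -ζv₁) divided by ζ, and the last is a lift
  -- of ∂/∂z multiplied by ζ. The factors cancel in the volume, and the frame stays independent at ζ
  -- = 0.
  refine mem_wall_of_disc hfg hAB hb (x := fun ζ => ![ζ * x 0, ζ * x 1, x 2, x 3, x 4])
    (t := ![fun _ => ![x 0, -x 1, 0, 0, 0], fun _ => ![0, 0, x 2, -x 3, 0],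
      fun ζ => ![s, s', ζ * d, ζ * d', ζ]]) (c := (x 4)⁻¹) ?_ ?_ ?_ ?_ ?_ ?_ (inv_ne_zero e3) ?_
  · refine differentiable_pi.2 fun i => ?_
    fin_cases i <;> simp
  · intro ζ
    refine ⟨?_, e2, e3⟩
    simp only [Matrix.cons_val, hz]
    linear_combination ζ ^ 2 * e1
  · intro ζ hζ
    have hζ1 : ‖ζ‖ = 1 := by simpa using hζ
    rw [← hxb, fibration_eq_iff]
    simp [momentMap, hζ1]
  · intro h
    have h0 := congrFun h 0
    have h1 := congrFun h 1
    simp at h0 h1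
    rcases hn.1 with h | h
    · exact h h0.symm
    · exact h h1.symm
  · intro i
    fin_cases i
    · exact continuous_const
    · exact continuous_const
    · refine continuous_pi fun i => ?_
      fin_cases i <;> simp <;> fun_prop
  · intro ζ i
    rw [conifoldEqDeriv_eq_zero_iff]
    fin_cases i <;> simp
    · ring
    · exact ⟨by linear_combination ζ * hs, by linear_combination ζ * hd⟩
  · intro ζ
    rw [volumeForm_apply]
    simp [volumeCoord_apply, Matrix.det_fin_three]
    linear_combination (x 4)⁻¹ * (ζ ^ 2 * (x 2 * A.eval (x 4) * x 3 + x 2 * B.eval (x 4) * d' +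
      B.eval (x 4) * x 3 * d) * e1 + B.eval (x 4) * x 2 * x 3 * hs +
      B.eval (x 4) * f.derivative.eval (x 4) * e2 + hE)

theorem mem_wall_of_right_root (hfg : IsAdmissible f g) {b : Base} (hb : b ∈ regularValues f g)
    {z : ℂ} (hz : g.eval z = 0) (hbz : b.2.2 = ‖z‖ₑ) : b ∈ wall f g := by
  obtain ⟨A, B, hAB⟩ := exists_isBezoutPair hfg
  obtain ⟨x, hx, hxb, rfl⟩ := exists_mem_conifold_fibration_eq f g
    (notMem_baseBoundary_of_regular hfg hb) hbz.symm
  have hn := isNondegenerate_of_regular hfg hx (by rwa [hxb])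
  obtain ⟨e1, e2, e3⟩ := hx
  rw [hz] at e2
  obtain ⟨s, s', hs⟩ := exists_solve hn.2 (g.derivative.eval (x 4))
  obtain ⟨d, d', hd⟩ := exists_solve hn.1 (f.derivative.eval (x 4))
  have hE := hAB (x 4)
  rw [hz] at hE
  refine mem_wall_of_disc hfg hAB hb (x := fun ζ => ![x 0, x 1, ζ * x 2, ζ * x 3, x 4])
    (t := ![fun _ => ![x 0, -x 1, 0, 0, 0], fun _ => ![0, 0, x 2, -x 3, 0],
      fun ζ => ![ζ * d, ζ * d', s, s', ζ]]) (c := (x 4)⁻¹) ?_ ?_ ?_ ?_ ?_ ?_ (inv_ne_zero e3) ?_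
  · refine differentiable_pi.2 fun i => ?_
    fin_cases i <;> simp
  · intro ζ
    refine ⟨e1, ?_, e3⟩
    simp only [Matrix.cons_val, hz]
    linear_combination ζ ^ 2 * e2
  · intro ζ hζ
    have hζ1 : ‖ζ‖ = 1 := by simpa using hζ
    rw [← hxb, fibration_eq_iff]
    simp [momentMap, hζ1]
  · intro h
    have h0 := congrFun h 2
    have h1 := congrFun h 3
    simp at h0 h1
    rcases hn.2 with h | h
    · exact h h0.symm
    · exact h h1.symm
  · intro i
    fin_cases i
    · exact continuous_const
    · exact continuous_const
    · refine continuous_pi fun i => ?_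
      fin_cases i <;> simp <;> fun_prop
  · intro ζ i
    rw [conifoldEqDeriv_eq_zero_iff]
    fin_cases i <;> simp
    · ring
    · exact ⟨by linear_combination ζ * hd, by linear_combination ζ * hs⟩
  · intro ζ
    rw [volumeForm_apply]
    simp [volumeCoord_apply, Matrix.det_fin_three]
    linear_combination (x 4)⁻¹ * (ζ ^ 2 * (x 0 * A.eval (x 4) * x 1 + x 0 * B.eval (x 4) * d' +
      B.eval (x 4) * x 1 * d) * e2 + B.eval (x 4) * x 0 * x 1 * hs +
      B.eval (x 4) * g.derivative.eval (x 4) * e1 + hE)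

theorem mem_wall_iff (hfg : IsAdmissible f g) {b : Base} : b ∈ wall f g ↔
    b ∈ regularValues f g ∧ ∃ z, (f.eval z = 0 ∨ g.eval z = 0) ∧ b.2.2 = ‖z‖ₑ := by
  refine ⟨fun h => ⟨h.1, exists_root_of_mem_wall hfg h⟩, ?_⟩
  rintro ⟨hb, z, hz | hz, hbz⟩
  · exact mem_wall_of_left_root hfg hb hz hbz
  · exact mem_wall_of_right_root hfg hb hz hbz

end Wall

/-! ### From the lists of roots to squarefreeness. -/

section Roots

/-- As many distinct roots as the degree allows must exhaust the multiset of roots and leave no room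
for multiplicity. -/
theorem toFinset_roots_eq_image {ι : Type*} [Fintype ι] {p : ℂ[X]} (hp : p ≠ 0)
    (hd : p.natDegree ≤ Fintype.card ι) {r : ι → ℂ} (hr : Function.Injective r)
    (hroot : ∀ i, p.IsRoot (r i)) :
    p.roots.toFinset = Finset.univ.image r ∧ p.roots.Nodup := by
  have h1 : Finset.univ.image r ⊆ p.roots.toFinset := by
    intro z hz
    obtain ⟨i, -, rfl⟩ := Finset.mem_image.1 hz
    exact Multiset.mem_toFinset.2 ((Polynomial.mem_roots hp).2 (hroot i))
  have h2 : (Finset.univ.image r).card = Fintype.card ι :=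
    Finset.card_image_of_injective _ hr
  have h3 : p.roots.toFinset.card ≤ p.roots.card := Multiset.toFinset_card_le _
  have h4 := p.card_roots'
  have h5 := Finset.card_le_card h1
  refine ⟨(Finset.eq_of_subset_of_card_le h1 (by omega)).symm, ?_⟩
  exact Multiset.toFinset_card_eq_card_iff_nodup.1 (by omega)

theorem eval_eq_zero_iff_exists {ι : Type*} [Fintype ι] {p : ℂ[X]} (hp : p ≠ 0)
    (hd : p.natDegree ≤ Fintype.card ι) {r : ι → ℂ} (hr : Function.Injective r)
    (hroot : ∀ i, p.IsRoot (r i)) {z : ℂ} : p.eval z = 0 ↔ ∃ i, r i = z := by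
  have h := (toFinset_roots_eq_image hp hd hr hroot).1
  have h1 : z ∈ p.roots.toFinset ↔ z ∈ Finset.univ.image r := by rw [h]
  simpa [hp] using h1

theorem isAdmissible_of_roots {k l : ℕ} (hk : 1 ≤ k) (hl : 1 ≤ l) {f g : ℂ[X]}
    (hf : f.natDegree = k) (hg : g.natDegree = l) {r : Fin k → ℂ} {s : Fin l → ℂ}
    (hfr : ∀ i, f.IsRoot (r i)) (hgs : ∀ j, g.IsRoot (s j))
    (hr : Function.Injective r) (hs : Function.Injective s) (hrs : ∀ i j, r i ≠ s j)
    (hr0 : ∀ i, r i ≠ 0) (hs0 : ∀ j, s j ≠ 0) : IsAdmissible f g := by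
  have hf0 : f ≠ 0 := Polynomial.ne_zero_of_natDegree_gt (n := 0) (by omega)
  have hg0 : g ≠ 0 := Polynomial.ne_zero_of_natDegree_gt (n := 0) (by omega)
  refine ⟨?_, fun h => ?_, fun h => ?_, by omega, by omega⟩
  · have hfg := mul_ne_zero hf0 hg0
    -- The concatenated list of roots of fg has length k + l = deg(fg), so simplicity and
    -- disjointness of the roots are encoded together in separability.
    refine (Polynomial.nodup_roots_iff_of_splits hfg (IsAlgClosed.splits _)).1
      (toFinset_roots_eq_image (r := Sum.elim r s) hfg ?_ (hr.sumElim hs hrs) ?_).2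
    · simp [Polynomial.natDegree_mul hf0 hg0, hf, hg]
    · rintro (i | j)
      · exact Polynomial.root_mul_right_of_isRoot _ (hfr i)
      · exact Polynomial.root_mul_left_of_isRoot _ (hgs j)
  · obtain ⟨i, hi⟩ := (eval_eq_zero_iff_exists hf0 (by simp [hf]) hr hfr).1 h
    exact hr0 i hi
  · obtain ⟨j, hj⟩ := (eval_eq_zero_iff_exists hg0 (by simp [hg]) hs hgs).1 h
    exact hs0 j hj

end Roots

end OrbConifold

end

theorem mainTheorem12 (k l : ℕ) (hk : 1 ≤ k) (hl : 1 ≤ l) (f g : Polynomial ℂ)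
    (hf : f.natDegree = k) (hg : g.natDegree = l) (r : Fin k → ℂ) (s : Fin l → ℂ)
    (hfr : ∀ i, f.IsRoot (r i)) (hgs : ∀ j, g.IsRoot (s j))
    (hr : Function.Injective r) (hs : Function.Injective s) (hrs : ∀ i j, r i ≠ s j)
    (hr0 : ∀ i, r i ≠ 0) (hs0 : ∀ j, s j ≠ 0) :
    OrbConifold.discriminant f g =
      OrbConifold.baseBoundary ∪
        (⋃ i, {b : OrbConifold.Base | b.1 = 0 ∧ b.2.2 = ‖r i‖ₑ}) ∪
        (⋃ j, {b : OrbConifold.Base | b.2.1 = 0 ∧ b.2.2 = ‖s j‖ₑ}) ∧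
    (∃ Ω, OrbConifold.IsLogVolumeForm f g Ω) ∧
    (∀ Ω, OrbConifold.IsLogVolumeForm f g Ω →
      OrbConifold.IsNowhereVanishing f g Ω ∧
      OrbConifold.HasPolesAlongBoundary f g Ω ∧
      OrbConifold.IsSpecialLagrangianFibration f g Ω) ∧
    OrbConifold.wall f g =
      OrbConifold.regularValues f g ∩
        ((⋃ i, {b : OrbConifold.Base | b.2.2 = ‖r i‖ₑ}) ∪
          (⋃ j, {b : OrbConifold.Base | b.2.2 = ‖s j‖ₑ})) := by
  have hfg := OrbConifold.isAdmissible_of_roots hk hl hf hg hfr hgs hr hs hrs hr0 hs0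
  have hf0 : f ≠ 0 := Polynomial.ne_zero_of_natDegree_gt (n := 0) (by omega)
  have hg0 : g ≠ 0 := Polynomial.ne_zero_of_natDegree_gt (n := 0) (by omega)
  have hfz : ∀ z, f.eval z = 0 ↔ ∃ i, r i = z := fun z =>
    OrbConifold.eval_eq_zero_iff_exists hf0 (by simp [hf]) hr hfr
  have hgz : ∀ z, g.eval z = 0 ↔ ∃ j, s j = z := fun z =>
    OrbConifold.eval_eq_zero_iff_exists hg0 (by simp [hg]) hs hgs
  obtain ⟨A, B, hAB⟩ := OrbConifold.exists_isBezoutPair hfg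
  refine ⟨?_, ⟨_, OrbConifold.isLogVolumeForm_volumeForm hfg hAB⟩, fun Ω hΩ =>
    ⟨hΩ.isNowhereVanishing hfg, hΩ.hasPolesAlongBoundary hfg,
      hΩ.isSpecialLagrangianFibration hfg⟩, ?_⟩
  · ext b
    rw [OrbConifold.mem_discriminant_iff_roots hfg]
    simp [hfz, hgz, or_assoc]
  · ext b
    rw [OrbConifold.mem_wall_iff hfg]
    refine and_congr_right fun _ => ?_
    simp only [hfz, hgz, Set.mem_union, Set.mem_iUnion, Set.mem_ofPred_eq]
    constructor
    · rintro ⟨z, ⟨i, rfl⟩ | ⟨j, rfl⟩, h⟩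
      · exact Or.inl ⟨i, h⟩
      · exact Or.inr ⟨j, h⟩
    · rintro (⟨i, h⟩ | ⟨j, h⟩)
      · exact ⟨_, Or.inl ⟨i, rfl⟩, h⟩
      · exact ⟨_, Or.inr ⟨j, rfl⟩, h⟩
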